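/- Let $\delta\ge 3$ and let $\mathcal G$ be the (infinite) tree in which every node has degree $\delta$. A rumor starts at a node $v_1$ at time $0$; an informed node $i$ passes it to an adjacent node $j$ after a time $\tau_{ij}$, where the $\tau_{ij}$ are independent exponential random variables of mean $1$, and informed nodes stay informed. Let $G_n$ be the network of informed nodes when exactly $n$ nodes are informed. Given $G_n=\mathcal G_n$, the maximum likelihood estimator $\hat V_n$ picks, uniformly at random, one of the nodes $v$ of $\mathcal G_n$ that maximize the probability $\Pr\{\mathcal G_n\mid v\}$ of observing $\mathcal G_n$ when the rumor starts at $v$. Put $\mathbf D_n(d)=\Pr\{d_{\mathcal G}(\hat V_n,v_1)=d\}$, where $d_{\mathcal G}$ is the graph distance. Then for every $d\ge 1$ the limit $\lim_{n\to\infty}\mathbf D_n(d)$ exists, and for every $m\ge d+1$ $$0\le \lim_{n\to\infty}\mathbf D_n(d)-g(\delta,d,m)\le \epsilon_m,\qquad \epsilon_m=e^2(8+5m+m^2)\,2^{-m+3},$$ where $$g(\delta,d,m)=\delta(\delta-1)^{d-1}\sum_{k=d+1}^{m}p_1(\delta,d,k)\,p_2(\delta,k),$$ $$p_1(\delta,d,k)=\frac{2}{(\delta-2)^d}\,\frac{\left(\frac1{\delta-2}\right)^{\overline{k-1}}}{\left(\frac2{\delta-2}\right)^{\overline{k}}}\;\zeta_{k-2}^{d-1}\!\left(\frac1{\delta-2}\right),$$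 $$p_2(\delta,k)=I_{1/2}\!\left(k-1+\frac1{\delta-2},\frac{\delta-1}{\delta-2}\right)-(\delta-1)\,I_{1/2}\!\left(k-1+\frac{\delta-1}{\delta-2},\frac1{\delta-2}\right).$$ Here $x^{\overline k}=x(x+1)\cdots(x+k-1)$, $\;\zeta_k^d(x)=\sum_{1\le j_1<\cdots<j_d\le k}\prod_{i=1}^d\frac1{j_i+x}$ with $\zeta_k^0(x)=1$, and $I_x(a,b)=\frac{\Gamma(a+b)}{\Gamma(a)\Gamma(b)}\int_0^x t^{a-1}(1-t)^{b-1}\,dt$. -/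

import Mathlib

open MeasureTheory ProbabilityTheory Filter Topology

namespace RumorSource

noncomputable section

/-! ### The spreading model on a graph -/

section Spreading

variable {V Ω : Type*} {G : SimpleGraph V}

/-- The time at which the rumor started at time `0` by the source `s` reaches the node `w`, where
`τ e ω` is the spreading time along the directed edge `e` (from `e.fst` to `e.snd`): the least total
spreading time over all paths from `s` to `w`. In a tree there is exactly one such path. -/
def infectionTime (τ : G.Dart → Ω → ℝ) (s w : V) (ω : Ω) : ℝ :=
  ⨅ p : G.Path s w, (p.1.darts.map fun e => τ e ω).sum

/-- The event that the network of `S.card` infected nodes is exactly `S` when the source is `s`: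
at some time `t`, the infected nodes are exactly the elements of `S`. For `S.card = n` this is the
event `G_n = S` (a subgraph of a tree is identified with its set of nodes; as infected
sets grow with time, at most one `S` of each cardinality occurs). -/
def observed (τ : G.Dart → Ω → ℝ) (s : V) (S : Finset V) : Set Ω :=
  {ω | ∃ t : ℝ, ∀ w : V, infectionTime τ s w ω ≤ t ↔ w ∈ S}

variable [MeasurableSpace Ω]

open Classical in
/-- The set of maximum likelihood candidates for an observed network `S`: the nodes `v` of `S` which
maximize the probability of observing `S` when `v` is the source. -/
def mlCandidates (P : Measure Ω) (τ : G.Dart → Ω → ℝ) (S : Finset V) : Finset V :=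
  S.filter fun v => ∀ u ∈ S, P (observed τ u S) ≤ P (observed τ v S)

open Classical in
/-- `X` is the output of the maximum likelihood estimator, with ties broken uniformly at random, when
the network of `n` infected nodes spread from the source `s` is observed: `X` is a random node whose
conditional law, given that the observed network is `S`, is uniform on the candidates of `S`. -/
def IsMLEstimate (P : Measure Ω) (τ : G.Dart → Ω → ℝ) (s : V) (n : ℕ) (X : Ω → V) : Prop :=
  (∀ v : V, MeasurableSet {ω | X ω = v}) ∧
  ∀ (S : Finset V) (v : V), S.card = n →
    P (observed τ s S ∩ {ω | X ω = v}) =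
      P (observed τ s S) *
        (if v ∈ mlCandidates P τ S then ((mlCandidates P τ S).card : ENNReal)⁻¹ else 0)

/-- The probability that the random node `X` is at distance `d` from `s`. -/
def distProb (G : SimpleGraph V) (P : Measure Ω) (s : V) (X : Ω → V) (d : ℕ) : ℝ :=
  P.real {ω | G.dist (X ω) s = d}

end Spreading

/-! ### The explicit bound -/

/-- The regularized incomplete beta function `I_x(a, b)`. -/
def regIncBeta (x a b : ℝ) : ℝ :=
  Real.Gamma (a + b) / (Real.Gamma a * Real.Gamma b) *
    ∫ t in (0 : ℝ)..x, t ^ (a - 1) * (1 - t) ^ (b - 1)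

/-- The rising factorial `x (x + 1) ⋯ (x + k - 1)`. -/
def risingFactorial (x : ℝ) (k : ℕ) : ℝ :=
  ∏ i ∈ Finset.range k, (x + i)

/-- The shifted multiple harmonic sum `ζ_k^d(x)`: the sum over `1 ≤ j₁ < ⋯ < j_d ≤ k`, that is over
the `d`-element subsets of `{1, …, k}`, of the products of the `1 / (j_i + x)`. -/
def shiftedHarmonic (k d : ℕ) (x : ℝ) : ℝ :=
  ∑ J ∈ (Finset.Icc 1 k).powersetCard d, ∏ j ∈ J, 1 / ((j : ℝ) + x)

def p₁ (δ d k : ℕ) : ℝ :=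
  2 / ((δ : ℝ) - 2) ^ d *
    (risingFactorial (1 / ((δ : ℝ) - 2)) (k - 1) / risingFactorial (2 / ((δ : ℝ) - 2)) k) *
    shiftedHarmonic (k - 2) (d - 1) (1 / ((δ : ℝ) - 2))

def p₂ (δ k : ℕ) : ℝ :=
  regIncBeta (1 / 2) ((k : ℝ) - 1 + 1 / ((δ : ℝ) - 2)) (((δ : ℝ) - 1) / ((δ : ℝ) - 2)) -
    ((δ : ℝ) - 1) *
      regIncBeta (1 / 2) ((k : ℝ) - 1 + ((δ : ℝ) - 1) / ((δ : ℝ) - 2)) (1 / ((δ : ℝ) - 2))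

/-- The lower bound `g(δ, d, m)`. -/
def g (δ d m : ℕ) : ℝ :=
  (δ : ℝ) * ((δ : ℝ) - 1) ^ (d - 1) * ∑ k ∈ Finset.Icc (d + 1) m, p₁ δ d k * p₂ δ k

/-- The error term `ε_m`. -/
def eps (m : ℕ) : ℝ :=
  Real.exp 1 ^ 2 * (8 + 5 * (m : ℝ) + (m : ℝ) ^ 2) * (2 : ℝ) ^ (-(m : ℤ) + 3)

end

end RumorSource

/-! Exponential clocks have no memory, so whatever the informed network is, the next informed node
is uniform on its boundary. In a `δ`-regular tree the boundary of `k` connected nodes has `k (δ - 2)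
+ 2` nodes, independently of the shape. Hence all orders in which the first `n + 1` nodes can be
reached are equally likely (`edgeLaw_historyEvent_eq`), and the likelihood of a source `v` is
proportional to the number of orders growing `{v}` to the observed set `S`.

Moving the source across an edge multiplies this number by the ratio of the sizes of the two sides
of the edge (`growthRatio_mul_card_branch`). The maximizers are therefore the centroids of `S`: the
nodes none of whose branches contains more than half of `S`. There are one or two of them, and the
tie-breaking weight of `v` equals one minus a sum of terms each depending on a single branch
(`candidate_weight`). By linearity, the probability of estimating `v` only needs the law of each
branch size separately.

Put `c = δ - 2`. A branch of `j` nodes out of `k` owns `j c + 1` of the `k c + 2` boundary nodes, so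
its size is a Pólya urn, that is, a mixture of Bernoulli walks over a Beta law (`urn_eq_integral`).
By the law of large numbers the chance that the branch ends with more than half of the nodes tends
to the Beta mass above `1 / 2`, an incomplete beta function. When `v` joins a network of `k` nodes,
one of its branches has `k` nodes and the other `c + 1` are empty; this gives the limit `p₂`
(`tendsto_entryProb`).

It remains to average over the moment at which `v` joins. Until then its ancestors must be added one
after another, each step hitting the next ancestor with probability `1 / (k c + 2)`; summing over
the sizes at which the ancestors are hit yields `p₁` (`estimateProb_eq_sum`, `p₁_eq_entryWeight`).
Dominated convergence turns the limit into a series with nonnegative terms of which `g` is a partial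
sum. In the tail, `p₁` times the number of nodes at the given distance is at most one, and `p₂`
decays like `k 2⁻ᵏ`, which is far below the claimed error. -/

namespace RumorSource

/-! ### Trees: geodesics, convex sets, branches and boundaries. -/

section TreeGeometry

variable {V : Type*} {G : SimpleGraph V}

theorem exists_adj_dist_add_one (hG : G.IsTree) {s x : V} (h : x ≠ s) :
    ∃ z, G.Adj x z ∧ G.dist s z + 1 = G.dist s x := by
  obtain ⟨p, hp⟩ := hG.connected.exists_walk_length_eq_dist x s
  cases p with
  | nil => exact absurd rfl h
  | cons hadj q =>
    rename_i z
    refine ⟨z, hadj, ?_⟩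
    have h1 := SimpleGraph.dist_le q
    simp only [SimpleGraph.Walk.length_cons] at hp
    have h2 := hG.dist_eq_dist_add_one_of_adj s hadj
    rw [SimpleGraph.dist_comm] at h1 hp
    omega

/-- Appending `x` to shortest walks ending at `z` and `z'` gives two shortest walks to `x`. They are
paths, so they coincide in a tree and have the same penultimate node. -/
theorem eq_of_adj_of_dist_add_one (hG : G.IsTree) {s x z z' : V} (hz : G.Adj x z)
    (hz' : G.Adj x z') (h : G.dist s z + 1 = G.dist s x) (h' : G.dist s z' + 1 = G.dist s x) :
    z = z' := by
  obtain ⟨p, hp⟩ := hG.connected.exists_walk_length_eq_dist s z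
  obtain ⟨p', hp'⟩ := hG.connected.exists_walk_length_eq_dist s z'
  have hq : (p.concat hz.symm).IsPath :=
    SimpleGraph.Walk.isPath_of_length_eq_dist _ (by simp [hp, h])
  have hq' : (p'.concat hz'.symm).IsPath :=
    SimpleGraph.Walk.isPath_of_length_eq_dist _ (by simp [hp', h'])
  have h1 := (hG.existsUnique_path s x).unique hq hq'
  have h2 := congrArg SimpleGraph.Walk.penultimate h1
  simpa using h2

open Classical in
/-- The neighbor of `x` on the way to `s` (and `s` itself if `x = s`). -/
noncomputable def toward (G : SimpleGraph V) (s x : V) : V :=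
  if h : ∃ z, G.Adj x z ∧ G.dist s z + 1 = G.dist s x then h.choose else x

theorem toward_self (G : SimpleGraph V) (s : V) : toward G s s = s := by
  unfold toward
  rw [dif_neg]
  rintro ⟨z, -, h⟩
  simp at h

theorem adj_toward (hG : G.IsTree) {s x : V} (h : x ≠ s) : G.Adj x (toward G s x) := by
  unfold toward
  rw [dif_pos (exists_adj_dist_add_one hG h)]
  exact (exists_adj_dist_add_one hG h).choose_spec.1

theorem dist_toward (hG : G.IsTree) {s x : V} (h : x ≠ s) :
    G.dist s (toward G s x) + 1 = G.dist s x := by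
  unfold toward
  rw [dif_pos (exists_adj_dist_add_one hG h)]
  exact (exists_adj_dist_add_one hG h).choose_spec.2

theorem toward_eq_iff (hG : G.IsTree) {s x z : V} (hz : G.Adj x z) :
    toward G s x = z ↔ G.dist s z + 1 = G.dist s x := by
  by_cases h : x = s
  · subst h
    simp [toward_self, hz.ne]
  · constructor
    · rintro rfl
      exact dist_toward hG h
    · intro h'
      exact eq_of_adj_of_dist_add_one hG (adj_toward hG h) hz (dist_toward hG h) h'

theorem toward_eq_or_toward_eq (hG : G.IsTree) (s : V) {x z : V} (hz : G.Adj x z) :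
    toward G s x = z ∨ toward G s z = x := by
  rw [toward_eq_iff hG hz, toward_eq_iff hG hz.symm]
  have := hG.dist_eq_dist_add_one_of_adj s hz
  omega

theorem not_toward_eq_and_toward_eq (hG : G.IsTree) (s : V) {x z : V} (hz : G.Adj x z)
    (h : toward G s x = z) (h' : toward G s z = x) : False := by
  rw [toward_eq_iff hG hz] at h
  rw [toward_eq_iff hG hz.symm] at h'
  omega

theorem dist_adj {x z : V} (hz : G.Adj x z) : G.dist x z = 1 :=
  SimpleGraph.dist_eq_one_iff_adj.2 hz

theorem eq_of_dist_eq_zero (hG : G.IsTree) {x z : V} (h : G.dist x z = 0) : x = z :=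
  (hG.connected.dist_eq_zero_iff).1 h

/-- If `v` is between `u` and `b ≠ v`, then the way from `b` to `u` starts like the one to `v`. -/
theorem toward_eq_toward_of_between (hG : G.IsTree) {u v b : V} (hb : b ≠ v)
    (h : G.dist u v + G.dist v b = G.dist u b) : toward G u b = toward G v b := by
  have h1 := dist_toward hG hb
  have h2 := adj_toward hG hb
  rw [toward_eq_iff hG h2]
  have h3 := hG.connected.dist_triangle (u := u) (v := v) (w := toward G v b)
  have h4 := hG.dist_eq_dist_add_one_of_adj u h2
  omega

/-- The only edge between the two sides of the edge `uv` is `uv`. -/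
theorem eq_and_eq_of_adj_of_sides (hG : G.IsTree) {u v a b : V} (huv : G.Adj u v)
    (hab : G.Adj a b) (ha : toward G a v = u) (hb : toward G b u = v) : a = u ∧ b = v := by
  rw [toward_eq_iff hG huv.symm] at ha
  rw [toward_eq_iff hG huv] at hb
  have c1 : G.dist a v = G.dist v a := SimpleGraph.dist_comm
  have c2 : G.dist a u = G.dist u a := SimpleGraph.dist_comm
  have c3 : G.dist b v = G.dist v b := SimpleGraph.dist_comm
  have c4 : G.dist b u = G.dist u b := SimpleGraph.dist_comm
  have d1 := hG.dist_eq_dist_add_one_of_adj u hab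
  have d2 := hG.dist_eq_dist_add_one_of_adj v hab
  have d3 := dist_adj huv
  have key : b = v := by
    by_contra hbv
    -- If `b ≠ v`, the neighbors of `b` toward `u` and toward `v` coincide. The distances identify
    -- this neighbor as `a`, which is farther from `v` than `b` is.
    have h1 := toward_eq_toward_of_between hG (u := u) hbv (by omega)
    have h2 : toward G u b = a := (toward_eq_iff hG hab.symm).2 (by omega)
    have h3 := dist_toward hG hbv
    rw [← h1, h2] at h3
    omega
  subst key
  refine ⟨eq_of_dist_eq_zero hG ?_, rfl⟩
  have := SimpleGraph.dist_self (G := G) (v := b)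
  omega

/-- A set of nodes which contains all nodes between any two of its nodes. -/
def GeodConvex (G : SimpleGraph V) (S : Finset V) : Prop :=
  ∀ x ∈ S, ∀ y ∈ S, ∀ z, G.dist x z + G.dist z y = G.dist x y → z ∈ S

theorem geodConvex_singleton (hG : G.IsTree) (s : V) : GeodConvex G {s} := by
  intro x hx y hy z h
  simp only [Finset.mem_singleton] at hx hy ⊢
  subst hx hy
  rw [SimpleGraph.dist_self] at h
  exact eq_of_dist_eq_zero hG (by omega)

theorem GeodConvex.toward_mem (hG : G.IsTree) {S : Finset V} (hS : GeodConvex G S) {s x : V}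
    (hs : s ∈ S) (hx : x ∈ S) : toward G s x ∈ S := by
  by_cases h : x = s
  · subst h; rwa [toward_self]
  · refine hS s hs x hx _ ?_
    rw [← dist_toward hG h, dist_adj (adj_toward hG h).symm]

/-- One endpoint of the edge `ax` points to the other; if it were `a`, convexity would force `x ∈
S`. -/
theorem GeodConvex.toward_eq (hG : G.IsTree) {S : Finset V} (hS : GeodConvex G S) {s x a : V}
    (hs : s ∈ S) (hx : x ∉ S) (ha : a ∈ S) (hax : G.Adj a x) : toward G s x = a := by
  rcases toward_eq_or_toward_eq hG s hax with h | h
  · exact absurd (h ▸ hS.toward_mem hG hs ha) hx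
  · exact h

open Classical in
-- Every way from `x` into `S` starts through `a`, so a node other than `x` between `x` and `y ∈ S`
-- is already between `a` and `y`.
theorem GeodConvex.insert_of_adj (hG : G.IsTree) {S : Finset V} (hS : GeodConvex G S) {x a : V}
    (hx : x ∉ S) (ha : a ∈ S) (hax : G.Adj a x) : GeodConvex G (insert x S) := by
  have key : ∀ y ∈ S, ∀ z, G.dist x z + G.dist z y = G.dist x y → z ∈ insert x S := by
    intro y hy z h
    by_cases hzx : z = x
    · simp [hzx]
    rw [Finset.mem_insert]
    right
    have h1 : toward G y x = a := hS.toward_eq hG hy hx ha hax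
    have e1 : G.dist y x = G.dist x y := SimpleGraph.dist_comm
    have e2 : G.dist y z = G.dist z y := SimpleGraph.dist_comm
    have e3 : G.dist x z = G.dist z x := SimpleGraph.dist_comm
    have e4 : G.dist z a = G.dist a z := SimpleGraph.dist_comm
    have e5 : G.dist y a = G.dist a y := SimpleGraph.dist_comm
    have h2 : toward G y x = toward G z x :=
      toward_eq_toward_of_between hG (Ne.symm hzx) (by omega)
    have h3 := (toward_eq_iff hG hax.symm).1 h1
    have h4 := (toward_eq_iff hG hax.symm).1 (h2 ▸ h1)
    exact hS a ha y hy z (by omega)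
  intro p hp q hq z h
  rw [Finset.mem_insert] at hp hq
  rcases hp with rfl | hp <;> rcases hq with rfl | hq
  · rw [SimpleGraph.dist_self] at h
    rw [eq_of_dist_eq_zero hG (show G.dist q z = 0 by omega)]
    simp
  · exact key q hq z h
  · refine key p hp z ?_
    rw [SimpleGraph.dist_comm (u := q) (v := z), SimpleGraph.dist_comm (u := z) (v := p),
      SimpleGraph.dist_comm (u := q) (v := p)]
    omega
  · exact Finset.mem_insert_of_mem (hS p hp q hq z h)

open Classical in
/-- The nodes of `S` reached from `v` through its neighbor `u`. -/
noncomputable def branch (G : SimpleGraph V) (S : Finset V) (v u : V) : Finset V :=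
  S.filter fun y => toward G y v = u

theorem mem_branch {S : Finset V} {v u y : V} :
    y ∈ branch G S v u ↔ y ∈ S ∧ toward G y v = u := by
  simp [branch]

/-- Going from `y` to `v` one enters the branch of `u` at `v` only by passing through `u`. -/
theorem toward_toward_eq_iff (hG : G.IsTree) {v u y : V} (hu : G.Adj v u) (hyv : y ≠ v)
    (hyu : y ≠ u) : toward G (toward G v y) v = u ↔ toward G y v = u := by
  have h1 := adj_toward hG hyv
  constructor
  · intro h
    rcases toward_eq_or_toward_eq hG y hu with h' | h'
    · exact h'
    · exact absurd (eq_and_eq_of_adj_of_sides hG hu.symm h1.symm h h').2 hyv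
  · intro h
    rcases toward_eq_or_toward_eq hG (toward G v y) hu with h' | h'
    · exact h'
    · exact absurd (eq_and_eq_of_adj_of_sides hG hu.symm h1 h h').1 hyu

theorem card_branch_add_card_branch (hG : G.IsTree) (S : Finset V) {u v : V} (huv : G.Adj u v) :
    (branch G S v u).card + (branch G S u v).card = S.card := by
  classical
  rw [← Finset.card_union_of_disjoint]
  · congr 1
    ext y
    simp only [Finset.mem_union, mem_branch, ← and_or_left, and_iff_left_iff_imp]
    intro _
    exact (toward_eq_or_toward_eq hG y huv).symm
  · rw [Finset.disjoint_left]
    intro y hy hy'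
    exact not_toward_eq_and_toward_eq hG y huv (mem_branch.1 hy').2 (mem_branch.1 hy).2

theorem toward_of_adj (hG : G.IsTree) {u v : V} (huv : G.Adj u v) : toward G u v = u := by
  rw [toward_eq_iff hG huv.symm, SimpleGraph.dist_self, dist_adj huv]

variable [G.LocallyFinite]

open Classical in
/-- The nodes outside `S` with a neighbor in `S`. -/
noncomputable def boundary (G : SimpleGraph V) [G.LocallyFinite] (S : Finset V) : Finset V :=
  (S.biUnion fun v => G.neighborFinset v) \ S

theorem mem_boundary {S : Finset V} {x : V} :
    x ∈ boundary G S ↔ x ∉ S ∧ ∃ a ∈ S, G.Adj a x := by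
  simp [boundary, and_comm]

open Classical in
theorem GeodConvex.insert_boundary (hG : G.IsTree) {S : Finset V} (hS : GeodConvex G S) {x : V}
    (hx : x ∈ boundary G S) : GeodConvex G (insert x S) := by
  obtain ⟨h, a, ha, hax⟩ := mem_boundary.1 hx
  exact hS.insert_of_adj hG h ha hax

theorem GeodConvex.toward_mem_of_boundary (hG : G.IsTree) {S : Finset V} (hS : GeodConvex G S)
    {s x : V} (hs : s ∈ S) (hx : x ∈ boundary G S) : toward G s x ∈ S := by
  obtain ⟨h, a, ha, hax⟩ := mem_boundary.1 hx
  rwa [hS.toward_eq hG hs h ha hax]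

theorem ne_of_mem_boundary {S : Finset V} {s x : V} (hs : s ∈ S) (hx : x ∈ boundary G S) :
    x ≠ s := by
  rintro rfl
  exact (mem_boundary.1 hx).1 hs

theorem mem_boundary_iff_toward (hG : G.IsTree) {S : Finset V} (hS : GeodConvex G S) {s x : V}
    (hs : s ∈ S) : x ∈ boundary G S ↔ x ∉ S ∧ toward G s x ∈ S := by
  constructor
  · intro h
    exact ⟨(mem_boundary.1 h).1, hS.toward_mem_of_boundary hG hs h⟩
  · rintro ⟨h, h'⟩
    refine mem_boundary.2 ⟨h, _, h', (adj_toward hG ?_).symm⟩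
    rintro rfl
    exact h hs

open Classical in
-- Adding `x` removes only `x` from the boundary and creates only children of `x`; the children are
-- filtered out here because they contribute trivially to the probabilities below.
theorem boundary_insert_filter (hG : G.IsTree) {S : Finset V} (hS : GeodConvex G S) {s x : V}
    (hs : s ∈ S) (hx : x ∈ boundary G S) :
    (boundary G (insert x S)).filter (fun y => toward G s y ≠ x) = (boundary G S).erase x := by
  ext y
  rw [Finset.mem_filter, Finset.mem_erase,
    mem_boundary_iff_toward hG (hS.insert_boundary hG hx) (Finset.mem_insert_of_mem hs),
    mem_boundary_iff_toward hG hS hs]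
  simp only [Finset.mem_insert, not_or]
  have hxS := (mem_boundary.1 hx).1
  constructor
  · rintro ⟨⟨⟨h1, h2⟩, h3⟩, h4⟩
    exact ⟨h1, h2, h3.resolve_left h4⟩
  · rintro ⟨h1, h2, h3⟩
    exact ⟨⟨⟨h1, h2⟩, Or.inr h3⟩, fun h => hxS (h ▸ h3)⟩

/-- The neighbors of `x` further away from `s`. -/
noncomputable def children (G : SimpleGraph V) [G.LocallyFinite] (s x : V) : Finset V :=
  (G.neighborFinset x).filter fun y => G.dist s y = G.dist s x + 1

theorem mem_children (hG : G.IsTree) {s x y : V} :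
    y ∈ children G s x ↔ y ≠ s ∧ toward G s y = x := by
  simp only [children, Finset.mem_filter, SimpleGraph.mem_neighborFinset]
  constructor
  · rintro ⟨h, h'⟩
    refine ⟨?_, (toward_eq_iff hG h.symm).2 h'.symm⟩
    rintro rfl
    simp at h'
  · rintro ⟨h, rfl⟩
    exact ⟨(adj_toward hG h).symm, (dist_toward hG h).symm⟩

theorem card_children_self {δ : ℕ} (hreg : G.IsRegularOfDegree δ) (s : V) :
    (children G s s).card = δ := by
  rw [← hreg s, ← SimpleGraph.card_neighborFinset_eq_degree]
  congr 1
  rw [children, Finset.filter_true_of_mem]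
  intro y hy
  rw [SimpleGraph.mem_neighborFinset] at hy
  simp [dist_adj hy]

open Classical in
theorem card_children (hG : G.IsTree) {δ : ℕ} (hreg : G.IsRegularOfDegree δ) {s x : V}
    (hx : x ≠ s) : (children G s x).card = δ - 1 := by
  have h : children G s x = (G.neighborFinset x).erase (toward G s x) := by
    ext y
    simp only [children, Finset.mem_filter, SimpleGraph.mem_neighborFinset, Finset.mem_erase]
    have h1 := dist_toward hG hx
    constructor
    · rintro ⟨h, h'⟩
      refine ⟨?_, h⟩
      rintro rfl
      omega
    · rintro ⟨h, h'⟩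
      refine ⟨h', ?_⟩
      have := mt (toward_eq_iff hG (s := s) h').2 (Ne.symm h)
      have := hG.dist_eq_dist_add_one_of_adj s h'
      omega
  rw [h, Finset.card_erase_of_mem, SimpleGraph.card_neighborFinset_eq_degree, hreg x]
  rw [SimpleGraph.mem_neighborFinset]
  exact adj_toward hG hx

open Classical in
/-- The nodes at distance `r` from `s`. -/
noncomputable def sphere (G : SimpleGraph V) [G.LocallyFinite] (s : V) : ℕ → Finset V
  | 0 => {s}
  | r + 1 => (sphere G s r).biUnion fun x => children G s x

theorem mem_sphere (hG : G.IsTree) {s x : V} {r : ℕ} : x ∈ sphere G s r ↔ G.dist s x = r := by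
  induction r generalizing x with
  | zero =>
    simp only [sphere, Finset.mem_singleton, hG.connected.dist_eq_zero_iff]
    exact eq_comm
  | succ r ih =>
    simp only [sphere, Finset.mem_biUnion, mem_children hG, ih]
    constructor
    · rintro ⟨a, ha, h, rfl⟩
      rw [← dist_toward hG h, ha]
    · intro h
      have hx : x ≠ s := by rintro rfl; simp at h
      have := dist_toward hG hx
      exact ⟨_, by omega, hx, rfl⟩

open Classical in
theorem card_biUnion_children (hG : G.IsTree) (s : V) (T : Finset V) :
    (T.biUnion fun x => children G s x).card = ∑ x ∈ T, (children G s x).card := by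
  rw [Finset.card_biUnion]
  intro x _ y _ hxy
  rw [Function.onFun, Finset.disjoint_left]
  intro z hz hz'
  rw [mem_children hG] at hz hz'
  exact hxy (hz.2.symm.trans hz'.2)

theorem card_sphere (hG : G.IsTree) {δ : ℕ} (hreg : G.IsRegularOfDegree δ) (s : V) (r : ℕ) :
    (sphere G s (r + 1)).card = δ * (δ - 1) ^ r := by
  induction r with
  | zero => simp [sphere, card_children_self hreg]
  | succ r ih =>
    rw [sphere, card_biUnion_children hG, Finset.sum_congr rfl (fun x hx =>
      card_children hG hreg (s := s) (x := x) ?_), Finset.sum_const, ih, smul_eq_mul, pow_succ,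
      mul_assoc]
    rintro rfl
    rw [mem_sphere hG] at hx
    simp at hx

/-- Countability lets almost sure statements about single edges hold for all edges at once. -/
theorem countable_of_isTree (hG : G.IsTree) : Countable V := by
  obtain ⟨s⟩ := hG.connected.nonempty
  rw [← Set.countable_univ_iff]
  refine (Set.countable_iUnion fun r => (sphere G s r).countable_toSet).mono ?_
  intro x _
  exact Set.mem_iUnion.2 ⟨G.dist s x, (mem_sphere hG).2 rfl⟩

theorem sum_card_branch (hG : G.IsTree) {S : Finset V} {v : V} (hv : v ∉ S) :
    ∑ u ∈ G.neighborFinset v, (branch G S v u).card = S.card := by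
  classical
  rw [Finset.card_eq_sum_card_fiberwise (f := fun y => toward G y v) (t := G.neighborFinset v)]
  · rfl
  · intro y hy
    simp only [SimpleGraph.coe_neighborFinset, SimpleGraph.mem_neighborSet]
    refine adj_toward hG ?_
    rintro rfl
    exact hv hy

open Classical in
-- Seen from `v`, everything beyond `u` in `S` or its boundary hangs from `u`, and each such node
-- other than `u` is a child of a node of the branch. An empty branch is allowed: then `u` itself is
-- the boundary node.
theorem branch_union_boundary (hG : G.IsTree) {S : Finset V} (hS : GeodConvex G S) {v u : V}
    (hv : v ∈ S) (hu : G.Adj v u) :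
    branch G S v u ∪ branch G (boundary G S) v u =
      insert u ((branch G S v u).biUnion fun x => children G v x) := by
  have huu : toward G u v = u := by
    rw [toward_eq_iff hG hu, SimpleGraph.dist_self, dist_adj hu.symm]
  have hbr : ∀ y, toward G y v = u → y ≠ v := by
    rintro y h rfl
    rw [toward_self] at h
    exact hu.ne h
  ext y
  simp only [Finset.mem_union, mem_branch, Finset.mem_insert, Finset.mem_biUnion,
    mem_children hG]
  constructor
  · rintro (⟨h, h'⟩ | ⟨h, h'⟩)
    · by_cases hyu : y = u
      · exact Or.inl hyu
      · right
        have hyv := hbr y h'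
        exact ⟨_, ⟨hS.toward_mem hG hv h, (toward_toward_eq_iff hG hu hyv hyu).2 h'⟩, hyv, rfl⟩
    · by_cases hyu : y = u
      · exact Or.inl hyu
      · right
        have hyv := hbr y h'
        exact ⟨_, ⟨hS.toward_mem_of_boundary hG hv h,
          (toward_toward_eq_iff hG hu hyv hyu).2 h'⟩, hyv, rfl⟩
  · rintro (rfl | ⟨x, ⟨hx, hx'⟩, hyv, rfl⟩)
    · by_cases h : y ∈ S
      · exact Or.inl ⟨h, huu⟩
      · exact Or.inr ⟨mem_boundary.2 ⟨h, v, hv, hu⟩, huu⟩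
    · have h' : toward G y v = u := by
        by_cases hyu : y = u
        · rw [hyu, huu]
        · exact (toward_toward_eq_iff hG hu hyv hyu).1 hx'
      by_cases h : y ∈ S
      · exact Or.inl ⟨h, h'⟩
      · exact Or.inr ⟨(mem_boundary_iff_toward hG hS hv).2 ⟨h, hx⟩, h'⟩

/-- Counting children in the previous decomposition, a branch of `j` nodes with `b` boundary nodes
satisfies `j + b = 1 + j (δ - 1)`. That `b` depends on `j` alone is what makes branch sizes
Markovian. -/
theorem card_branch_boundary (hG : G.IsTree) {δ : ℕ} (hδ : 2 ≤ δ) (hreg : G.IsRegularOfDegree δ)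
    {S : Finset V} (hS : GeodConvex G S) {v u : V} (hv : v ∈ S) (hu : G.Adj v u) :
    (branch G (boundary G S) v u).card = (branch G S v u).card * (δ - 2) + 1 := by
  classical
  have h := congrArg Finset.card (branch_union_boundary hG hS hv hu)
  have hbr : ∀ y ∈ branch G S v u, y ≠ v := by
    rintro y hy rfl
    rw [mem_branch, toward_self] at hy
    exact hu.ne hy.2
  rw [Finset.card_union_of_disjoint, Finset.card_insert_of_notMem, card_biUnion_children hG,
    Finset.sum_congr rfl (fun x hx => card_children hG hreg (hbr x hx)), Finset.sum_const,
    smul_eq_mul] at h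
  · obtain ⟨k, rfl⟩ := Nat.exists_eq_add_of_le hδ
    have e1 : 2 + k - 1 = k + 1 := by omega
    have e2 : 2 + k - 2 = k := by omega
    rw [e1] at h
    rw [e2]
    ring_nf at h ⊢
    omega
  · simp only [Finset.mem_biUnion, mem_children hG, not_exists, not_and]
    intro x hx _ h'
    have : toward G v u = v := by
      rw [toward_eq_iff hG hu.symm, SimpleGraph.dist_self, dist_adj hu]
    exact hbr x hx (h'.symm.trans this)
  · rw [Finset.disjoint_left]
    intro y hy hy'
    exact (mem_boundary.1 (mem_branch.1 hy').1).1 (mem_branch.1 hy).1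

theorem sum_card_branch_of_mem (hG : G.IsTree) {S : Finset V} {v : V} (hv : v ∈ S) :
    ∑ u ∈ G.neighborFinset v, (branch G S v u).card + 1 = S.card := by
  classical
  rw [← Finset.card_erase_add_one hv, ← sum_card_branch hG (Finset.notMem_erase v S)]
  congr 1
  refine Finset.sum_congr rfl fun u hu => congrArg _ ?_
  ext y
  simp only [mem_branch, Finset.mem_erase]
  refine ⟨fun h => ⟨⟨?_, h.1⟩, h.2⟩, fun h => ⟨h.1.2, h.2⟩⟩
  rintro rfl
  rw [toward_self] at h
  rw [SimpleGraph.mem_neighborFinset] at hu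
  exact hu.ne h.2

theorem card_boundary (hG : G.IsTree) {δ : ℕ} (hδ : 2 ≤ δ) (hreg : G.IsRegularOfDegree δ)
    {S : Finset V} (hS : GeodConvex G S) (hne : S.Nonempty) :
    (boundary G S).card = S.card * (δ - 2) + 2 := by
  obtain ⟨v, hv⟩ := hne
  have h1 := sum_card_branch hG (S := boundary G S) (v := v) (fun h => (mem_boundary.1 h).1 hv)
  rw [Finset.sum_congr rfl (fun u hu => card_branch_boundary hG hδ hreg hS hv
    ((SimpleGraph.mem_neighborFinset _ _ _).1 hu)), Finset.sum_add_distrib, Finset.sum_const,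
    ← Finset.sum_mul, SimpleGraph.card_neighborFinset_eq_degree, hreg v] at h1
  rw [← h1, ← sum_card_branch_of_mem hG hv]
  simp only [smul_eq_mul, mul_one, add_mul, one_mul]
  omega

end TreeGeometry

/-! ### Counting growth orders. -/

section Growth

variable {V : Type*} {G : SimpleGraph V} [G.LocallyFinite]

open Classical in
/-- The sum of `φ` over the sets obtained from `S` by adding one node of its boundary. -/
noncomputable def grow (G : SimpleGraph V) [G.LocallyFinite] (φ : Finset V → ℝ) (S : Finset V) :
    ℝ :=
  ∑ x ∈ boundary G S, φ (insert x S)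

open Classical in
/-- The number of ways of growing `I` to `S` one boundary node at a time, divided by
`(S.card - I.card)!`. -/
noncomputable def growthRatio (G : SimpleGraph V) [G.LocallyFinite] (I S : Finset V) : ℝ :=
  (grow G)^[S.card - I.card] (fun T => if T = S then 1 else 0) I / (S.card - I.card).factorial

open Classical in
theorem grow_iterate_eq_zero {I S : Finset V} (h : ¬ I ⊆ S) (n : ℕ) :
    (grow G)^[n] (fun T => if T = S then 1 else 0) I = 0 := by
  induction n generalizing I with
  | zero =>
    simp only [Function.iterate_zero, id_eq, ite_eq_right_iff, one_ne_zero, imp_false]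
    rintro rfl
    exact h subset_rfl
  | succ n ih =>
    rw [Function.iterate_succ_apply']
    exact Finset.sum_eq_zero fun x _ => ih fun h' => h ((Finset.subset_insert _ _).trans h')

theorem growthRatio_self (S : Finset V) : growthRatio G S S = 1 := by
  simp [growthRatio]

open Classical in
-- Decomposition by the first added node; nodes outside `S` contribute nothing because sets only
-- grow. Every later fact about growth orders is derived from this recursion.
theorem sub_mul_growthRatio {I S : Finset V} (h : I ⊆ S) :
    ((S.card : ℝ) - I.card) * growthRatio G I S =
      ∑ x ∈ boundary G I ∩ S, growthRatio G (insert x I) S := by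
  by_cases hIS : I = S
  · subst hIS
    have : boundary G I ∩ I = ∅ := by
      ext x; simp [boundary]
    simp [this]
  have hlt := Finset.card_lt_card (h.ssubset_of_ne hIS)
  obtain ⟨k, hk⟩ := Nat.exists_eq_add_of_lt hlt
  have h1 : S.card - I.card = k + 1 := by omega
  have h2 : (S.card : ℝ) - I.card = k + 1 := by rw [hk]; push_cast; ring
  have h3 : ∀ x ∈ boundary G I, S.card - (insert x I).card = k := by
    intro x hx
    rw [Finset.card_insert_of_notMem (mem_boundary.1 hx).1]
    omega
  rw [h2, growthRatio, h1, Function.iterate_succ_apply', Nat.factorial_succ, grow]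
  have h4 : ∑ x ∈ boundary G I, (grow G)^[k] (fun T => if T = S then 1 else 0) (insert x I) =
      ∑ x ∈ boundary G I ∩ S, (grow G)^[k] (fun T => if T = S then 1 else 0) (insert x I) := by
    symm
    refine Finset.sum_subset Finset.inter_subset_left fun x hx hx' => grow_iterate_eq_zero ?_ _
    intro h'
    exact hx' (Finset.mem_inter.2 ⟨hx, h' (Finset.mem_insert_self _ _)⟩)
  rw [h4, Finset.sum_congr rfl (g := fun x => (k.factorial : ℝ) * growthRatio G (insert x I) S),
    ← Finset.mul_sum]
  · have : (k.factorial : ℝ) ≠ 0 := by positivity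
    have : ((k : ℝ) + 1) ≠ 0 := by positivity
    push_cast
    field_simp
  · intro x hx
    rw [growthRatio, h3 x (Finset.mem_inter.1 hx).1]
    have : (k.factorial : ℝ) ≠ 0 := by positivity
    field_simp

variable (hG : G.IsTree)
include hG

open Classical in
-- Once both ends of `uv` are present, the two sides grow without interacting, so an order for `S`
-- is a shuffle of an order for each side. Dividing by factorials absorbs the binomial coefficient
-- and makes the count multiplicative. The induction is on the number `n` of missing nodes.
theorem growthRatio_union {S : Finset V} {u v : V} (huv : G.Adj u v) (n : ℕ) :
    ∀ A' ⊆ branch G S v u, ∀ B' ⊆ branch G S u v, u ∈ A' → v ∈ B' →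
      (branch G S v u).card + (branch G S u v).card = A'.card + B'.card + n →
      growthRatio G (A' ∪ B') S =
        growthRatio G A' (branch G S v u) * growthRatio G B' (branch G S u v) := by
  set A := branch G S v u with hA
  set B := branch G S u v with hB
  have hcard : A.card + B.card = S.card := card_branch_add_card_branch hG S huv
  have hdisj : Disjoint A B := by
    rw [Finset.disjoint_left]
    intro y hy hy'
    exact not_toward_eq_and_toward_eq hG y huv (mem_branch.1 hy').2 (mem_branch.1 hy).2
  have hS : S = A ∪ B := by
    ext y
    simp only [hA, hB, Finset.mem_union, mem_branch, ← and_or_left]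
    refine ⟨fun h => ⟨h, (toward_eq_or_toward_eq hG y huv).symm⟩, fun h => h.1⟩
  induction n with
  | zero =>
    intro A' hA' B' hB' _ _ h
    have h1 := Finset.card_le_card hA'
    have h2 := Finset.card_le_card hB'
    have h3 := Finset.eq_of_subset_of_card_le hA' (by omega)
    have h4 := Finset.eq_of_subset_of_card_le hB' (by omega)
    rw [h3, h4, ← hS]
    simp [growthRatio_self]
  | succ n ih =>
    intro A' hA' B' hB' hu hv h
    have hsub : A' ∪ B' ⊆ S := hS ▸ Finset.union_subset_union hA' hB'
    have hdisj' : Disjoint A' B' := hdisj.mono hA' hB'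
    have key := sub_mul_growthRatio (G := G) hsub
    -- No new node is reached across the two sides, since `uv` is the only crossing edge and both
    -- its ends are present.
    have hbd : boundary G (A' ∪ B') ∩ S = (boundary G A' ∩ A) ∪ (boundary G B' ∩ B) := by
      ext x
      simp only [Finset.mem_inter, Finset.mem_union, mem_boundary, not_or]
      constructor
      · rintro ⟨⟨⟨h1, h2⟩, a, ha, hax⟩, hxS⟩
        rw [hS, Finset.mem_union] at hxS
        rcases ha with ha | ha <;> rcases hxS with hx | hx
        · exact Or.inl ⟨⟨h1, a, ha, hax⟩, hx⟩
        · have := eq_and_eq_of_adj_of_sides hG huv hax (mem_branch.1 (hA' ha)).2 (mem_branch.1 hx).2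
          exact absurd (this.2 ▸ hv) h2
        · have := eq_and_eq_of_adj_of_sides hG huv hax.symm (mem_branch.1 hx).2
            (mem_branch.1 (hB' ha)).2
          exact absurd (this.1 ▸ hu) h1
        · exact Or.inr ⟨⟨h2, a, ha, hax⟩, hx⟩
      · rintro (⟨⟨h1, a, ha, hax⟩, hx⟩ | ⟨⟨h1, a, ha, hax⟩, hx⟩)
        · exact ⟨⟨⟨h1, fun h => Finset.disjoint_left.1 hdisj hx (hB' h)⟩, a, Or.inl ha, hax⟩,
            hS ▸ Finset.mem_union_left _ hx⟩
        · exact ⟨⟨⟨fun h => Finset.disjoint_left.1 hdisj (hA' h) hx, h1⟩, a, Or.inr ha, hax⟩,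
            hS ▸ Finset.mem_union_right _ hx⟩
    have hd2 : Disjoint (boundary G A' ∩ A) (boundary G B' ∩ B) :=
      hdisj.mono Finset.inter_subset_right Finset.inter_subset_right
    rw [hbd, Finset.sum_union hd2, Finset.card_union_of_disjoint hdisj', ← hcard] at key
    have e1 : ∑ x ∈ boundary G A' ∩ A, growthRatio G (insert x (A' ∪ B')) S =
        ((A.card : ℝ) - A'.card) * growthRatio G A' A * growthRatio G B' B := by
      rw [sub_mul_growthRatio hA', Finset.sum_mul]
      refine Finset.sum_congr rfl fun x hx => ?_
      rw [Finset.mem_inter] at hx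
      rw [← Finset.insert_union, ih (insert x A') (Finset.insert_subset hx.2 hA') B' hB'
        (Finset.mem_insert_of_mem hu) hv]
      rw [Finset.card_insert_of_notMem (mem_boundary.1 hx.1).1]
      omega
    have e2 : ∑ x ∈ boundary G B' ∩ B, growthRatio G (insert x (A' ∪ B')) S =
        growthRatio G A' A * (((B.card : ℝ) - B'.card) * growthRatio G B' B) := by
      rw [sub_mul_growthRatio hB', Finset.mul_sum]
      refine Finset.sum_congr rfl fun x hx => ?_
      rw [Finset.mem_inter] at hx
      rw [← Finset.union_insert, ih A' hA' (insert x B') (Finset.insert_subset hx.2 hB')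
        hu (Finset.mem_insert_of_mem hv)]
      rw [Finset.card_insert_of_notMem (mem_boundary.1 hx.1).1]
      omega
    rw [e1, e2] at key
    have hn : ((A.card : ℝ) + B.card) = A'.card + B'.card + (n + 1) := by exact_mod_cast h
    push_cast at key
    have hpos : ((n : ℝ) + 1) ≠ 0 := by positivity
    have e3 : ((A.card : ℝ) + B.card - (A'.card + B'.card)) = n + 1 := by linarith
    rw [e3] at key
    apply mul_left_cancel₀ hpos
    rw [key, ← e3]
    ring

/-- Orders are again shuffles, but now `v` is among the missing nodes and must come first on its
side. That side has `|B|` missing nodes while only the `|B| - 1` after `v` are ordered freely, which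
accounts for the factor `|B|`. -/
theorem growthRatio_of_subset_branch {S : Finset V} {u v : V} (huv : G.Adj u v) (hvS : v ∈ S)
    (n : ℕ) :
    ∀ A' ⊆ branch G S v u, u ∈ A' → (branch G S v u).card = A'.card + n →
      growthRatio G A' S * (branch G S u v).card =
        growthRatio G A' (branch G S v u) * growthRatio G {v} (branch G S u v) := by
  classical
  set A := branch G S v u with hA
  set B := branch G S u v with hB
  have hcard : A.card + B.card = S.card := card_branch_add_card_branch hG S huv
  have hvB : v ∈ B := mem_branch.2 ⟨hvS, toward_of_adj hG huv.symm⟩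
  have hdisj : Disjoint A B := by
    rw [Finset.disjoint_left]
    intro y hy hy'
    exact not_toward_eq_and_toward_eq hG y huv (mem_branch.1 hy').2 (mem_branch.1 hy).2
  have hS : S = A ∪ B := by
    ext y
    simp only [hA, hB, Finset.mem_union, mem_branch, ← and_or_left]
    refine ⟨fun h => ⟨h, (toward_eq_or_toward_eq hG y huv).symm⟩, fun h => h.1⟩
  have hBpos : (0 : ℝ) < B.card := by exact_mod_cast Finset.card_pos.2 ⟨v, hvB⟩
  induction n with
  | zero =>
    intro A' hA' hu h
    have key := sub_mul_growthRatio (G := G) (I := A') (S := S)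
      (hA'.trans (hS ▸ Finset.subset_union_left))
    have h3 := Finset.eq_of_subset_of_card_le hA' (by omega)
    -- The side of `u` is complete, so the next node can only be `v`.
    have hbd : boundary G A' ∩ S = {v} := by
      ext x
      simp only [Finset.mem_inter, mem_boundary, Finset.mem_singleton]
      constructor
      · rintro ⟨⟨h1, a, ha, hax⟩, hxS⟩
        rw [hS, Finset.mem_union, ← h3] at hxS
        exact (eq_and_eq_of_adj_of_sides hG huv hax (mem_branch.1 (hA' ha)).2
          (mem_branch.1 (hxS.resolve_left h1)).2).2
      · rintro rfl
        exact ⟨⟨fun h => Finset.disjoint_left.1 hdisj (hA' h) hvB, u, hu, huv⟩, hvS⟩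
    rw [hbd, Finset.sum_singleton, ← hcard, Finset.insert_eq, Finset.union_comm,
      growthRatio_union hG huv _ A' hA' {v} (by simpa using hvB) hu (by simp)
      (show A.card + B.card = A'.card + ({v} : Finset V).card + (B.card - 1) by
        rw [h3, Finset.card_singleton]
        have := Finset.card_pos.2 ⟨v, hvB⟩
        omega)] at key
    rw [← key, h3]
    push_cast
    ring
  | succ n ih =>
    intro A' hA' hu h
    have key := sub_mul_growthRatio (G := G) (I := A') (S := S)
      (hA'.trans (hS ▸ Finset.subset_union_left))
    have hbd : boundary G A' ∩ S = insert v (boundary G A' ∩ A) := by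
      ext x
      simp only [Finset.mem_inter, mem_boundary, Finset.mem_insert]
      constructor
      · rintro ⟨⟨h1, a, ha, hax⟩, hxS⟩
        rw [hS, Finset.mem_union] at hxS
        rcases hxS with hx | hx
        · exact Or.inr ⟨⟨h1, a, ha, hax⟩, hx⟩
        · exact Or.inl (eq_and_eq_of_adj_of_sides hG huv hax (mem_branch.1 (hA' ha)).2
            (mem_branch.1 hx).2).2
      · rintro (rfl | ⟨⟨h1, a, ha, hax⟩, hx⟩)
        · exact ⟨⟨fun h => Finset.disjoint_left.1 hdisj (hA' h) hvB, u, hu, huv⟩, hvS⟩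
        · exact ⟨⟨h1, a, ha, hax⟩, hS ▸ Finset.mem_union_left _ hx⟩
    have hvn : v ∉ boundary G A' ∩ A := fun h =>
      Finset.disjoint_left.1 hdisj (Finset.mem_inter.1 h).2 hvB
    have e0 : growthRatio G (insert v A') S = growthRatio G A' A * growthRatio G {v} B := by
      rw [Finset.insert_eq, Finset.union_comm,
        growthRatio_union hG huv _ A' hA' {v} (by simpa using hvB) hu (by simp)
        (show A.card + B.card = A'.card + ({v} : Finset V).card + (n + 1 + B.card - 1) by
          rw [h, Finset.card_singleton]
          have := Finset.card_pos.2 ⟨v, hvB⟩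
          omega)]
    have e1 : (∑ x ∈ boundary G A' ∩ A, growthRatio G (insert x A') S) * B.card =
        ((A.card : ℝ) - A'.card) * growthRatio G A' A * growthRatio G {v} B := by
      rw [sub_mul_growthRatio hA', Finset.sum_mul, Finset.sum_mul]
      refine Finset.sum_congr rfl fun x hx => ?_
      rw [Finset.mem_inter] at hx
      rw [ih (insert x A') (Finset.insert_subset hx.2 hA') (Finset.mem_insert_of_mem hu)]
      rw [Finset.card_insert_of_notMem (mem_boundary.1 hx.1).1]
      omega
    rw [hbd, Finset.sum_insert hvn, e0, ← hcard] at key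
    have hn : (A.card : ℝ) = A'.card + (n + 1) := by exact_mod_cast h
    have hpos : (A.card : ℝ) + B.card - A'.card ≠ 0 := by
      rw [hn]
      have : (0 : ℝ) ≤ n := by positivity
      linarith
    push_cast at key
    apply mul_left_cancel₀ hpos
    linear_combination (B.card : ℝ) * key + e1

/-- Moving the source along the edge `uv` changes the number of growth orders by the ratio of the
sizes of the two sides of this edge. -/
theorem growthRatio_mul_card_branch {S : Finset V} {u v : V} (huv : G.Adj u v) (hu : u ∈ S)
    (hv : v ∈ S) :
    growthRatio G {u} S * (branch G S u v).card = growthRatio G {v} S * (branch G S v u).card := by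
  have hu' : u ∈ branch G S v u := mem_branch.2 ⟨hu, toward_of_adj hG huv⟩
  have hv' : v ∈ branch G S u v := mem_branch.2 ⟨hv, toward_of_adj hG huv.symm⟩
  have h1 := Finset.card_pos.2 ⟨u, hu'⟩
  have h2 := Finset.card_pos.2 ⟨v, hv'⟩
  rw [growthRatio_of_subset_branch hG huv hv ((branch G S v u).card - 1) {u} (by simpa using hu')
      (by simp) (by rw [Finset.card_singleton]; omega),
    growthRatio_of_subset_branch hG huv.symm hu ((branch G S u v).card - 1) {v}
      (by simpa using hv') (by simp) (by rw [Finset.card_singleton]; omega), mul_comm]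

end Growth

/-! ### Centroids: large branches and likelihood maximizers. -/

section Excess

/-- The weight with which a branch of `j` out of `n` nodes prevents a node from being central. -/
noncomputable def excess (j n : ℕ) : ℝ :=
  if n < 2 * j then 1 else if 2 * j = n then 1 / 2 else 0

/-- The branches at `v` have `S.card - 1` nodes in all, so two of them cannot both hold at least
half of `S`, and at most one term survives. -/
theorem sum_excess_eq {V : Type*} {G : SimpleGraph V} [G.LocallyFinite] (hG : G.IsTree)
    {S : Finset V} {u v : V} (hv : v ∈ S) (hu : G.Adj v u)
    (hle : S.card ≤ 2 * (branch G S v u).card) :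
    ∑ u' ∈ G.neighborFinset v, excess (branch G S v u').card S.card =
      excess (branch G S v u).card S.card := by
  classical
  have hsum := sum_card_branch_of_mem hG hv
  refine Finset.sum_eq_single u ?_ ?_
  · intro u' hu' hne
    have h2 : (branch G S v u).card + (branch G S v u').card ≤
        ∑ u ∈ G.neighborFinset v, (branch G S v u).card := by
      rw [← Finset.sum_pair (Ne.symm hne) (f := fun u => (branch G S v u).card)]
      refine Finset.sum_le_sum_of_subset ?_
      intro x hx
      simp only [Finset.mem_insert, Finset.mem_singleton] at hx
      rcases hx with rfl | rfl
      · rwa [SimpleGraph.mem_neighborFinset]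
      · exact hu'
    unfold excess
    rw [if_neg (by omega), if_neg (by omega)]
  · intro h
    exact absurd ((SimpleGraph.mem_neighborFinset _ _ _).2 hu) h

theorem sum_excess_mem_Icc {V : Type*} {G : SimpleGraph V} [G.LocallyFinite] (hG : G.IsTree)
    {S : Finset V} {v : V} (hv : v ∈ S) :
    ∑ u ∈ G.neighborFinset v, excess (branch G S v u).card S.card ∈ Set.Icc (0 : ℝ) 1 := by
  by_cases h : ∃ u, G.Adj v u ∧ S.card ≤ 2 * (branch G S v u).card
  · obtain ⟨u, hu, hle⟩ := h
    rw [sum_excess_eq hG hv hu hle, excess]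
    split_ifs <;> norm_num
  · push Not at h
    rw [Finset.sum_eq_zero]
    · simp
    · intro u hu
      have := h u ((SimpleGraph.mem_neighborFinset _ _ _).1 hu)
      rw [excess, if_neg (by omega), if_neg (by omega)]

end Excess

section Candidates

variable {V : Type*} {G : SimpleGraph V} (hG : G.IsTree) {S : Finset V} {f : V → ℝ}
  (hf : ∀ u ∈ S, ∀ v ∈ S, G.Adj u v →
    f u * (branch G S u v).card = f v * (branch G S v u).card)
include hG hf

theorem lt_of_card_lt_two_mul_card_branch (hpos : ∀ w ∈ S, 0 < f w) {u v : V} (hu : u ∈ S)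
    (hv : v ∈ S) (hadj : G.Adj v u) (h : S.card < 2 * (branch G S v u).card) : f v < f u := by
  have h1 := hf v hv u hu hadj
  have h2 := card_branch_add_card_branch hG S hadj.symm
  have h3 : ((branch G S u v).card : ℝ) < (branch G S v u).card := by
    exact_mod_cast (by omega)
  by_contra h4
  have h5 : f u * (branch G S u v).card ≤ f v * (branch G S u v).card :=
    mul_le_mul_of_nonneg_right (not_lt.1 h4) (by positivity)
  have h6 := mul_lt_mul_of_pos_left h3 (hpos v hv)
  linarith

variable (hS : GeodConvex G S)
include hS

/-- Positivity spreads from `s` along edges, since the side of an edge containing `w` is never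
empty. -/
theorem pos_of_branch_ratio {s : V} (hs : s ∈ S) (h0 : 0 < f s) {w : V} (hw : w ∈ S) : 0 < f w := by
  induction hn : G.dist s w generalizing w with
  | zero => rwa [← eq_of_dist_eq_zero hG hn]
  | succ n ih =>
    have hws : w ≠ s := by rintro rfl; simp at hn
    have hadj := adj_toward hG hws
    have hd := dist_toward hG hws
    have hp := hS.toward_mem hG hs hw
    have h1 := ih hp (by omega)
    have h2 := hf _ hp _ hw hadj.symm
    have h3 : (0 : ℝ) < (branch G S (toward G s w) w).card := by
      exact_mod_cast Finset.card_pos.2 ⟨w, mem_branch.2 ⟨hw, toward_of_adj hG hadj⟩⟩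
    have h4 : (0 : ℝ) ≤ (branch G S w (toward G s w)).card := by positivity
    by_contra hneg
    have h5 := mul_nonneg (neg_nonneg.2 (not_lt.1 hneg)) h4
    have h6 := mul_pos h1 h3
    linarith

/-- Walking away from `v`, the part of `S` ahead shrinks strictly, so after the first step it is
less than half and `f` decreases strictly. On the first step equality needs a branch of exactly half
the nodes. The bound on the branch ahead is carried along for the induction. -/
theorem le_of_two_mul_card_branch_le (hpos : ∀ w ∈ S, 0 < f w) {v : V} (hv : v ∈ S)
    (h : ∀ u, G.Adj v u → 2 * (branch G S v u).card ≤ S.card) {w : V} (hw : w ∈ S) (hwv : w ≠ v) :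
    2 * (branch G S (toward G v w) w).card ≤ S.card ∧ f w ≤ f v ∧
      (¬ (G.Adj v w ∧ 2 * (branch G S v w).card = S.card) → f w < f v) := by
  classical
  induction hn : G.dist v w generalizing w with
  | zero => exact absurd (eq_of_dist_eq_zero hG hn).symm hwv
  | succ n ih =>
    have hadj := adj_toward hG hwv
    have hd := dist_toward hG hwv
    have hp := hS.toward_mem hG hv hw
    have h1 := hf _ hp _ hw hadj.symm
    have h2 := card_branch_add_card_branch hG S hadj
    set p := toward G v w with hpdef
    have hfp := hpos p hp
    have hfw := hpos w hw
    by_cases hpv : p = v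
    · have h3 := h w (hpv ▸ hadj.symm)
      rw [hpv] at h1 h2 hadj ⊢
      refine ⟨h3, ?_, ?_⟩
      · by_contra h4
        have h5 : ((branch G S v w).card : ℝ) ≤ (branch G S w v).card := by
          exact_mod_cast (by omega)
        have hn0 : 0 < S.card := Finset.card_pos.2 ⟨v, hv⟩
        have h6 : (0 : ℝ) < (branch G S w v).card := by
          exact_mod_cast (by omega)
        have h7 := mul_lt_mul_of_pos_right (not_le.1 h4) h6
        have h8 := mul_le_mul_of_nonneg_left h5 (hpos v hv).le
        linarith
      · intro h9
        by_contra h4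
        have h3' : 2 * (branch G S v w).card ≠ S.card := fun h => h9 ⟨hadj.symm, h⟩
        have h5 : ((branch G S v w).card : ℝ) < (branch G S w v).card := by
          exact_mod_cast (by omega)
        have h7 := mul_le_mul_of_nonneg_right (not_lt.1 h4)
          (show (0 : ℝ) ≤ (branch G S w v).card by positivity)
        have h8 := mul_lt_mul_of_pos_left h5 (hpos v hv)
        linarith
    · obtain ⟨i1, i2, -⟩ := ih hp hpv (by omega)
      have hadj' := adj_toward hG hpv
      have hd' := dist_toward hG hpv
      -- The branch beyond `w` is contained in the branch beyond `p` one step earlier, and misses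
      -- `p`.
      have hlt : (branch G S p w).card < (branch G S (toward G v p) p).card := by
        refine Finset.card_lt_card ((Finset.ssubset_iff_of_subset ?_).2 ⟨p, ?_, ?_⟩)
        · intro y hy
          rw [mem_branch] at hy ⊢
          refine ⟨hy.1, (toward_eq_or_toward_eq hG y hadj').resolve_left fun h' => ?_⟩
          rw [hy.2] at h'
          rw [← h'] at hd'
          omega
        · exact mem_branch.2 ⟨hp, toward_of_adj hG hadj'⟩
        · rw [mem_branch, toward_self]
          exact fun h => hadj.ne h.2.symm
      have h5 : ((branch G S p w).card : ℝ) < (branch G S w p).card := by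
        exact_mod_cast (by omega)
      have hfwp : f w < f p := by
        by_contra h4
        have h7 := mul_le_mul_of_nonneg_right (not_lt.1 h4)
          (show (0 : ℝ) ≤ (branch G S w p).card by positivity)
        have h8 := mul_lt_mul_of_pos_left h5 hfp
        linarith
      exact ⟨by omega, by linarith, fun _ => by linarith⟩

open Classical in
-- A branch with more than half of the nodes makes its first node strictly better than `v`. A branch
-- with exactly half makes that node the only other maximizer. Otherwise `v` is the unique one. The
-- excesses are `1`, `1 / 2` and `0`, respectively. Writing the weight as a sum over branches makes
-- its expectation computable branch by branch.
theorem candidate_weight [G.LocallyFinite] (hpos : ∀ w ∈ S, 0 < f w) {v : V} (hv : v ∈ S) :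
    (if v ∈ S.filter (fun w => ∀ u ∈ S, f u ≤ f w) then
      ((S.filter (fun w => ∀ u ∈ S, f u ≤ f w)).card : ℝ)⁻¹ else 0) =
    1 - ∑ u ∈ G.neighborFinset v, excess (branch G S v u).card S.card := by
  have hmem : ∀ u, 0 < (branch G S v u).card → u ∈ S := by
    intro u hu
    obtain ⟨y, hy⟩ := Finset.card_pos.1 hu
    rw [mem_branch] at hy
    exact hy.2 ▸ hS.toward_mem hG hy.1 hv
  have hn0 : 0 < S.card := Finset.card_pos.2 ⟨v, hv⟩
  have hsum := sum_card_branch_of_mem hG hv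
  have hsingle := fun u hu hle => sum_excess_eq hG hv (u := u) hu hle
  by_cases h1 : ∃ u, G.Adj v u ∧ S.card < 2 * (branch G S v u).card
  · obtain ⟨u, hu, hlt⟩ := h1
    have huS := hmem u (by omega)
    rw [hsingle u hu hlt.le, excess, if_pos hlt, if_neg]
    · simp
    · intro h
      rw [Finset.mem_filter] at h
      exact absurd (h.2 u huS)
        (not_le.2 (lt_of_card_lt_two_mul_card_branch hG hf hpos huS hv hu hlt))
  push Not at h1
  have hle := fun w hw hwv => le_of_two_mul_card_branch_le hG hf hS hpos hv h1 (w := w) hw hwv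
  have hvc : v ∈ S.filter (fun w => ∀ u ∈ S, f u ≤ f w) := by
    rw [Finset.mem_filter]
    refine ⟨hv, fun u hu => ?_⟩
    by_cases huv : u = v
    · rw [huv]
    · exact (hle u hu huv).2.1
  rw [if_pos hvc]
  by_cases h2 : ∃ u, G.Adj v u ∧ 2 * (branch G S v u).card = S.card
  · obtain ⟨u, hu, he⟩ := h2
    have huS := hmem u (by omega)
    have hcand : S.filter (fun w => ∀ u ∈ S, f u ≤ f w) = {v, u} := by
      have hfu : f u = f v := by
        have e1 := hf v hv u huS hu
        have e2 := card_branch_add_card_branch hG S hu.symm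
        have e3 : (branch G S u v).card = (branch G S v u).card := by omega
        have e4 : ((branch G S v u).card : ℝ) ≠ 0 := by
          have : (branch G S v u).card ≠ 0 := by omega
          exact_mod_cast this
        rw [e3] at e1
        exact (mul_right_cancel₀ e4 e1).symm
      ext w
      simp only [Finset.mem_filter, Finset.mem_insert, Finset.mem_singleton]
      constructor
      · rintro ⟨hw, hwm⟩
        by_cases hwv : w = v
        · exact Or.inl hwv
        right
        by_contra hwu
        refine absurd (hwm v hv) (not_le.2 ((hle w hw hwv).2.2 ?_))
        rintro ⟨hvw, hw2⟩
        have e1 := hsingle u hu he.ge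
        have e2 := hsingle w hvw hw2.ge
        have e3 : (branch G S v u).card + (branch G S v w).card ≤
            ∑ u ∈ G.neighborFinset v, (branch G S v u).card := by
          rw [← Finset.sum_pair (Ne.symm hwu) (f := fun u => (branch G S v u).card)]
          refine Finset.sum_le_sum_of_subset ?_
          intro x hx
          simp only [Finset.mem_insert, Finset.mem_singleton] at hx
          rcases hx with rfl | rfl <;> rwa [SimpleGraph.mem_neighborFinset]
        omega
      · have := (Finset.mem_filter.1 hvc).2
        rintro (rfl | rfl)
        · exact ⟨hv, this⟩
        · exact ⟨huS, fun u' hu' => hfu ▸ this u' hu'⟩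
    rw [hsingle u hu he.ge, hcand, excess, if_neg (by omega), if_pos he,
      Finset.card_pair hu.ne]
    norm_num
  · push Not at h2
    have hcand : S.filter (fun w => ∀ u ∈ S, f u ≤ f w) = {v} := by
      ext w
      rw [Finset.mem_singleton]
      constructor
      · intro hw
        rw [Finset.mem_filter] at hw
        by_contra hwv
        exact absurd (hw.2 v hv)
          (not_le.2 ((hle w hw.1 hwv).2.2 fun h => h2 w h.1 h.2))
      · rintro rfl
        exact hvc
    rw [hcand, Finset.sum_eq_zero]
    · simp
    · intro u hu
      rw [SimpleGraph.mem_neighborFinset] at hu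
      have e1 := h1 u hu
      have e2 := h2 u hu
      unfold excess
      rw [if_neg (by omega), if_neg e2]

end Candidates

/-! ### Resampling one independent coordinate. -/

section Resampling

/-- Replacing one coordinate by a fresh independent copy preserves a product law, as is checked on
finite boxes. This is how a single edge time is integrated out. -/
theorem lintegral_infinitePi_update {ι : Type*} [DecidableEq ι] {X : ι → Type*} [∀ i, MeasurableSpace (X i)]
    (μ : ∀ i, Measure (X i)) [∀ i, IsProbabilityMeasure (μ i)] (e : ι) {f : (∀ i, X i) → ENNReal}
    (hf : Measurable f) :
    ∫⁻ z, f z ∂Measure.infinitePi μ =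
      ∫⁻ z, ∫⁻ r, f (Function.update z e r) ∂(μ e) ∂Measure.infinitePi μ := by
  have hg : Measurable fun p : (∀ i, X i) × X e => Function.update p.1 e p.2 := measurable_update'
  have key : ((Measure.infinitePi μ).prod (μ e)).map
      (fun p : (∀ i, X i) × X e => Function.update p.1 e p.2) = Measure.infinitePi μ := by
    refine Measure.eq_infinitePi μ fun s t ht => ?_
    rw [Measure.map_apply hg (MeasurableSet.pi s.countable_toSet fun i _ => ht i)]
    by_cases he : e ∈ s
    · have : (fun p : (∀ i, X i) × X e => Function.update p.1 e p.2) ⁻¹' (Set.pi s t) =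
          (Set.pi (s.erase e : Finset ι) t) ×ˢ (t e) := by
        ext ⟨z, r⟩
        simp only [Set.mem_preimage, Set.mem_pi, Set.mem_prod, Finset.mem_coe, Finset.mem_erase]
        constructor
        · intro h
          refine ⟨fun i hi => ?_, by simpa using h e he⟩
          simpa [Function.update_of_ne hi.1] using h i hi.2
        · rintro ⟨h, h'⟩ i hi
          by_cases hie : i = e
          · subst hie; simpa using h'
          · simpa [Function.update_of_ne hie] using h i ⟨hie, hi⟩
      rw [this, Measure.prod_prod, Measure.infinitePi_pi μ (fun i _ => ht i), mul_comm,
        Finset.mul_prod_erase s (fun i => μ i (t i)) he]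
    · have : (fun p : (∀ i, X i) × X e => Function.update p.1 e p.2) ⁻¹' (Set.pi s t) =
          (Set.pi s t) ×ˢ Set.univ := by
        ext ⟨z, r⟩
        simp only [Set.mem_preimage, Set.mem_pi, Set.mem_prod, Finset.mem_coe, Set.mem_univ,
          and_true]
        refine forall₂_congr fun i hi => ?_
        rw [Function.update_of_ne]
        rintro rfl
        exact he hi
      rw [this, Measure.prod_prod, Measure.infinitePi_pi μ (fun i _ => ht i), measure_univ,
        mul_one]
  conv_lhs => rw [← key, lintegral_map hf hg]
  exact lintegral_prod _ (hf.comp hg).aemeasurable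

/-- The factor `exp (C - k r)` stands for `k` competing clocks surviving up to `r`; the density
supplies one more, hence the factor `1 / (k + 1)` of being the first among `k + 1` clocks. For `k =
0` it is the survival probability itself. -/
theorem lintegral_expMeasure_Ioi (C : ℝ) (k : ℕ) {a : ℝ} (ha : 0 ≤ a) :
    ∫⁻ r, (if a < r then ENNReal.ofReal (Real.exp (C - k * r)) else 0) ∂(expMeasure 1) =
      ENNReal.ofReal (Real.exp (C - (k + 1) * a) / (k + 1)) := by
  have h1 : expMeasure 1 = volume.withDensity (exponentialPDF 1) := rfl
  have hm : Measurable (exponentialPDF 1) := (measurable_exponentialPDFReal 1).ennreal_ofReal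
  rw [h1, lintegral_withDensity_eq_lintegral_mul _ hm
    (Measurable.ite measurableSet_Ioi (by fun_prop) measurable_const)]
  have h2 : (exponentialPDF 1 * fun r : ℝ => if a < r then ENNReal.ofReal (Real.exp (C - k * r))
      else 0) = (Set.Ioi a).indicator
        (fun r => ENNReal.ofReal (Real.exp C * Real.exp ((-((k : ℝ) + 1)) * r))) := by
    ext r
    simp only [Pi.mul_apply]
    by_cases hr : a < r
    · rw [if_pos hr, Set.indicator_of_mem (show r ∈ Set.Ioi a from hr),
        exponentialPDF_of_nonneg (ha.trans hr.le), ← ENNReal.ofReal_mul (by positivity),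
        one_mul, one_mul, ← Real.exp_add, ← Real.exp_add]
      congr 2
      ring
    · rw [if_neg hr, Set.indicator_of_notMem (show r ∉ Set.Ioi a from hr), mul_zero]
  have hk : -((k : ℝ) + 1) < 0 := by
    have : (0 : ℝ) ≤ k := by positivity
    linarith
  rw [h2, lintegral_indicator measurableSet_Ioi,
    ← ofReal_integral_eq_lintegral_ofReal ((integrableOn_exp_mul_Ioi hk a).const_mul _)
      (Eventually.of_forall fun r => by positivity), integral_const_mul, integral_exp_mul_Ioi hk]
  congr 1
  rw [neg_div_neg_eq, ← mul_div_assoc, ← Real.exp_add]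
  congr 2
  ring

end Resampling

/-! ### First-passage times from the source. -/

section Arrival

variable {V : Type*} {G : SimpleGraph V}

/-- The time at which `w` is reached from `s`, where `z w` is the spreading time along the last
edge on the way from `s` to `w`. -/
noncomputable def arrival (G : SimpleGraph V) (s : V) (z : V → ℝ) (w : V) : ℝ :=
  ∑ i ∈ Finset.range (G.dist s w), z ((toward G s)^[i] w)

theorem arrival_self (s : V) (z : V → ℝ) : arrival G s z s = 0 := by
  simp [arrival]

theorem arrival_of_ne (hG : G.IsTree) {s w : V} (h : w ≠ s) (z : V → ℝ) :
    arrival G s z w = arrival G s z (toward G s w) + z w := by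
  rw [arrival, ← dist_toward hG h, Finset.sum_range_succ']
  simp [arrival]

@[fun_prop]
theorem measurable_arrival (s w : V) : Measurable fun z : V → ℝ => arrival G s z w := by
  unfold arrival
  fun_prop

open Classical in
-- The way from `s` to a node of a convex set stays inside it, so the edge time into an outside node
-- plays no role.
theorem arrival_update (hG : G.IsTree) {I : Finset V} (hI : GeodConvex G I) {s y : V} (hs : s ∈ I)
    (hy : y ∉ I) (z : V → ℝ) (r : ℝ) {w : V} (hw : w ∈ I) :
    arrival G s (Function.update z y r) w = arrival G s z w := by
  induction hn : G.dist s w generalizing w with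
  | zero => rw [← eq_of_dist_eq_zero hG hn, arrival_self, arrival_self]
  | succ n ih =>
    have hws : w ≠ s := by rintro rfl; simp at hn
    have hd := dist_toward hG hws
    rw [arrival_of_ne hG hws, arrival_of_ne hG hws, ih (hI.toward_mem hG hs hw) (by omega),
      Function.update_of_ne]
    rintro rfl
    exact hy hw

open Classical in
/-- The spreading time along the last edge on the way from `s` to `w`. -/
noncomputable def edgeTime (G : SimpleGraph V) (s : V) (x : G.Dart → ℝ) (w : V) : ℝ :=
  if h : G.Adj (toward G s w) w then x ⟨(toward G s w, w), h⟩ else 0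

theorem measurable_edgeTime (s : V) : Measurable (edgeTime G s) := by
  refine measurable_pi_iff.2 fun w => ?_
  unfold edgeTime
  by_cases h : G.Adj (toward G s w) w
  · simp only [dif_pos h]
    fun_prop
  · simp only [dif_neg h]
    fun_prop

open Classical in
theorem edgeTime_update {s y : V} (h : G.Adj (toward G s y) y) (x : G.Dart → ℝ) (r : ℝ) :
    edgeTime G s (Function.update x ⟨(toward G s y, y), h⟩ r) =
      Function.update (edgeTime G s x) y r := by
  ext w
  by_cases hwy : w = y
  · subst hwy
    simp [edgeTime, h]
  · rw [Function.update_of_ne hwy]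
    unfold edgeTime
    split_ifs with hw
    · rw [Function.update_of_ne]
      intro h'
      exact hwy (congrArg (fun d : G.Dart => d.snd) h')
    · rfl

/-- The law of the spreading times on the edges directed away from `s`. -/
noncomputable def edgeLaw (G : SimpleGraph V) (s : V) : Measure (V → ℝ) :=
  (Measure.infinitePi fun _ : G.Dart => expMeasure 1).map (edgeTime G s)

instance : IsProbabilityMeasure (expMeasure 1) := isProbabilityMeasure_expMeasure one_pos

instance (s : V) : IsProbabilityMeasure (edgeLaw G s) :=
  Measure.isProbabilityMeasure_map (measurable_edgeTime s).aemeasurable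

open Classical in
theorem lintegral_edgeLaw_update (hG : G.IsTree) {s y : V} (h : y ≠ s) {f : (V → ℝ) → ENNReal}
    (hf : Measurable f) :
    ∫⁻ z, f z ∂edgeLaw G s =
      ∫⁻ z, ∫⁻ r, f (Function.update z y r) ∂(expMeasure 1) ∂edgeLaw G s := by
  have hadj := (adj_toward hG h).symm
  have hg : Measurable fun p : (V → ℝ) × ℝ => Function.update p.1 y p.2 := measurable_update'
  have hm : Measurable fun z : V → ℝ => ∫⁻ r, f (Function.update z y r) ∂(expMeasure 1) :=
    (hf.comp hg).lintegral_prod_right'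
  rw [edgeLaw, lintegral_map hf (measurable_edgeTime s), lintegral_map hm (measurable_edgeTime s),
    lintegral_infinitePi_update (f := fun x => f (edgeTime G s x)) _ ⟨(toward G s y, y), hadj⟩
      (hf.comp (measurable_edgeTime s))]
  simp only [edgeTime_update hadj]

theorem ae_edgeLaw_pos [Countable V] (hG : G.IsTree) (s : V) :
    ∀ᵐ z ∂edgeLaw G s, ∀ w, w ≠ s → 0 < z w := by
  classical
  rw [ae_all_iff]
  intro w
  by_cases hw : w = s
  · simp [hw]
  have hset : MeasurableSet {z : V → ℝ | 0 < z w} :=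
    measurableSet_lt measurable_const (measurable_pi_apply w)
  -- Resampling the edge time of `w`, with threshold zero and no competing clock.
  have h := lintegral_edgeLaw_update hG hw
    (f := fun z => if 0 < z w then ENNReal.ofReal (Real.exp (0 - (0 : ℕ) * z w)) else 0)
    (Measurable.ite hset (by fun_prop) measurable_const)
  simp only [Function.update_self, lintegral_expMeasure_Ioi 0 0 le_rfl, lintegral_const,
    measure_univ] at h
  have h' : ∫⁻ z, {z : V → ℝ | 0 < z w}.indicator 1 z ∂edgeLaw G s = 1 := by
    simpa [Set.indicator] using h
  rw [lintegral_indicator_one hset, ← mem_ae_iff_prob_eq_one hset] at h'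
  filter_upwards [h'] with z hz _ using hz

theorem infectionTime_eq_arrival (hG : G.IsTree) {Ω : Type*} (τ : G.Dart → Ω → ℝ) (s w : V)
    (ω : Ω) : infectionTime τ s w ω = arrival G s (edgeTime G s fun e => τ e ω) w := by
  have := hG.isAcyclic.subsingleton_path s w
  have key : ∀ n, ∀ w, G.dist s w = n → ∃ p : G.Path s w, p.1.length = n ∧
      (p.1.darts.map fun e => τ e ω).sum = arrival G s (edgeTime G s fun e => τ e ω) w := by
    intro n
    induction n with
    | zero =>
      intro w hw
      obtain rfl := eq_of_dist_eq_zero hG hw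
      exact ⟨SimpleGraph.Path.nil, rfl, by simp [arrival_self]⟩
    | succ n ih =>
      intro w hw
      have hws : w ≠ s := by rintro rfl; simp at hw
      have hd := dist_toward hG hws
      have hadj := adj_toward hG hws
      obtain ⟨p, hp, hsum⟩ := ih (toward G s w) (by omega)
      refine ⟨⟨p.1.concat hadj.symm, SimpleGraph.Walk.isPath_of_length_eq_dist _
        (by simp [hp, hw])⟩, by simp [hp], ?_⟩
      rw [arrival_of_ne hG hws, ← hsum]
      simp [edgeTime, hadj.symm]
  obtain ⟨p, -, hp⟩ := key _ w rfl
  rw [infectionTime, ciInf_subsingleton p, ← hp]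

end Arrival

/-! ### Memorylessness: all histories are equally likely. -/

section Histories

variable {V : Type*} {G : SimpleGraph V} [G.LocallyFinite]

open Classical in
/-- The possible orders, latest node first, in which the first `n + 1` nodes are reached
from `s`. -/
noncomputable def histories (G : SimpleGraph V) [G.LocallyFinite] (s : V) : ℕ → Finset (List V)
  | 0 => {[s]}
  | n + 1 => (histories G s n).biUnion fun l =>
      (boundary G l.toFinset).image fun x => x :: l

open Classical in
theorem mem_histories_succ {s : V} {n : ℕ} {l : List V} :
    l ∈ histories G s (n + 1) ↔
      ∃ x t, l = x :: t ∧ t ∈ histories G s n ∧ x ∈ boundary G t.toFinset := by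
  simp only [histories, Finset.mem_biUnion, Finset.mem_image]
  constructor
  · rintro ⟨t, ht, x, hx, rfl⟩
    exact ⟨x, t, rfl, ht, hx⟩
  · rintro ⟨x, t, rfl, ht, hx⟩
    exact ⟨t, ht, x, hx, rfl⟩

open Classical in
theorem sum_histories_succ {M : Type*} [AddCommMonoid M] (s : V) (n : ℕ) (f : List V → M) :
    ∑ l ∈ histories G s (n + 1), f l =
      ∑ l ∈ histories G s n, ∑ x ∈ boundary G l.toFinset, f (x :: l) := by
  rw [histories, Finset.sum_biUnion]
  · refine Finset.sum_congr rfl fun l _ => ?_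
    rw [Finset.sum_image]
    intro x _ y _ h
    exact (List.cons.inj h).1
  · intro l _ l' _ hl
    rw [Function.onFun, Finset.disjoint_left]
    intro m hm hm'
    rw [Finset.mem_image] at hm hm'
    obtain ⟨x, _, rfl⟩ := hm
    obtain ⟨y, _, h⟩ := hm'
    exact hl (List.cons.inj h).2.symm

open Classical in
theorem sum_histories (s : V) (n : ℕ) (φ : Finset V → ℝ) :
    ∑ l ∈ histories G s n, φ l.toFinset = (grow G)^[n] φ {s} := by
  induction n generalizing φ with
  | zero => simp [histories]
  | succ n ih =>
    rw [sum_histories_succ, Function.iterate_succ_apply, ← ih]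
    refine Finset.sum_congr rfl fun l _ => ?_
    simp [grow]

open Classical in
theorem histories_spec (hG : G.IsTree) {s : V} {n : ℕ} {l : List V} (hl : l ∈ histories G s n) :
    GeodConvex G l.toFinset ∧ s ∈ l.toFinset ∧ l.toFinset.card = n + 1 := by
  induction n generalizing l with
  | zero =>
    rw [histories, Finset.mem_singleton] at hl
    subst hl
    simpa using geodConvex_singleton hG s
  | succ n ih =>
    obtain ⟨x, t, rfl, ht, hx⟩ := mem_histories_succ.1 hl
    obtain ⟨h1, h2, h3⟩ := ih ht
    rw [List.toFinset_cons]
    refine ⟨h1.insert_boundary hG hx, Finset.mem_insert_of_mem h2, ?_⟩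
    rw [Finset.card_insert_of_notMem (mem_boundary.1 hx).1, h3]

/-- The nodes of `l` are reached in reverse order. -/
def orderedSet (G : SimpleGraph V) (s : V) (l : List V) : Set (V → ℝ) :=
  {z | l.Pairwise fun a b => arrival G s z b < arrival G s z a}

open Classical in
/-- The nodes of `l` are reached in reverse order, and before all other nodes. -/
def historyEvent (G : SimpleGraph V) [G.LocallyFinite] (s : V) (l : List V) : Set (V → ℝ) :=
  orderedSet G s l ∩
    {z | ∀ y ∈ boundary G l.toFinset, ∀ x ∈ l, arrival G s z x < arrival G s z y}

omit [G.LocallyFinite] in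
theorem measurableSet_orderedSet (s : V) (l : List V) : MeasurableSet (orderedSet G s l) := by
  induction l with
  | nil => simp [orderedSet]
  | cons x t ih =>
    have : orderedSet G s (x :: t) =
        {z | ∀ y ∈ t, arrival G s z y < arrival G s z x} ∩ orderedSet G s t := by
      ext z
      simp [orderedSet, List.pairwise_cons]
    rw [this]
    refine MeasurableSet.inter ?_ ih
    rw [show {z | ∀ y ∈ t, arrival G s z y < arrival G s z x} =
      ⋂ y ∈ {y | y ∈ t}, {z | arrival G s z y < arrival G s z x} by ext z; simp]
    exact MeasurableSet.biInter t.finite_toSet.countable fun y _ =>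
      measurableSet_lt (measurable_arrival s y) (measurable_arrival s x)

theorem measurableSet_historyEvent (s : V) (l : List V) :
    MeasurableSet (historyEvent G s l) := by
  classical
  refine (measurableSet_orderedSet s l).inter ?_
  rw [show {z | ∀ y ∈ boundary G l.toFinset, ∀ x ∈ l, arrival G s z x < arrival G s z y} =
    ⋂ y ∈ {y | y ∈ boundary G l.toFinset}, ⋂ x ∈ {y | y ∈ l},
      {z | arrival G s z x < arrival G s z y} by ext z; simp]
  exact MeasurableSet.biInter (boundary G l.toFinset).finite_toSet.countable fun y _ =>
    MeasurableSet.biInter l.finite_toSet.countable fun x _ =>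
      measurableSet_lt (measurable_arrival s x) (measurable_arrival s y)

omit [G.LocallyFinite] in
theorem arrival_le_head {s x : V} {t : List V} {z : V → ℝ} (hz : z ∈ orderedSet G s (x :: t))
    {w : V} (hw : w ∈ x :: t) : arrival G s z w ≤ arrival G s z x := by
  rcases List.mem_cons.1 hw with rfl | hw
  · exact le_rfl
  · exact ((List.pairwise_cons.1 hz).1 w hw).le

open Classical in
omit [G.LocallyFinite] in
theorem update_mem_orderedSet (hG : G.IsTree) {s y : V} {l : List V}
    (hl : GeodConvex G l.toFinset) (hs : s ∈ l.toFinset) (hy : y ∉ l.toFinset) (z : V → ℝ) (r : ℝ) :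
    Function.update z y r ∈ orderedSet G s l ↔ z ∈ orderedSet G s l := by
  refine List.Pairwise.iff_of_mem fun {a b} ha hb => ?_
  rw [arrival_update hG hl hs hy z r (List.mem_toFinset.2 ha),
    arrival_update hG hl hs hy z r (List.mem_toFinset.2 hb)]

open Classical in
theorem arrival_update_boundary (hG : G.IsTree) {I : Finset V} (hI : GeodConvex G I) {s y : V}
    (hs : s ∈ I) (hy : y ∈ boundary G I) (z : V → ℝ) (r : ℝ) :
    arrival G s (Function.update z y r) y = arrival G s z (toward G s y) + r := by
  rw [arrival_of_ne hG (ne_of_mem_boundary hs hy), Function.update_self,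
    arrival_update hG hI hs (mem_boundary.1 hy).1 z r (hI.toward_mem_of_boundary hG hs hy)]

open Classical in
theorem arrival_update_boundary_of_ne (hG : G.IsTree) {I : Finset V} (hI : GeodConvex G I)
    {s x y : V} (hs : s ∈ I) (hy : y ∈ boundary G I) (hx : x ∈ boundary G I) (hxy : x ≠ y)
    (z : V → ℝ) (r : ℝ) :
    arrival G s (Function.update z y r) x = arrival G s z x := by
  rw [arrival_of_ne hG (ne_of_mem_boundary hs hx), Function.update_of_ne hxy,
    arrival_update hG hI hs (mem_boundary.1 hy).1 z r (hI.toward_mem_of_boundary hG hs hx),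
    arrival_of_ne hG (ne_of_mem_boundary hs hx) z]

/-- The conditional probability, given the times at which the nodes up to `x` are reached,
that `y` is reached after `x`. -/
noncomputable def survival (G : SimpleGraph V) (s x : V) (z : V → ℝ) (y : V) : ENNReal :=
  ENNReal.ofReal (Real.exp (arrival G s z (toward G s y) - arrival G s z x))

omit [G.LocallyFinite] in
@[fun_prop]
theorem measurable_survival (s x y : V) : Measurable fun z => survival G s x z y := by
  unfold survival
  fun_prop

open Classical in
theorem survival_update (hG : G.IsTree) {I : Finset V} (hI : GeodConvex G I) {s x a y : V}
    (hs : s ∈ I) (hx : x ∈ I) (ha : a ∉ I) (hy : y ∈ boundary G I) (z : V → ℝ) (r : ℝ) :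
    survival G s x (Function.update z a r) y = survival G s x z y := by
  rw [survival, survival, arrival_update hG hI hs ha z r hx,
    arrival_update hG hI hs ha z r (hI.toward_mem_of_boundary hG hs hy)]

open Classical in
/-- The probability of the history `x :: t`, as an integral over the times at which its nodes are
reached. -/
noncomputable def historyWeight (G : SimpleGraph V) [G.LocallyFinite] (s x : V) (t : List V) :
    ENNReal :=
  ∫⁻ z, (orderedSet G s (x :: t)).indicator
    (fun z => ∏ y ∈ boundary G (x :: t).toFinset, survival G s x z y) z ∂edgeLaw G s

open Classical in
-- The edge times into the boundary nodes do not affect the history, so they are integrated out one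
-- at a time, each replacing an indicator by a survival factor. The set `A` holds the nodes still to
-- be treated: the full boundary gives the history event, the empty set its weight.
theorem lintegral_later_eq_historyWeight (hG : G.IsTree) {s x : V} {t : List V}
    (hI : GeodConvex G (x :: t).toFinset) (hs : s ∈ (x :: t).toFinset) (A : Finset V)
    (hA : A ⊆ boundary G (x :: t).toFinset) :
    ∫⁻ z, (orderedSet G s (x :: t)).indicator
      (fun z => (∏ y ∈ A, if arrival G s z x < arrival G s z y then 1 else 0) *
        ∏ y ∈ boundary G (x :: t).toFinset \ A, survival G s x z y) z ∂edgeLaw G s =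
      historyWeight G s x t := by
  induction A using Finset.induction_on with
  | empty => simp [historyWeight]
  | insert a A ha ih =>
    set I := (x :: t).toFinset with hIdef
    have haI : a ∈ boundary G I := hA (Finset.mem_insert_self _ _)
    have hA' : A ⊆ boundary G I := (Finset.subset_insert _ _).trans hA
    have hxI : x ∈ I := by simp [hIdef]
    have hanI := (mem_boundary.1 haI).1
    rw [← ih hA']
    have hmeas : ∀ B C : Finset V, Measurable (fun z : V → ℝ =>
        (∏ y ∈ B, if arrival G s z x < arrival G s z y then (1 : ENNReal) else 0) *
          ∏ y ∈ C, survival G s x z y) := by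
      intro B C
      refine Measurable.mul (Finset.measurable_prod _ fun y _ => ?_)
        (Finset.measurable_prod _ fun y _ => by fun_prop)
      exact Measurable.ite (measurableSet_lt (measurable_arrival s x) (measurable_arrival s y))
        measurable_const measurable_const
    rw [lintegral_edgeLaw_update hG (ne_of_mem_boundary hs haI)
      ((hmeas _ _).indicator (measurableSet_orderedSet s _))]
    refine lintegral_congr fun z => ?_
    by_cases hz : z ∈ orderedSet G s (x :: t)
    · have hz' : ∀ r, Function.update z a r ∈ orderedSet G s (x :: t) := fun r =>
        (update_mem_orderedSet hG hI hs hanI z r).2 hz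
      simp only [Set.indicator_of_mem hz, Set.indicator_of_mem (hz' _)]
      -- The parent of `a` belongs to the network, so it is reached no later than `x`.
      have hg : 0 ≤ arrival G s z x - arrival G s z (toward G s a) :=
        sub_nonneg.2 (arrival_le_head hz (List.mem_toFinset.1
          (hI.toward_mem_of_boundary hG hs haI)))
      have hint : ∀ r, ((∏ y ∈ insert a A,
          if arrival G s (Function.update z a r) x < arrival G s (Function.update z a r) y
            then (1 : ENNReal) else 0) *
          ∏ y ∈ boundary G I \ insert a A, survival G s x (Function.update z a r) y) =
          (if arrival G s z x - arrival G s z (toward G s a) < r then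
            ENNReal.ofReal (Real.exp (0 - (0 : ℕ) * r)) else 0) *
          ((∏ y ∈ A, if arrival G s z x < arrival G s z y then (1 : ENNReal) else 0) *
          ∏ y ∈ boundary G I \ insert a A, survival G s x z y) := by
        intro r
        rw [Finset.prod_insert ha, arrival_update_boundary hG hI hs haI,
          arrival_update hG hI hs hanI z r hxI, mul_assoc]
        congr 1
        · simp [sub_lt_iff_lt_add']
        congr 1
        · refine Finset.prod_congr rfl fun y hy => ?_
          rw [arrival_update_boundary_of_ne hG hI hs haI (hA' hy)]
          rintro rfl
          exact ha hy
        · refine Finset.prod_congr rfl fun y hy => ?_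
          exact survival_update hG hI hs hxI hanI (Finset.mem_sdiff.1 hy).1 z r
      simp only [hint]
      rw [lintegral_mul_const _ (Measurable.ite measurableSet_Ioi (by fun_prop) measurable_const),
        lintegral_expMeasure_Ioi 0 0 hg]
      have hsd : boundary G I \ A = insert a (boundary G I \ insert a A) := by
        ext y
        simp only [Finset.mem_sdiff, Finset.mem_insert, not_or]
        by_cases hya : y = a
        · subst hya
          simp [haI, ha]
        · simp [hya]
      rw [hsd, Finset.prod_insert (by simp), survival]
      have : (0 - (((0 : ℕ) : ℝ) + 1) * (arrival G s z x - arrival G s z (toward G s a))) =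
          arrival G s z (toward G s a) - arrival G s z x := by push_cast; ring
      rw [this, Nat.cast_zero, zero_add, div_one]
      ring
    · have hz' : ∀ r, Function.update z a r ∉ orderedSet G s (x :: t) := fun r =>
        mt (update_mem_orderedSet hG hI hs hanI z r).1 hz
      simp only [Set.indicator_of_notMem hz, Set.indicator_of_notMem (hz' _), lintegral_zero]

open Classical in
theorem edgeLaw_historyEvent (hG : G.IsTree) {s x : V} {t : List V}
    (hI : GeodConvex G (x :: t).toFinset) (hs : s ∈ (x :: t).toFinset) :
    edgeLaw G s (historyEvent G s (x :: t)) = historyWeight G s x t := by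
  rw [← lintegral_later_eq_historyWeight hG hI hs _ subset_rfl,
    ← lintegral_indicator_one (measurableSet_historyEvent s _)]
  refine lintegral_congr fun z => ?_
  simp only [Finset.sdiff_self, Finset.prod_empty, mul_one]
  by_cases hz : z ∈ orderedSet G s (x :: t)
  · rw [Set.indicator_of_mem hz]
    by_cases hz' : z ∈ historyEvent G s (x :: t)
    · rw [Set.indicator_of_mem hz', Pi.one_apply, Finset.prod_eq_one]
      intro y hy
      rw [if_pos (hz'.2 y hy x (by simp))]
    · rw [Set.indicator_of_notMem hz']
      symm
      rw [Finset.prod_eq_zero_iff]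
      by_contra! h
      refine hz' ⟨hz, fun y hy w hw => (arrival_le_head hz hw).trans_lt ?_⟩
      by_contra h'
      exact h y hy (if_neg h')
  · rw [Set.indicator_of_notMem hz, Set.indicator_of_notMem fun h => hz h.1]

open Classical in
-- The edge time `r` of `x` is integrated over the values for which `x` is reached after `h`, while
-- the other boundary nodes survive until `x`. Memorylessness returns the survival factors at the
-- time of `h`, divided by the number of competing boundary nodes.
theorem historyWeight_cons (hG : G.IsTree) {s x h : V} {t : List V}
    (hI : GeodConvex G (h :: t).toFinset) (hs : s ∈ (h :: t).toFinset)
    (hx : x ∈ boundary G (h :: t).toFinset) :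
    historyWeight G s x (h :: t) =
      ((boundary G (h :: t).toFinset).card : ENNReal)⁻¹ * historyWeight G s h t := by
  set I := (h :: t).toFinset with hIdef
  have hh : h ∈ I := by simp [hIdef]
  have hxI := (mem_boundary.1 hx).1
  have hI' : (x :: h :: t).toFinset = insert x I := by rw [List.toFinset_cons]
  -- The new boundary nodes are children of `x`; their clocks start when `x` is reached, so their
  -- survival factors are `1`.
  have hprod : ∀ z, ∏ y ∈ boundary G (x :: h :: t).toFinset, survival G s x z y =
      ∏ y ∈ (boundary G I).erase x, survival G s x z y := by
    intro z
    rw [hI', ← boundary_insert_filter hG hI hs hx]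
    refine (Finset.prod_subset (Finset.filter_subset _ _) fun y hy hy' => ?_).symm
    rw [Finset.mem_filter, not_and, not_not] at hy'
    rw [survival, hy' hy, sub_self, Real.exp_zero, ENNReal.ofReal_one]
  obtain ⟨k, hk⟩ : ∃ k, ((boundary G I).erase x).card = k := ⟨_, rfl⟩
  have hcard : (boundary G I).card = k + 1 := by
    rw [← hk, Finset.card_erase_add_one hx]
  unfold historyWeight
  simp only [hprod]
  have hm1 : Measurable fun z : V → ℝ => ∏ y ∈ (boundary G I).erase x, survival G s x z y :=
    Finset.measurable_prod _ fun y _ => by fun_prop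
  have hm2 : Measurable fun z : V → ℝ => ∏ y ∈ boundary G I, survival G s h z y :=
    Finset.measurable_prod _ fun y _ => by fun_prop
  rw [lintegral_edgeLaw_update hG (ne_of_mem_boundary hs hx)
    (hm1.indicator (measurableSet_orderedSet s _)),
    ← lintegral_const_mul _ (hm2.indicator (measurableSet_orderedSet s _))]
  refine lintegral_congr fun z => ?_
  have hmem : ∀ r, Function.update z x r ∈ orderedSet G s (x :: h :: t) ↔
      (z ∈ orderedSet G s (h :: t) ∧ arrival G s z h - arrival G s z (toward G s x) < r) := by
    intro r
    have e1 : Function.update z x r ∈ orderedSet G s (x :: h :: t) ↔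
        (∀ y ∈ h :: t, arrival G s (Function.update z x r) y <
          arrival G s (Function.update z x r) x) ∧
        Function.update z x r ∈ orderedSet G s (h :: t) := List.pairwise_cons
    rw [e1, update_mem_orderedSet hG hI hs hxI, and_comm]
    refine and_congr_right fun hz => ?_
    rw [sub_lt_iff_lt_add', arrival_update_boundary hG hI hs hx]
    constructor
    · intro h'
      have := h' h (by simp)
      rwa [arrival_update hG hI hs hxI z r hh] at this
    · intro h' y hy
      rw [arrival_update hG hI hs hxI z r (List.mem_toFinset.2 hy)]
      exact (arrival_le_head hz hy).trans_lt h'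
  by_cases hz : z ∈ orderedSet G s (h :: t)
  · rw [Set.indicator_of_mem hz]
    have hg : 0 ≤ arrival G s z h - arrival G s z (toward G s x) :=
      sub_nonneg.2 (arrival_le_head hz (List.mem_toFinset.1
        (hI.toward_mem_of_boundary hG hs hx)))
    set C := ∑ y ∈ (boundary G I).erase x,
      (arrival G s z (toward G s y) - arrival G s z (toward G s x)) with hC
    have hint : ∀ r, (orderedSet G s (x :: h :: t)).indicator
        (fun z => ∏ y ∈ (boundary G I).erase x, survival G s x z y) (Function.update z x r) =
        if arrival G s z h - arrival G s z (toward G s x) < r then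
          ENNReal.ofReal (Real.exp (C - k * r)) else 0 := by
      intro r
      by_cases hr : arrival G s z h - arrival G s z (toward G s x) < r
      · rw [Set.indicator_of_mem ((hmem r).2 ⟨hz, hr⟩), if_pos hr]
        have e2 : C - k * r = ∑ y ∈ (boundary G I).erase x,
            (arrival G s z (toward G s y) - arrival G s z (toward G s x) - r) := by
          rw [Finset.sum_sub_distrib, Finset.sum_const, hk, nsmul_eq_mul]
        rw [e2, Real.exp_sum, ENNReal.ofReal_prod_of_nonneg fun _ _ => (Real.exp_pos _).le]
        refine Finset.prod_congr rfl fun y hy => ?_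
        rw [survival, arrival_update_boundary hG hI hs hx, arrival_update hG hI hs hxI z r
          (hI.toward_mem_of_boundary hG hs (Finset.mem_of_mem_erase hy)), sub_sub]
      · rw [Set.indicator_of_notMem fun h' => hr ((hmem r).1 h').2, if_neg hr]
    simp only [hint]
    rw [lintegral_expMeasure_Ioi C k hg, hcard]
    unfold survival
    rw [← ENNReal.ofReal_prod_of_nonneg fun _ _ => (Real.exp_pos _).le, ← Real.exp_sum]
    -- The node `x` itself would add zero to `C`, so the sum may be taken over the whole boundary of
    -- `k + 1` nodes.
    have e3 : ∑ y ∈ boundary G I, (arrival G s z (toward G s y) - arrival G s z h) =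
        C - (k + 1) * (arrival G s z h - arrival G s z (toward G s x)) := by
      have e4 : ∀ y ∈ boundary G I, arrival G s z (toward G s y) - arrival G s z h =
          (arrival G s z (toward G s y) - arrival G s z (toward G s x)) -
            (arrival G s z h - arrival G s z (toward G s x)) := fun y _ => by ring
      rw [Finset.sum_congr rfl e4, Finset.sum_sub_distrib, Finset.sum_const, hcard, nsmul_eq_mul,
        ← Finset.add_sum_erase _ _ hx, hC]
      push_cast
      ring
    rw [e3, div_eq_inv_mul, ENNReal.ofReal_mul (by positivity), ENNReal.ofReal_inv_of_pos
      (by positivity)]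
    congr 2
    rw [ENNReal.ofReal_add (by positivity) zero_le_one, ENNReal.ofReal_natCast]
    simp
  · rw [Set.indicator_of_notMem hz, mul_zero]
    have : ∀ r, (orderedSet G s (x :: h :: t)).indicator
        (fun z => ∏ y ∈ (boundary G I).erase x, survival G s x z y) (Function.update z x r) = 0 :=
      fun r => Set.indicator_of_notMem (fun h' => hz ((hmem r).1 h').1) _
    simp only [this, lintegral_zero]

/-- The number of orders in which the first `n + 1` nodes can be reached: a network of `i + 1`
nodes has `(i + 1) (δ - 2) + 2` boundary nodes. -/
def orderCount (δ n : ℕ) : ℕ := ∏ i ∈ Finset.range n, ((i + 1) * (δ - 2) + 2)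

theorem orderCount_pos (δ n : ℕ) : 0 < orderCount δ n :=
  Finset.prod_pos fun _ _ => by positivity

theorem historyWeight_eq (hG : G.IsTree) {δ : ℕ} (hδ : 2 ≤ δ) (hreg : G.IsRegularOfDegree δ)
    {s : V} {n : ℕ} {x : V} {t : List V} (hl : x :: t ∈ histories G s n) :
    historyWeight G s x t = (orderCount δ n : ENNReal)⁻¹ := by
  classical
  induction n generalizing x t with
  | zero =>
    rw [histories, Finset.mem_singleton, List.cons.injEq] at hl
    obtain ⟨rfl, rfl⟩ := hl
    unfold historyWeight
    rw [lintegral_congr (g := fun _ => 1)]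
    · simp [orderCount]
    · intro z
      rw [Set.indicator_of_mem (by simp [orderedSet]), Finset.prod_eq_one]
      intro y hy
      have := (geodConvex_singleton hG x).toward_mem_of_boundary hG (s := x) (by simp)
        (by simpa using hy)
      rw [survival, Finset.mem_singleton.1 this, sub_self, Real.exp_zero, ENNReal.ofReal_one]
  | succ n ih =>
    obtain ⟨x', t', he, ht, hx⟩ := mem_histories_succ.1 hl
    obtain ⟨rfl, rfl⟩ := List.cons.inj he
    obtain ⟨h1, h2, h3⟩ := histories_spec hG ht
    cases t with
    | nil => simp at h2
    | cons h t =>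
      rw [historyWeight_cons hG h1 h2 hx, ih ht, card_boundary hG hδ hreg h1 ⟨s, h2⟩, h3,
        orderCount, orderCount, Finset.prod_range_succ, Nat.cast_mul, mul_comm,
        ENNReal.mul_inv (Or.inr (ENNReal.natCast_ne_top _)) (Or.inl (ENNReal.natCast_ne_top _))]

theorem edgeLaw_historyEvent_eq (hG : G.IsTree) {δ : ℕ} (hδ : 2 ≤ δ)
    (hreg : G.IsRegularOfDegree δ) {s : V} {n : ℕ} {l : List V} (hl : l ∈ histories G s n) :
    edgeLaw G s (historyEvent G s l) = (orderCount δ n : ENNReal)⁻¹ := by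
  classical
  obtain ⟨h1, h2, h3⟩ := histories_spec hG hl
  cases l with
  | nil => simp at h2
  | cons x t => rw [edgeLaw_historyEvent hG h1 h2, historyWeight_eq hG hδ hreg hl]

theorem card_histories (hG : G.IsTree) {δ : ℕ} (hδ : 2 ≤ δ) (hreg : G.IsRegularOfDegree δ)
    (s : V) (n : ℕ) : (histories G s n).card = orderCount δ n := by
  classical
  induction n with
  | zero => simp [histories, orderCount]
  | succ n ih =>
    rw [Finset.card_eq_sum_ones, sum_histories_succ, Finset.sum_congr rfl (g := fun _ =>
      (n + 1) * (δ - 2) + 2), Finset.sum_const, ih, orderCount, orderCount,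
      Finset.prod_range_succ, smul_eq_mul]
    intro l hl
    obtain ⟨h1, h2, h3⟩ := histories_spec hG hl
    rw [← Finset.card_eq_sum_ones, card_boundary hG hδ hreg h1 ⟨s, h2⟩, h3]

/-- A history can be read off the arrival times: truncating it leaves a history, and the node
removed is the boundary node with strictly the earliest arrival. -/
theorem disjoint_historyEvent (hG : G.IsTree) {s : V} {n : ℕ} {l l' : List V}
    (hl : l ∈ histories G s n) (hl' : l' ∈ histories G s n) {z : V → ℝ}
    (hz : z ∈ historyEvent G s l) (hz' : z ∈ historyEvent G s l') : l = l' := by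
  classical
  have key : ∀ {m : ℕ} {x : V} {t : List V}, t ∈ histories G s m → x ∈ boundary G t.toFinset →
      z ∈ historyEvent G s (x :: t) → z ∈ historyEvent G s t ∧
        ∀ y ∈ boundary G t.toFinset, y ≠ x → arrival G s z x < arrival G s z y := by
    intro m x t ht hx hz
    obtain ⟨h1, h2, -⟩ := histories_spec hG ht
    have hp := List.pairwise_cons.1 hz.1
    have hb : ∀ y ∈ boundary G t.toFinset, y ≠ x →
        ∀ a ∈ x :: t, arrival G s z a < arrival G s z y := by
      intro y hy hyx a ha
      refine hz.2 y ?_ a ha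
      have := Finset.mem_erase.2 ⟨hyx, hy⟩
      rw [← boundary_insert_filter hG h1 h2 hx, Finset.mem_filter] at this
      rw [List.toFinset_cons]
      exact this.1
    refine ⟨⟨hp.2, fun y hy a ha => ?_⟩, fun y hy hyx => hb y hy hyx x (by simp)⟩
    by_cases hyx : y = x
    · rw [hyx]
      exact hp.1 a ha
    · exact hb y hy hyx a (List.mem_cons_of_mem _ ha)
  induction n generalizing l l' with
  | zero =>
    rw [histories, Finset.mem_singleton] at hl hl'
    rw [hl, hl']
  | succ n ih =>
    obtain ⟨x, t, rfl, ht, hx⟩ := mem_histories_succ.1 hl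
    obtain ⟨x', t', rfl, ht', hx'⟩ := mem_histories_succ.1 hl'
    obtain ⟨k1, k2⟩ := key ht hx hz
    obtain ⟨k1', k2'⟩ := key ht' hx' hz'
    obtain rfl := ih ht ht' k1 k1'
    by_contra hne
    have hxx : x' ≠ x := by
      rintro rfl
      exact hne rfl
    exact lt_asymm (k2 x' hx' hxx) (k2' x hx hxx.symm)

open Classical in
-- The way to an outside node leaves the network through a boundary node, reached after `x`;
-- positive edge times only delay it further. Hence at the arrival time of `x` the informed set is
-- exactly the history.
theorem arrival_le_iff_mem (hG : G.IsTree) {s x : V} {t : List V}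
    (hI : GeodConvex G (x :: t).toFinset) (hs : s ∈ (x :: t).toFinset) {z : V → ℝ}
    (hpos : ∀ w, w ≠ s → 0 < z w) (hz : z ∈ historyEvent G s (x :: t)) (w : V) :
    arrival G s z w ≤ arrival G s z x ↔ w ∈ (x :: t).toFinset := by
  refine ⟨fun h => ?_, fun h => arrival_le_head hz.1 (List.mem_toFinset.1 h)⟩
  by_contra hw
  refine not_le.2 ?_ h
  clear h
  induction hn : G.dist s w generalizing w with
  | zero => exact absurd (eq_of_dist_eq_zero hG hn ▸ hs) hw
  | succ n ih =>
    have hws : w ≠ s := by rintro rfl; simp at hn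
    have hd := dist_toward hG hws
    by_cases hp : toward G s w ∈ (x :: t).toFinset
    · exact hz.2 w ((mem_boundary_iff_toward hG hI hs).2 ⟨hw, hp⟩) x (by simp)
    · rw [arrival_of_ne hG hws]
      have := ih _ hp (by omega)
      have := hpos w hws
      linarith

end Histories

/-! ### The law of the maximum likelihood estimate. -/

section Estimator

variable {V Ω : Type*} {G : SimpleGraph V}

theorem eq_of_mem_observed {τ : G.Dart → Ω → ℝ} {s : V} {S T : Finset V} {ω : Ω}
    (hS : ω ∈ observed τ s S) (hT : ω ∈ observed τ s T) (h : S.card = T.card) : S = T := by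
  obtain ⟨a, ha⟩ := hS
  obtain ⟨b, hb⟩ := hT
  rcases le_total a b with hab | hab
  · exact Finset.eq_of_subset_of_card_le
      (fun w hw => (hb w).1 (((ha w).2 hw).trans hab)) h.ge
  · exact (Finset.eq_of_subset_of_card_le
      (fun w hw => (ha w).1 (((hb w).2 hw).trans hab)) h.le).symm

variable [G.LocallyFinite]

/-- The event that the first nodes reached from `s` are those of `l`, in reverse order. -/
def historyPreimage (τ : G.Dart → Ω → ℝ) (s : V) (l : List V) : Set Ω :=
  (fun ω => edgeTime G s fun e => τ e ω) ⁻¹' historyEvent G s l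

theorem pairwiseDisjoint_historyPreimage (hG : G.IsTree) (τ : G.Dart → Ω → ℝ) (s : V) (n : ℕ) :
    (histories G s n : Set (List V)).PairwiseDisjoint (historyPreimage τ s) := by
  intro l hl l' hl' hne
  rw [Function.onFun, Set.disjoint_left]
  intro ω hω hω'
  exact hne (disjoint_historyEvent hG hl hl' hω hω')

variable [MeasurableSpace Ω]

open Classical in
/-- The nodes of `S` maximizing the number of growth orders. -/
noncomputable def centers (G : SimpleGraph V) [G.LocallyFinite] (S : Finset V) : Finset V :=
  S.filter fun v => ∀ u ∈ S, growthRatio G {u} S ≤ growthRatio G {v} S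

open Classical in
/-- The weight of `v` in the uniform distribution on the centers of `S`, in terms of the sizes of
the branches at `v`. -/
noncomputable def centrality (G : SimpleGraph V) [G.LocallyFinite] (v : V) (S : Finset V) : ℝ :=
  if v ∈ S then 1 - ∑ u ∈ G.neighborFinset v, excess (branch G S v u).card S.card else 0

open Classical in
theorem card_filter_histories (s : V) {n : ℕ} {S : Finset V} (hS : S.card = n + 1) :
    (((histories G s n).filter fun l => l.toFinset = S).card : ℝ) =
      n.factorial * growthRatio G {s} S := by
  have h := sum_histories (G := G) s n (fun T => if T = S then 1 else 0)
  rw [← Finset.sum_filter, Finset.sum_const, nsmul_eq_mul, mul_one] at h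
  have h1 : S.card - ({s} : Finset V).card = n := by rw [hS]; simp
  have : (n.factorial : ℝ) ≠ 0 := by positivity
  rw [h, growthRatio, h1]
  field_simp

open Classical in
-- The history `l` is itself a growth order from `s`, which gives the positivity that the centroid
-- criterion needs.
theorem card_inv_centers_eq_centrality (hG : G.IsTree) {s : V} {n : ℕ} {l : List V}
    (hl : l ∈ histories G s n) (v : V) :
    (if v ∈ centers G l.toFinset then ((centers G l.toFinset).card : ℝ)⁻¹ else 0) =
      centrality G v l.toFinset := by
  obtain ⟨h1, h2, h3⟩ := histories_spec hG hl
  have hpos : 0 < growthRatio G {s} l.toFinset := by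
    have h4 := card_filter_histories (G := G) s h3
    have h5 : (0 : ℝ) < ((histories G s n).filter fun l' => l'.toFinset = l.toFinset).card :=
      Nat.cast_pos.2 (Finset.card_pos.2 ⟨l, Finset.mem_filter.2 ⟨hl, rfl⟩⟩)
    rw [h4] at h5
    exact (pos_iff_pos_of_mul_pos h5).1 (by positivity)
  have hf : ∀ u ∈ l.toFinset, ∀ v ∈ l.toFinset, G.Adj u v →
      growthRatio G {u} l.toFinset * (branch G l.toFinset u v).card =
        growthRatio G {v} l.toFinset * (branch G l.toFinset v u).card :=
    fun u hu v hv huv => growthRatio_mul_card_branch hG huv hu hv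
  unfold centrality
  split_ifs with hc hv hv
  · have key := candidate_weight hG (f := fun u => growthRatio G {u} l.toFinset) hf h1
      (fun w hw => pos_of_branch_ratio hG hf h1 h2 hpos hw) hv
    rw [← key]
    exact (if_pos hc).symm
  · exact absurd (Finset.mem_filter.1 hc).1 hv
  · have key := candidate_weight hG (f := fun u => growthRatio G {u} l.toFinset) hf h1
      (fun w hw => pos_of_branch_ratio hG hf h1 h2 hpos hw) hv
    rw [← key]
    exact (if_neg hc).symm
  · rfl

variable (P : Measure Ω) (hG : G.IsTree) {δ : ℕ} (hδ : 2 ≤ δ)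
  (hreg : G.IsRegularOfDegree δ) (τ : G.Dart → Ω → ℝ) (hm : ∀ e, Measurable (τ e))
  (hi : iIndepFun τ P) (hlaw : ∀ e, P.map (τ e) = expMeasure 1)

omit [G.LocallyFinite] in
include hm in
theorem measurable_edgeTime_comp (s : V) :
    Measurable fun ω => edgeTime G s fun e => τ e ω :=
  (measurable_edgeTime s).comp (measurable_pi_iff.2 hm)

omit [G.LocallyFinite] in
include hm hi hlaw in
theorem map_edgeTime (s : V) : P.map (fun ω => edgeTime G s fun e => τ e ω) = edgeLaw G s := by
  have h := hi.map_fun_eq_infinitePi_map hm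
  simp only [hlaw] at h
  rw [edgeLaw, ← h, Measure.map_map (measurable_edgeTime s) (measurable_pi_iff.2 hm)]
  rfl

include hm in
theorem measurableSet_historyPreimage (s : V) (l : List V) :
    MeasurableSet (historyPreimage τ s l) :=
  measurable_edgeTime_comp τ hm s (measurableSet_historyEvent s l)

include hG hδ hreg hm hi hlaw

theorem measure_historyPreimage {s : V} {n : ℕ} {l : List V} (hl : l ∈ histories G s n) :
    P (historyPreimage τ s l) = (orderCount δ n : ENNReal)⁻¹ := by
  rw [historyPreimage, ← Measure.map_apply (measurable_edgeTime_comp τ hm s)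
    (measurableSet_historyEvent s l), map_edgeTime P τ hm hi hlaw,
    edgeLaw_historyEvent_eq hG hδ hreg hl]

variable [IsProbabilityMeasure P]

open Classical in
-- The histories are disjoint, and their number is the inverse of their common probability, so
-- together they have mass one.
theorem ae_exists_history (s : V) (n : ℕ) :
    ∀ᵐ ω ∂P, ∃ l ∈ histories G s n, ω ∈ historyPreimage τ s l ∧
      ∀ S : Finset V, S.card = n + 1 → (ω ∈ observed τ s S ↔ l.toFinset = S) := by
  have := countable_of_isTree hG
  have h1 : ∀ᵐ ω ∂P, ω ∈ ⋃ l ∈ histories G s n, historyPreimage τ s l := by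
    have hms : MeasurableSet (⋃ l ∈ histories G s n, historyPreimage τ s l) :=
      Finset.measurableSet_biUnion _ fun l _ => measurableSet_historyPreimage τ hm s l
    refine (mem_ae_iff_prob_eq_one hms).2 ?_
    rw [measure_biUnion_finset (pairwiseDisjoint_historyPreimage hG τ s n)
      fun l _ => measurableSet_historyPreimage τ hm s l,
      Finset.sum_congr rfl fun l hl => measure_historyPreimage P hG hδ hreg τ hm hi hlaw hl,
      Finset.sum_const, card_histories hG hδ hreg, nsmul_eq_mul]
    exact ENNReal.mul_inv_cancel (by exact_mod_cast (orderCount_pos δ n).ne')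
      (ENNReal.natCast_ne_top _)
  have h2 : ∀ᵐ ω ∂P, ∀ w, w ≠ s → 0 < edgeTime G s (fun e => τ e ω) w := by
    have := ae_edgeLaw_pos hG s
    rw [← map_edgeTime P τ hm hi hlaw s] at this
    exact ae_of_ae_map (measurable_edgeTime_comp τ hm s).aemeasurable this
  filter_upwards [h1, h2] with ω hω hpos
  simp only [Set.mem_iUnion, exists_prop] at hω
  obtain ⟨l, hl, hωl⟩ := hω
  refine ⟨l, hl, hωl, fun S hS => ?_⟩
  obtain ⟨e1, e2, e3⟩ := histories_spec hG hl
  have hobs : ω ∈ observed τ s l.toFinset := by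
    cases l with
    | nil => simp at e2
    | cons x t =>
      refine ⟨arrival G s (edgeTime G s fun e => τ e ω) x, fun w => ?_⟩
      rw [infectionTime_eq_arrival hG]
      exact arrival_le_iff_mem hG e1 e2 hpos hωl w
  constructor
  · intro h
    exact eq_of_mem_observed hobs h (e3.trans hS.symm)
  · rintro rfl
    exact hobs

open Classical in
-- Up to a null set the observation of `S` is a finite disjoint union of histories; measurability of
-- the observation event itself is not needed.
theorem measure_observed_inter (s : V) {n : ℕ} {S : Finset V} (hS : S.card = n + 1) {B : Set Ω}
    (hB : MeasurableSet B) :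
    P (observed τ s S ∩ B) =
      ∑ l ∈ (histories G s n).filter (fun l => l.toFinset = S), P (historyPreimage τ s l ∩ B) := by
  rw [← measure_biUnion_finset]
  · refine measure_congr (Filter.eventuallyEq_set.2 ?_)
    filter_upwards [ae_exists_history P hG hδ hreg τ hm hi hlaw s n] with ω ⟨l, hl, hωl, h⟩
    simp only [Set.mem_inter_iff, h S hS, Set.mem_iUnion, Finset.mem_filter, exists_prop]
    constructor
    · rintro ⟨h1, h2⟩
      exact ⟨l, ⟨hl, h1⟩, hωl, h2⟩
    · rintro ⟨l', ⟨hl', h1⟩, hωl', h2⟩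
      obtain rfl := disjoint_historyEvent hG hl hl' hωl hωl'
      exact ⟨h1, h2⟩
  · intro l hl l' hl' hne
    exact (pairwiseDisjoint_historyPreimage hG τ s n (Finset.mem_filter.1 hl).1
      (Finset.mem_filter.1 hl').1 hne).mono Set.inter_subset_left Set.inter_subset_left
  · exact fun l _ => (measurableSet_historyPreimage τ hm s l).inter hB

/-- The source enters only through the number of growth orders, so maximizing the likelihood is a
combinatorial problem. -/
theorem measure_observed (s : V) {n : ℕ} {S : Finset V} (hS : S.card = n + 1) :
    P (observed τ s S) =
      ENNReal.ofReal (n.factorial * growthRatio G {s} S / orderCount δ n) := by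
  classical
  have h := measure_observed_inter P hG hδ hreg τ hm hi hlaw s hS MeasurableSet.univ
  simp only [Set.inter_univ] at h
  rw [h, Finset.sum_congr rfl fun l hl => measure_historyPreimage P hG hδ hreg τ hm hi hlaw
    (Finset.mem_filter.1 hl).1, Finset.sum_const, ← card_filter_histories s hS, nsmul_eq_mul,
    ENNReal.ofReal_div_of_pos (by exact_mod_cast orderCount_pos δ n), ENNReal.ofReal_natCast,
    ENNReal.ofReal_natCast, div_eq_mul_inv]

theorem mlCandidates_eq_centers {n : ℕ} {S : Finset V} (hS : S.card = n + 1) :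
    mlCandidates P τ S = centers G S := by
  classical
  have hnn : ∀ u : V, 0 ≤ growthRatio G {u} S := by
    intro u
    have := card_filter_histories (G := G) u hS
    have h2 : (0 : ℝ) ≤ n.factorial * growthRatio G {u} S := by rw [← this]; positivity
    exact nonneg_of_mul_nonneg_right h2 (by positivity)
  have hc : (0 : ℝ) < orderCount δ n := by exact_mod_cast orderCount_pos δ n
  have hf : (0 : ℝ) < n.factorial := by positivity
  unfold mlCandidates centers
  refine Finset.filter_congr fun v _ => forall₂_congr fun u _ => ?_
  rw [measure_observed P hG hδ hreg τ hm hi hlaw u hS,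
    measure_observed P hG hδ hreg τ hm hi hlaw v hS,
    ENNReal.ofReal_le_ofReal_iff (by have := hnn v; positivity),
    div_le_div_iff_of_pos_right hc, mul_le_mul_iff_right₀ hf]

theorem measureReal_estimate_eq {s : V} {n : ℕ} {X : Ω → V}
    (hX : IsMLEstimate P τ s (n + 1) X) (v : V) :
    P.real {ω | X ω = v} = (grow G)^[n] (centrality G v) {s} / orderCount δ n := by
  classical
  have hq : ∀ S : Finset V, S.card = n + 1 → P (observed τ s S ∩ {ω | X ω = v}) =
      P (observed τ s S) *
        (if v ∈ centers G S then ((centers G S).card : ENNReal)⁻¹ else 0) := by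
    intro S hS
    rw [hX.2 S v hS, mlCandidates_eq_centers P hG hδ hreg τ hm hi hlaw hS]
  have h1 : P {ω | X ω = v} =
      ∑ l ∈ histories G s n, P (historyPreimage τ s l ∩ {ω | X ω = v}) := by
    rw [← measure_biUnion_finset]
    · refine measure_congr (Filter.eventuallyEq_set.2 ?_)
      filter_upwards [ae_exists_history P hG hδ hreg τ hm hi hlaw s n] with ω ⟨l, hl, hωl, h⟩
      simp only [Set.mem_iUnion, exists_prop]
      exact ⟨fun h => ⟨l, hl, hωl, h⟩, fun ⟨_, _, _, h⟩ => h⟩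
    · intro l hl l' hl' hne
      exact (pairwiseDisjoint_historyPreimage hG τ s n hl hl' hne).mono Set.inter_subset_left
        Set.inter_subset_left
    · exact fun l _ => (measurableSet_historyPreimage τ hm s l).inter (hX.1 v)
  have hmaps : ∀ l ∈ histories G s n,
      l.toFinset ∈ (histories G s n).image fun l => l.toFinset :=
    fun l hl => Finset.mem_image_of_mem _ hl
  have h2 : P {ω | X ω = v} = ∑ l ∈ histories G s n, P (historyPreimage τ s l) *
      (if v ∈ centers G l.toFinset then ((centers G l.toFinset).card : ENNReal)⁻¹ else 0) := by
    -- The law of `X` is prescribed given the observed set only, not given the history, so histories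
    -- with the same set are grouped together.
    rw [h1, ← Finset.sum_fiberwise_of_maps_to hmaps, ← Finset.sum_fiberwise_of_maps_to hmaps]
    refine Finset.sum_congr rfl fun S hS => ?_
    obtain ⟨l, hl, rfl⟩ := Finset.mem_image.1 hS
    have hcard := (histories_spec hG hl).2.2
    rw [← measure_observed_inter P hG hδ hreg τ hm hi hlaw s hcard (hX.1 v), hq _ hcard]
    have h3 := measure_observed_inter P hG hδ hreg τ hm hi hlaw s hcard MeasurableSet.univ
    simp only [Set.inter_univ] at h3
    rw [h3, Finset.sum_mul]
    refine Finset.sum_congr rfl fun l' hl' => ?_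
    rw [(Finset.mem_filter.1 hl').2]
  have h4 : ∀ l ∈ histories G s n, P (historyPreimage τ s l) *
      (if v ∈ centers G l.toFinset then ((centers G l.toFinset).card : ENNReal)⁻¹ else 0) =
      ENNReal.ofReal (centrality G v l.toFinset / orderCount δ n) := by
    intro l hl
    rw [measure_historyPreimage P hG hδ hreg τ hm hi hlaw hl,
      ← card_inv_centers_eq_centrality hG hl, ENNReal.ofReal_div_of_pos
        (by exact_mod_cast orderCount_pos δ n), ENNReal.ofReal_natCast, div_eq_mul_inv, mul_comm]
    congr 1
    split_ifs with hv
    · rw [ENNReal.ofReal_inv_of_pos (by exact_mod_cast Finset.card_pos.2 ⟨v, hv⟩),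
        ENNReal.ofReal_natCast]
    · simp
  have hnn : ∀ l ∈ histories G s n, 0 ≤ centrality G v l.toFinset / orderCount δ n := by
    intro l hl
    rw [← card_inv_centers_eq_centrality hG hl]
    split_ifs <;> positivity
  rw [measureReal_def, h2, Finset.sum_congr rfl h4, ← ENNReal.ofReal_sum_of_nonneg hnn,
    ENNReal.toReal_ofReal (Finset.sum_nonneg hnn), ← Finset.sum_div, sum_histories]

theorem distProb_eq {s : V} {n : ℕ} {X : Ω → V} (hX : IsMLEstimate P τ s (n + 1) X) (d : ℕ) :
    distProb G P s X d =
      ∑ v ∈ sphere G s d, (grow G)^[n] (centrality G v) {s} / orderCount δ n := by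
  have : {ω | G.dist (X ω) s = d} = ⋃ v ∈ sphere G s d, {ω | X ω = v} := by
    ext ω
    simp [mem_sphere hG, SimpleGraph.dist_comm]
  rw [distProb, this, measureReal_biUnion_finset]
  · exact Finset.sum_congr rfl fun v _ =>
      measureReal_estimate_eq P hG hδ hreg τ hm hi hlaw hX v
  · intro v _ w _ hvw
    rw [Function.onFun, Set.disjoint_left]
    rintro ω rfl h
    exact hvw h
  · exact fun v _ => hX.1 v

end Estimator

/-! ### Uniform growth as a Markov chain; Pólya urns. -/

section Chain

/-- The expectation of `ψ` after `n` steps of the urn process in which, when `j` of the `k` nodes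
lie in a given branch, the next node is added to it with probability `(jc + 1) / (kc + 2)`. -/
noncomputable def urn (c : ℕ) (ψ : ℕ → ℕ → ℝ) : ℕ → ℕ → ℕ → ℝ
  | 0, j, k => ψ j k
  | n + 1, j, k => ((j * c + 1) * urn c ψ n (j + 1) (k + 1) +
      (k * c + 2 - (j * c + 1)) * urn c ψ n j (k + 1)) / (k * c + 2)

/-- The probability that a node added to a network of `k` nodes is the estimate `n` steps later. -/
noncomputable def entryProb (c n k : ℕ) : ℝ :=
  1 - urn c excess n k (k + 1) - (c + 1) * urn c excess n 0 (k + 1)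

/-- The probability that a node at distance `r + 1` from a network of `k` nodes is the estimate
`n` steps later. -/
noncomputable def estimateProb (c : ℕ) : ℕ → ℕ → ℕ → ℝ
  | 0, _, _ => 0
  | n + 1, k, 0 => ((k * c + 1) * estimateProb c n (k + 1) 0 + entryProb c n k) / (k * c + 2)
  | n + 1, k, r + 1 =>
      ((k * c + 1) * estimateProb c n (k + 1) (r + 1) + estimateProb c n (k + 1) r) / (k * c + 2)

variable {V : Type*} {G : SimpleGraph V} [G.LocallyFinite]

/-- The expectation of `φ` after adding a uniformly chosen boundary node to `S`. -/
noncomputable def stepAverage (G : SimpleGraph V) [G.LocallyFinite] (c : ℕ) (φ : Finset V → ℝ)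
    (S : Finset V) : ℝ :=
  grow G φ S / (S.card * c + 2)

theorem stepAverage_iterate (c : ℕ) (φ : Finset V → ℝ) (n : ℕ) (S : Finset V) :
    (stepAverage G c)^[n] φ S =
      (grow G)^[n] φ S / ∏ i ∈ Finset.range n, (((S.card : ℝ) + i) * c + 2) := by
  classical
  induction n generalizing S with
  | zero => simp
  | succ n ih =>
    rw [Function.iterate_succ_apply', Function.iterate_succ_apply', stepAverage, grow, grow,
      Finset.prod_range_succ', Finset.sum_congr rfl (g := fun x => (grow G)^[n] φ (insert x S) /
        ∏ i ∈ Finset.range n, (((S.card : ℝ) + (i + 1 : ℕ)) * c + 2)), ← Finset.sum_div,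
      div_div, Nat.cast_zero, add_zero]
    intro x hx
    rw [ih, Finset.card_insert_of_notMem (mem_boundary.1 hx).1]
    congr 1
    refine Finset.prod_congr rfl fun i _ => ?_
    push_cast
    ring

theorem grow_iterate_div_orderCount (c : ℕ) (φ : Finset V → ℝ) (n : ℕ) (s : V) :
    (grow G)^[n] φ {s} / orderCount (c + 2) n = (stepAverage G c)^[n] φ {s} := by
  rw [stepAverage_iterate, orderCount]
  push_cast
  congr 1
  refine Finset.prod_congr rfl fun i _ => ?_
  simp [add_comm]

variable (hG : G.IsTree) {c : ℕ} (hreg : G.IsRegularOfDegree (c + 2))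
include hG hreg

open Classical in
-- Of the `k c + 2` boundary nodes exactly `j c + 1` enlarge the branch, whatever its shape.
theorem sum_boundary_urn (ψ : ℕ → ℕ → ℝ) (n : ℕ) {S : Finset V} (hS : GeodConvex G S) {v u : V}
    (hv : v ∈ S) (hu : G.Adj v u) :
    (∑ x ∈ boundary G S, urn c ψ n (branch G (insert x S) v u).card (insert x S).card) /
      (S.card * c + 2) = urn c ψ (n + 1) (branch G S v u).card S.card := by
  have h1 := card_branch_boundary hG (by omega) hreg hS hv hu
  have h2 := card_boundary hG (by omega) hreg hS ⟨v, hv⟩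
  rw [show c + 2 - 2 = c by omega] at h1 h2
  have h3 : branch G (boundary G S) v u = (boundary G S).filter fun y => toward G y v = u := rfl
  rw [h3] at h1
  have h4 := Finset.card_filter_add_card_filter_not (s := boundary G S)
    (fun y => toward G y v = u)
  rw [h1, h2] at h4
  rw [urn, ← Finset.sum_filter_add_sum_filter_not _ (fun y => toward G y v = u)]
  congr 1
  congr 1
  · rw [Finset.sum_congr rfl (g := fun _ => urn c ψ n ((branch G S v u).card + 1) (S.card + 1)),
      Finset.sum_const, h1, nsmul_eq_mul]
    · push_cast
      ring
    · intro x hx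
      rw [Finset.mem_filter] at hx
      have hxS := (mem_boundary.1 hx.1).1
      rw [Finset.card_insert_of_notMem hxS, branch, Finset.filter_insert, if_pos hx.2,
        Finset.card_insert_of_notMem fun h => hxS (Finset.mem_filter.1 h).1]
      rfl
  · rw [Finset.sum_congr rfl (g := fun _ => urn c ψ n (branch G S v u).card (S.card + 1)),
      Finset.sum_const, nsmul_eq_mul]
    · congr 1
      have : ((branch G S v u).card * c + 1 : ℝ) +
        ((boundary G S).filter fun y => ¬ toward G y v = u).card = S.card * c + 2 := by
        exact_mod_cast h4
      linarith
    · intro x hx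
      rw [Finset.mem_filter] at hx
      have hxS := (mem_boundary.1 hx.1).1
      rw [Finset.card_insert_of_notMem hxS, branch, Finset.filter_insert, if_neg hx.2]
      rfl

/-- The branches at `v` are dependent, but the weight is a sum over them, so each is followed as its
own urn. -/
theorem stepAverage_iterate_centrality (n : ℕ) {S : Finset V} (hS : GeodConvex G S) {v : V}
    (hv : v ∈ S) :
    (stepAverage G c)^[n] (centrality G v) S =
      1 - ∑ u ∈ G.neighborFinset v, urn c excess n (branch G S v u).card S.card := by
  classical
  induction n generalizing S with
  | zero => simp [centrality, hv, urn]
  | succ n ih =>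
    have h2 := card_boundary hG (by omega) hreg hS ⟨v, hv⟩
    rw [show c + 2 - 2 = c by omega] at h2
    have hpos : (0 : ℝ) < S.card * c + 2 := by positivity
    rw [Function.iterate_succ_apply', stepAverage, grow, Finset.sum_congr rfl fun x hx =>
      ih (hS.insert_boundary hG hx) (Finset.mem_insert_of_mem hv), Finset.sum_sub_distrib,
      Finset.sum_comm, Finset.sum_const, h2, nsmul_eq_mul, mul_one, sub_div, Finset.sum_div]
    congr 1
    · push_cast
      exact div_self hpos.ne'
    · refine Finset.sum_congr rfl fun u hu => ?_
      exact sum_boundary_urn hG hreg excess n hS hv ((SimpleGraph.mem_neighborFinset _ _ _).1 hu)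

open Classical in
-- When `v` is added, all older nodes lie behind its parent `p`, and the other `c + 1` branches are
-- empty.
theorem stepAverage_iterate_entry (n : ℕ) {S : Finset V} (hS : GeodConvex G S) {v : V}
    (hv : v ∈ boundary G S) :
    (stepAverage G c)^[n] (centrality G v) (insert v S) = entryProb c n S.card := by
  obtain ⟨hvS, p, hp, hpv⟩ := mem_boundary.1 hv
  rw [stepAverage_iterate_centrality hG hreg n (hS.insert_boundary hG hv)
    (Finset.mem_insert_self v S), Finset.card_insert_of_notMem hvS]
  have hpN : p ∈ G.neighborFinset v := (SimpleGraph.mem_neighborFinset _ _ _).2 hpv.symm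
  have hcard : ∀ u ∈ G.neighborFinset v,
      (branch G (insert v S) v u).card = if u = p then S.card else 0 := by
    intro u hu
    rw [SimpleGraph.mem_neighborFinset] at hu
    have hbr : branch G (insert v S) v u = if u = p then S else ∅ := by
      ext y
      rw [mem_branch, Finset.mem_insert]
      constructor
      · rintro ⟨h | h, h'⟩
        · rw [h, toward_self] at h'
          exact absurd h' hu.ne
        · rw [hS.toward_eq hG h hvS hp hpv] at h'
          rwa [if_pos h'.symm]
      · split_ifs with hup
        · intro h
          exact ⟨Or.inr h, by rw [hS.toward_eq hG h hvS hp hpv, hup]⟩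
        · simp
    rw [hbr]
    split_ifs <;> simp
  rw [Finset.sum_congr rfl fun u hu => by rw [hcard u hu],
    ← Finset.add_sum_erase _ _ hpN, if_pos rfl,
    Finset.sum_congr rfl (g := fun _ => urn c excess n 0 (S.card + 1)) fun u hu => by
      rw [if_neg (Finset.mem_erase.1 hu).1],
    Finset.sum_const, Finset.card_erase_of_mem hpN, SimpleGraph.card_neighborFinset_eq_degree,
    hreg v, entryProb, nsmul_eq_mul, show c + 2 - 1 = c + 1 by omega]
  push_cast
  ring

/-- Among the boundary nodes only the next missing ancestor of `v`, possibly `v` itself, brings the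
network closer to `v`; each of the remaining `k c + 1` merely increases its size. -/
theorem stepAverage_iterate_eq_estimateProb (n : ℕ) {S : Finset V} (hS : GeodConvex G S) {s v : V}
    (hs : s ∈ S) (r : ℕ) (hin : (toward G s)^[r + 1] v ∈ S)
    (hout : ∀ i ≤ r, (toward G s)^[i] v ∉ S) :
    (stepAverage G c)^[n] (centrality G v) S = estimateProb c n S.card r := by
  classical
  induction n generalizing S r with
  | zero => cases r <;> simp [centrality, estimateProb, show v ∉ S from hout 0 (Nat.zero_le _)]
  | succ n ih =>
    have h2 := card_boundary hG (by omega) hreg hS ⟨s, hs⟩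
    rw [show c + 2 - 2 = c by omega] at h2
    set y := (toward G s)^[r] v with hy
    have hyb : y ∈ boundary G S := by
      rw [mem_boundary_iff_toward hG hS hs]
      refine ⟨hout r le_rfl, ?_⟩
      rwa [hy, ← Function.iterate_succ_apply' (toward G s)]
    have hlater : ∀ i < r, ∀ x ∈ boundary G S, (toward G s)^[i] v ≠ x := by
      rintro i hi x hx rfl
      have := hS.toward_mem_of_boundary hG hs hx
      rw [← Function.iterate_succ_apply' (toward G s)] at this
      exact hout _ hi this
    have hother : ∑ x ∈ (boundary G S).erase y,
        (stepAverage G c)^[n] (centrality G v) (insert x S) =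
        (S.card * c + 1) * estimateProb c n (S.card + 1) r := by
      rw [Finset.sum_congr rfl (g := fun _ => estimateProb c n (S.card + 1) r), Finset.sum_const,
        Finset.card_erase_of_mem hyb, h2, nsmul_eq_mul]
      · rw [show S.card * c + 2 - 1 = S.card * c + 1 by omega]
        push_cast
        ring
      · intro x hx
        rw [Finset.mem_erase] at hx
        rw [← Finset.card_insert_of_notMem (mem_boundary.1 hx.2).1]
        refine ih (hS.insert_boundary hG hx.2) (Finset.mem_insert_of_mem hs) r
          (Finset.mem_insert_of_mem hin) fun i hi => ?_
        rw [Finset.mem_insert, not_or]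
        refine ⟨?_, hout i hi⟩
        rcases hi.lt_or_eq with h | rfl
        · exact hlater i h x hx.2
        · exact hx.1.symm
    rw [Function.iterate_succ_apply', stepAverage, grow, ← Finset.add_sum_erase _ _ hyb, hother]
    cases r with
    | zero =>
      have hyv : y = v := rfl
      rw [hyv, stepAverage_iterate_entry hG hreg n hS (hyv ▸ hyb), estimateProb, add_comm]
    | succ r =>
      rw [estimateProb, add_comm]
      congr 2
      rw [← Finset.card_insert_of_notMem (mem_boundary.1 hyb).1]
      refine ih (hS.insert_boundary hG hyb) (Finset.mem_insert_of_mem hs) r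
        (Finset.mem_insert_self _ _) fun i hi => ?_
      rw [Finset.mem_insert, not_or]
      exact ⟨hlater i (by omega) y hyb, hout i (by omega)⟩

omit [G.LocallyFinite] hreg in
theorem dist_toward_iterate (s v : V) (i : ℕ) (hi : i ≤ G.dist s v) :
    G.dist s ((toward G s)^[i] v) + i = G.dist s v := by
  induction i with
  | zero => simp
  | succ i ih =>
    have h1 := ih (by omega)
    rw [Function.iterate_succ_apply']
    have h2 : (toward G s)^[i] v ≠ s := by
      intro h
      rw [h, SimpleGraph.dist_self] at h1
      omega
    have := dist_toward hG h2
    omega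

theorem stepAverage_iterate_singleton (n : ℕ) {s v : V} {r : ℕ} (h : G.dist s v = r + 1) :
    (stepAverage G c)^[n] (centrality G v) {s} = estimateProb c n 1 r := by
  have h1 : ∀ i ≤ r, (toward G s)^[i] v ∉ ({s} : Finset V) := by
    intro i hi h'
    have := dist_toward_iterate hG s v i (by omega)
    rw [Finset.mem_singleton.1 h', SimpleGraph.dist_self] at this
    omega
  have h2 : (toward G s)^[r + 1] v ∈ ({s} : Finset V) := by
    have := dist_toward_iterate hG s v (r + 1) h.ge
    rw [Finset.mem_singleton]
    exact (eq_of_dist_eq_zero hG (by omega)).symm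
  rw [stepAverage_iterate_eq_estimateProb hG hreg n (geodConvex_singleton hG s) (by simp) r h2 h1,
    Finset.card_singleton]

omit hreg in
theorem centrality_mem_Icc (v : V) (S : Finset V) : centrality G v S ∈ Set.Icc (0 : ℝ) 1 := by
  classical
  unfold centrality
  split_ifs with hv
  · have := sum_excess_mem_Icc hG hv
    exact ⟨sub_nonneg.2 this.2, sub_le_self _ this.1⟩
  · simp

theorem stepAverage_iterate_mem_Icc (n : ℕ) {φ : Finset V → ℝ}
    (hφ : ∀ S, φ S ∈ Set.Icc (0 : ℝ) 1) {S : Finset V} (hS : GeodConvex G S) (hne : S.Nonempty) :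
    (stepAverage G c)^[n] φ S ∈ Set.Icc (0 : ℝ) 1 := by
  classical
  induction n generalizing S with
  | zero => exact hφ S
  | succ n ih =>
    have h2 := card_boundary hG (by omega) hreg hS hne
    rw [show c + 2 - 2 = c by omega] at h2
    have hpos : (0 : ℝ) < S.card * c + 2 := by positivity
    have hx := fun x (hx : x ∈ boundary G S) =>
      ih (hS.insert_boundary hG hx) (Finset.insert_nonempty x S)
    rw [Function.iterate_succ_apply', stepAverage, grow]
    refine ⟨div_nonneg (Finset.sum_nonneg fun x h => (hx x h).1) hpos.le, ?_⟩
    rw [div_le_one hpos]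
    calc _ ≤ ∑ x ∈ boundary G S, (1 : ℝ) := Finset.sum_le_sum fun x h => (hx x h).2
      _ = _ := by rw [Finset.sum_const, h2]; simp

/-- The bounds are not visible from the urn formula; they hold because the value is an average of
weights in `[0, 1]` over an actual growth. A network of the right size with `v` in its boundary is
obtained by growing from a neighbor while avoiding `v`. -/
theorem entryProb_mem_Icc (n k : ℕ) : entryProb c n (k + 1) ∈ Set.Icc (0 : ℝ) 1 := by
  classical
  obtain ⟨v⟩ := hG.connected.nonempty
  obtain ⟨S, hS, hv, hcard⟩ :
      ∃ S : Finset V, GeodConvex G S ∧ v ∈ boundary G S ∧ S.card = k + 1 := by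
    induction k with
    | zero =>
      obtain ⟨p, hp⟩ : ∃ p, G.Adj v p := by
        have : 0 < G.degree v := by rw [hreg v]; omega
        exact (G.degree_pos_iff_exists_adj v).1 this
      exact ⟨{p}, geodConvex_singleton hG p,
        mem_boundary.2 ⟨by simpa using hp.ne, p, by simp, hp.symm⟩, by simp⟩
    | succ k ih =>
      obtain ⟨S, hS, hv, hcard⟩ := ih
      obtain ⟨hvS, p, hp, hpv⟩ := mem_boundary.1 hv
      have h2 := card_boundary hG (by omega) hreg hS ⟨p, hp⟩
      obtain ⟨x, hx⟩ : ((boundary G S).erase v).Nonempty := by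
        rw [← Finset.card_pos, Finset.card_erase_of_mem hv]
        omega
      rw [Finset.mem_erase] at hx
      refine ⟨insert x S, hS.insert_boundary hG hx.2, mem_boundary.2 ⟨?_, p,
        Finset.mem_insert_of_mem hp, hpv⟩, ?_⟩
      · rw [Finset.mem_insert, not_or]
        exact ⟨hx.1.symm, hvS⟩
      · rw [Finset.card_insert_of_notMem (mem_boundary.1 hx.2).1, hcard]
  rw [← hcard, ← stepAverage_iterate_entry hG hreg n hS hv]
  exact stepAverage_iterate_mem_Icc hG hreg n (centrality_mem_Icc hG v)
    (hS.insert_boundary hG hv) (Finset.insert_nonempty v S)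

end Chain

/-! ### Beta integrals and incomplete beta functions at one half. -/

section BetaIntegral

theorem ofReal_beta_integrand {x y t : ℝ} (ht : t ∈ Set.Icc (0 : ℝ) 1) :
    ((t ^ (x - 1) * (1 - t) ^ (y - 1) : ℝ) : ℂ) =
      (t : ℂ) ^ ((x : ℂ) - 1) * (1 - (t : ℂ)) ^ ((y : ℂ) - 1) := by
  rw [Complex.ofReal_mul, Complex.ofReal_cpow ht.1, Complex.ofReal_cpow (sub_nonneg.2 ht.2)]
  push_cast
  rfl

theorem intervalIntegrable_beta {x y : ℝ} (hx : 0 < x) (hy : 0 < y) :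
    IntervalIntegrable (fun t : ℝ => t ^ (x - 1) * (1 - t) ^ (y - 1)) volume 0 1 := by
  have h := Complex.betaIntegral_convergent (u := x) (v := y) (by simpa) (by simpa)
  rw [intervalIntegrable_iff_integrableOn_Ioc_of_le zero_le_one] at h ⊢
  refine (Integrable.re h).congr ?_
  refine (ae_restrict_mem measurableSet_Ioc).mono fun t ht => ?_
  simp only [← ofReal_beta_integrand (Set.Ioc_subset_Icc_self ht)]
  exact Complex.ofReal_re _

theorem integral_beta {x y : ℝ} (hx : 0 < x) (hy : 0 < y) :
    ∫ t in (0 : ℝ)..1, t ^ (x - 1) * (1 - t) ^ (y - 1) = beta x y := by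
  rw [beta_eq_betaIntegralReal x y hx hy, Complex.betaIntegral,
    ← Complex.ofReal_re (∫ t in (0 : ℝ)..1, t ^ (x - 1) * (1 - t) ^ (y - 1)),
    ← intervalIntegral.integral_ofReal]
  congr 1
  refine intervalIntegral.integral_congr fun t ht => ?_
  rw [Set.uIcc_of_le zero_le_one] at ht
  exact ofReal_beta_integrand ht

theorem beta_add_one_left {x y : ℝ} (hx : 0 < x) (hy : 0 < y) :
    beta (x + 1) y = x / (x + y) * beta x y := by
  have h := Real.Gamma_add_one (show x + y ≠ 0 by positivity)
  have h1 := (Real.Gamma_pos_of_pos (add_pos hx hy)).ne'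
  rw [beta, beta, Real.Gamma_add_one hx.ne', show x + 1 + y = x + y + 1 by ring, h]
  field_simp

theorem beta_comm (x y : ℝ) : beta x y = beta y x := by
  rw [beta, beta, mul_comm, add_comm]

theorem beta_add_one_right {x y : ℝ} (hx : 0 < x) (hy : 0 < y) :
    beta x (y + 1) = y / (x + y) * beta x y := by
  rw [beta_comm, beta_add_one_left hy hx, beta_comm x y, add_comm x y]

theorem regIncBeta_eq (x a b : ℝ) :
    regIncBeta x a b = (∫ t in (0 : ℝ)..x, t ^ (a - 1) * (1 - t) ^ (b - 1)) / beta a b := by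
  rw [regIncBeta, beta, div_eq_inv_mul _ (_ / _), inv_div]

theorem integral_half_one (x y : ℝ) :
    ∫ t in (1 / 2 : ℝ)..1, t ^ (x - 1) * (1 - t) ^ (y - 1) =
      ∫ t in (0 : ℝ)..(1 / 2), t ^ (y - 1) * (1 - t) ^ (x - 1) := by
  have h := intervalIntegral.integral_comp_sub_left
    (a := 1 / 2) (b := 1) (fun t : ℝ => t ^ (y - 1) * (1 - t) ^ (x - 1)) 1
  rw [sub_self, show (1 : ℝ) - 1 / 2 = 1 / 2 by norm_num] at h
  rw [← h]
  refine intervalIntegral.integral_congr fun t _ => ?_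
  simp only [sub_sub_cancel]
  exact mul_comm _ _

theorem intervalIntegrable_beta_sub {x y a b : ℝ} (hx : 0 < x) (hy : 0 < y) (ha : 0 ≤ a)
    (hab : a ≤ b) (hb : b ≤ 1) :
    IntervalIntegrable (fun t : ℝ => t ^ (x - 1) * (1 - t) ^ (y - 1)) volume a b := by
  refine (intervalIntegrable_beta hx hy).mono_set ?_
  rw [Set.uIcc_of_le hab, Set.uIcc_of_le zero_le_one]
  exact Set.Icc_subset_Icc ha hb

theorem regIncBeta_half_add {x y : ℝ} (hx : 0 < x) (hy : 0 < y) :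
    regIncBeta (1 / 2) x y + regIncBeta (1 / 2) y x = 1 := by
  rw [regIncBeta_eq, regIncBeta_eq, ← integral_half_one x y, beta_comm y x, ← add_div,
    intervalIntegral.integral_add_adjacent_intervals
      (intervalIntegrable_beta_sub hx hy le_rfl (by norm_num) (by norm_num))
      (intervalIntegrable_beta_sub hx hy (by norm_num) (by norm_num) le_rfl),
    integral_beta hx hy, div_self (beta_pos hx hy).ne']

theorem regIncBeta_half_nonneg {x y : ℝ} (hx : 0 < x) (hy : 0 < y) :
    0 ≤ regIncBeta (1 / 2) x y := by
  rw [regIncBeta_eq]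
  refine div_nonneg (intervalIntegral.integral_nonneg (by norm_num) fun t ht => ?_)
    (beta_pos hx hy).le
  have : 0 ≤ 1 - t := by linarith [ht.2]
  have := ht.1
  positivity

/-- In the incomplete integral `(1 - t) ^ (b - 1) ≤ 1` since `1 ≤ b`; in the full one `b ≤ 2` gives
the lower bound `beta a 2 = 1 / (a (a + 1))`. -/
theorem regIncBeta_half_le {a b : ℝ} (ha : 0 < a) (hb : 1 ≤ b) (hb' : b ≤ 2) :
    regIncBeta (1 / 2) a b ≤ (a + 1) * (1 / 2) ^ a := by
  have hb0 : 0 < b := by linarith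
  have h1 : ∫ t in (0 : ℝ)..(1 / 2), t ^ (a - 1) * (1 - t) ^ (b - 1) ≤ (1 / 2) ^ a / a := by
    have e : ∫ t in (0 : ℝ)..(1 / 2), t ^ (a - 1) = (1 / 2) ^ a / a := by
      rw [integral_rpow (Or.inl (by linarith)), sub_add_cancel, Real.zero_rpow ha.ne', sub_zero]
    rw [← e]
    refine intervalIntegral.integral_mono_on (by norm_num)
      (intervalIntegrable_beta_sub ha hb0 le_rfl (by norm_num) (by norm_num))
      (intervalIntegral.intervalIntegrable_rpow' (by linarith)) fun t ht => ?_
    have h2 : 0 ≤ 1 - t := by linarith [ht.2]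
    refine mul_le_of_le_one_right (Real.rpow_nonneg ht.1 _) ?_
    exact Real.rpow_le_one h2 (by linarith [ht.1]) (by linarith)
  have h3 : 1 / (a * (a + 1)) ≤ beta a b := by
    have e : beta a 2 = 1 / (a * (a + 1)) := by
      have h := beta_add_one_right ha one_pos
      have g1 := (Real.Gamma_pos_of_pos ha).ne'
      rw [show (1 : ℝ) + 1 = 2 by norm_num] at h
      rw [h, beta, Real.Gamma_one, Real.Gamma_add_one ha.ne']
      field_simp
    rw [← e, ← integral_beta ha two_pos, ← integral_beta ha hb0]
    refine intervalIntegral.integral_mono_on_of_le_Ioo zero_le_one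
      (intervalIntegrable_beta ha two_pos) (intervalIntegrable_beta ha hb0) fun t ht => ?_
    have h2 : 0 < 1 - t := by linarith [ht.2]
    refine mul_le_mul_of_nonneg_left ?_ (Real.rpow_nonneg ht.1.le _)
    exact Real.rpow_le_rpow_of_exponent_ge h2 (by linarith [ht.1]) (by linarith)
  rw [regIncBeta_eq, div_le_iff₀ (beta_pos ha hb0)]
  refine h1.trans ?_
  have h4 : (0 : ℝ) < (1 / 2) ^ a := by positivity
  calc (1 / 2 : ℝ) ^ a / a = (a + 1) * (1 / 2) ^ a * (1 / (a * (a + 1))) := by field_simp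
    _ ≤ _ := mul_le_mul_of_nonneg_left h3 (by positivity)

end BetaIntegral

/-! ### Law of large numbers for Bernoulli walks. -/

section BernoulliWalk

/-- The expectation of `ψ j k` after `n` steps in each of which `k` increases by one and `j`
increases by one with probability `t`. -/
noncomputable def bernoulliWalk (t : ℝ) (ψ : ℕ → ℕ → ℝ) : ℕ → ℕ → ℕ → ℝ
  | 0, j, k => ψ j k
  | n + 1, j, k =>
      t * bernoulliWalk t ψ n (j + 1) (k + 1) + (1 - t) * bernoulliWalk t ψ n j (k + 1)

theorem continuous_bernoulliWalk (ψ : ℕ → ℕ → ℝ) (n j k : ℕ) :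
    Continuous fun t => bernoulliWalk t ψ n j k := by
  induction n generalizing j k with
  | zero => exact continuous_const
  | succ n ih =>
    have h1 := ih (j + 1) (k + 1)
    have h2 := ih j (k + 1)
    simp only [bernoulliWalk]
    fun_prop

theorem bernoulliWalk_mono {t : ℝ} (ht : t ∈ Set.Icc (0 : ℝ) 1) {ψ ψ' : ℕ → ℕ → ℝ} {n j k : ℕ}
    (h : ∀ i, ψ i (k + n) ≤ ψ' i (k + n)) :
    bernoulliWalk t ψ n j k ≤ bernoulliWalk t ψ' n j k := by
  induction n generalizing j k with
  | zero => exact h j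
  | succ n ih =>
    have h' : ∀ i, ψ i (k + 1 + n) ≤ ψ' i (k + 1 + n) := by
      intro i
      have := h i
      rwa [show k + (n + 1) = k + 1 + n by ring] at this
    exact add_le_add (mul_le_mul_of_nonneg_left (ih h') ht.1)
      (mul_le_mul_of_nonneg_left (ih h') (sub_nonneg.2 ht.2))

theorem bernoulliWalk_const (t a : ℝ) (n j k : ℕ) :
    bernoulliWalk t (fun _ _ => a) n j k = a := by
  induction n generalizing j k with
  | zero => rfl
  | succ n ih => rw [bernoulliWalk, ih, ih]; ring

theorem bernoulliWalk_one_sub (t : ℝ) (ψ : ℕ → ℕ → ℝ) (n j k : ℕ) :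
    bernoulliWalk t (fun i l => 1 - ψ i l) n j k = 1 - bernoulliWalk t ψ n j k := by
  induction n generalizing j k with
  | zero => rfl
  | succ n ih => rw [bernoulliWalk, bernoulliWalk, ih, ih]; ring

/-- The centered position moves by independent mean-zero steps of variance `t (1 - t)`, so variances
add. -/
theorem bernoulliWalk_sq (t a : ℝ) (n j k : ℕ) :
    bernoulliWalk t (fun i l => a * ((i : ℝ) - l * t) ^ 2) n j k =
      a * (((j : ℝ) - k * t) ^ 2 + n * (t * (1 - t))) := by
  induction n generalizing j k with
  | zero => simp [bernoulliWalk]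
  | succ n ih =>
    rw [bernoulliWalk, ih, ih]
    push_cast
    ring

theorem excess_nonneg (j n : ℕ) : 0 ≤ excess j n := by
  unfold excess
  split_ifs <;> norm_num

theorem excess_le_one (j n : ℕ) : excess j n ≤ 1 := by
  unfold excess
  split_ifs <;> norm_num

/-- Chebyshev's inequality pointwise: the excess vanishes unless the deviation is at least `n (1 / 2
- t)`. -/
theorem excess_le {t : ℝ} (ht : t < 1 / 2) (j : ℕ) {n : ℕ} (hn : 0 < n) :
    excess j n ≤ 1 / ((n : ℝ) * (t - 1 / 2)) ^ 2 * ((j : ℝ) - n * t) ^ 2 := by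
  have hn' : (0 : ℝ) < n := by exact_mod_cast hn
  by_cases h : n ≤ 2 * j
  · refine (excess_le_one j n).trans ?_
    have h' : (n : ℝ) ≤ 2 * j := by exact_mod_cast h
    have h1 : 0 < (n : ℝ) * (1 / 2 - t) := mul_pos hn' (by linarith)
    have h2 : (n : ℝ) * (1 / 2 - t) ≤ j - n * t := by linarith
    have h3 : ((n : ℝ) * (t - 1 / 2)) ^ 2 = ((n : ℝ) * (1 / 2 - t)) ^ 2 := by ring
    rw [h3, div_mul_eq_mul_div, one_mul, one_le_div (by positivity)]
    exact pow_le_pow_left₀ h1.le h2 2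
  · rw [excess, if_neg (by omega), if_neg (by omega)]
    positivity

theorem one_sub_excess_le {t : ℝ} (ht : 1 / 2 < t) (j : ℕ) {n : ℕ} (hn : 0 < n) :
    1 - excess j n ≤ 1 / ((n : ℝ) * (t - 1 / 2)) ^ 2 * ((j : ℝ) - n * t) ^ 2 := by
  have hn' : (0 : ℝ) < n := by exact_mod_cast hn
  by_cases h : n < 2 * j
  · rw [excess, if_pos h, sub_self]
    positivity
  · refine (sub_le_self _ (excess_nonneg j n)).trans ?_
    have h' : (2 * j : ℝ) ≤ n := by exact_mod_cast not_lt.1 h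
    have h1 : 0 < (n : ℝ) * (t - 1 / 2) := mul_pos hn' (by linarith)
    have h2 : (n : ℝ) * (t - 1 / 2) ≤ n * t - j := by linarith
    rw [div_mul_eq_mul_div, one_mul, one_le_div (by positivity), ← neg_sq ((j : ℝ) - n * t)]
    exact pow_le_pow_left₀ h1.le (by linarith) 2

theorem bernoulliWalk_excess_mem_Icc {t : ℝ} (ht : t ∈ Set.Icc (0 : ℝ) 1) (n j k : ℕ) :
    bernoulliWalk t excess n j k ∈ Set.Icc (0 : ℝ) 1 := by
  constructor
  · rw [← bernoulliWalk_const t 0 n j k]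
    exact bernoulliWalk_mono ht fun i => excess_nonneg _ _
  · rw [← bernoulliWalk_const t 1 n j k]
    exact bernoulliWalk_mono ht fun i => excess_le_one _ _

theorem tendsto_bernoulliWalk_excess {t : ℝ} (ht : t ∈ Set.Icc (0 : ℝ) 1) (hne : t ≠ 1 / 2)
    (j k : ℕ) :
    Tendsto (fun n => bernoulliWalk t excess n j k) atTop (𝓝 (if 1 / 2 < t then 1 else 0)) := by
  set A := ((j : ℝ) - k * t) ^ 2 + t * (1 - t) with hA
  have hB : 0 ≤ t * (1 - t) := mul_nonneg ht.1 (sub_nonneg.2 ht.2)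
  have hlim : Tendsto (fun n : ℕ => A / (t - 1 / 2) ^ 2 / (n : ℝ)) atTop (𝓝 0) :=
    tendsto_const_div_atTop_nhds_zero_nat _
  have hsq : 0 < (t - 1 / 2) ^ 2 := by
    have : t - 1 / 2 ≠ 0 := sub_ne_zero.2 hne
    positivity
  have hbound : ∀ n : ℕ, 0 < n → 1 / (((k + n : ℕ) : ℝ) * (t - 1 / 2)) ^ 2 *
      (((j : ℝ) - k * t) ^ 2 + n * (t * (1 - t))) ≤ A / (t - 1 / 2) ^ 2 / (n : ℝ) := by
    intro n hn
    have hn' : (1 : ℝ) ≤ n := by exact_mod_cast hn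
    have h1 : ((j : ℝ) - k * t) ^ 2 + n * (t * (1 - t)) ≤ n * A := by
      rw [hA, mul_add]
      have := mul_le_mul_of_nonneg_right hn' (sq_nonneg ((j : ℝ) - k * t))
      linarith
    have h2 : (n : ℝ) ^ 2 * (t - 1 / 2) ^ 2 ≤ (((k + n : ℕ) : ℝ) * (t - 1 / 2)) ^ 2 := by
      rw [mul_pow]
      refine mul_le_mul_of_nonneg_right (pow_le_pow_left₀ (by positivity) ?_ 2) hsq.le
      push_cast
      linarith [(Nat.cast_nonneg k : (0 : ℝ) ≤ k)]
    have hA0 : 0 ≤ A := by positivity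
    calc _ ≤ 1 / ((n : ℝ) ^ 2 * (t - 1 / 2) ^ 2) * (n * A) := by
          refine mul_le_mul (one_div_le_one_div_of_le (by positivity) h2) h1 (by positivity)
            (by positivity)
      _ = _ := by field_simp
  rcases lt_or_gt_of_ne hne with h | h
  · rw [if_neg (not_lt.2 h.le)]
    refine squeeze_zero' (Eventually.of_forall fun n =>
      (bernoulliWalk_excess_mem_Icc ht n j k).1) ?_ hlim
    filter_upwards [eventually_gt_atTop 0] with n hn
    refine le_trans ?_ (hbound n hn)
    rw [← bernoulliWalk_sq]
    exact bernoulliWalk_mono ht fun i => excess_le h i (by omega)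
  · rw [if_pos h]
    have : Tendsto (fun n => 1 - bernoulliWalk t excess n j k) atTop (𝓝 0) := by
      refine squeeze_zero' (Eventually.of_forall fun n =>
        sub_nonneg.2 (bernoulliWalk_excess_mem_Icc ht n j k).2) ?_ hlim
      filter_upwards [eventually_gt_atTop 0] with n hn
      refine le_trans ?_ (hbound n hn)
      rw [← bernoulliWalk_sq, ← bernoulliWalk_one_sub]
      refine bernoulliWalk_mono ht fun i => ?_
      exact one_sub_excess_le h i (by omega)
    simpa using this.const_sub 1

end BernoulliWalk

/-! ### Urns as Beta mixtures, and their limits. -/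

section UrnLimit

/-- De Finetti's representation of the Pólya urn. A factor `t` or `1 - t` raises one Beta parameter
by one, and the quotient of the normalizing constants is exactly the transition probability of the
urn. -/
theorem urn_eq_integral {c : ℕ} (hc : 0 < c) (ψ : ℕ → ℕ → ℝ) (n j i : ℕ) :
    urn c ψ n j (j + i) =
      (∫ t in (0 : ℝ)..1, t ^ ((j : ℝ) + 1 / c - 1) * (1 - t) ^ ((i : ℝ) + 1 / c - 1) *
        bernoulliWalk t ψ n j (j + i)) / beta (j + 1 / c) (i + 1 / c) := by
  have hc' : (0 : ℝ) < c := by exact_mod_cast hc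
  induction n generalizing j i with
  | zero =>
    simp only [urn, bernoulliWalk]
    have hx : (0 : ℝ) < j + 1 / c := by positivity
    have hy : (0 : ℝ) < i + 1 / c := by positivity
    rw [intervalIntegral.integral_mul_const, integral_beta hx hy]
    rw [mul_div_cancel_left₀ _ (beta_pos hx hy).ne']
  | succ n ih =>
    have hx : (0 : ℝ) < j + 1 / c := by positivity
    have hy : (0 : ℝ) < i + 1 / c := by positivity
    have hx1 : (0 : ℝ) < j + 1 / c + 1 := by positivity
    have hy1 : (0 : ℝ) < i + 1 / c + 1 := by positivity
    have h1 := ih (j + 1) i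
    have h2 := ih j (i + 1)
    rw [show j + 1 + i = j + i + 1 by ring, show ((j + 1 : ℕ) : ℝ) + 1 / c = j + 1 / c + 1 by
      push_cast; ring, beta_add_one_left hx hy] at h1
    rw [show j + (i + 1) = j + i + 1 by ring, show ((i + 1 : ℕ) : ℝ) + 1 / c = i + 1 / c + 1 by
      push_cast; ring, beta_add_one_right hx hy] at h2
    have hint : ∫ t in (0 : ℝ)..1, t ^ ((j : ℝ) + 1 / c - 1) * (1 - t) ^ ((i : ℝ) + 1 / c - 1) *
        bernoulliWalk t ψ (n + 1) j (j + i) =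
        (∫ t in (0 : ℝ)..1, t ^ ((j : ℝ) + 1 / c + 1 - 1) * (1 - t) ^ ((i : ℝ) + 1 / c - 1) *
          bernoulliWalk t ψ n (j + 1) (j + i + 1)) +
        ∫ t in (0 : ℝ)..1, t ^ ((j : ℝ) + 1 / c - 1) * (1 - t) ^ ((i : ℝ) + 1 / c + 1 - 1) *
          bernoulliWalk t ψ n j (j + i + 1) := by
      rw [← intervalIntegral.integral_add
        ((intervalIntegrable_beta hx1 hy).mul_continuousOn
          (continuous_bernoulliWalk ψ n _ _).continuousOn)
        ((intervalIntegrable_beta hx hy1).mul_continuousOn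
          (continuous_bernoulliWalk ψ n _ _).continuousOn),
        -- On the open interval both bases are nonzero, as `Real.rpow_add_one` requires.
        intervalIntegral.integral_of_le zero_le_one, intervalIntegral.integral_of_le zero_le_one,
        integral_Ioc_eq_integral_Ioo, integral_Ioc_eq_integral_Ioo]
      refine setIntegral_congr_fun measurableSet_Ioo fun t ht => ?_
      have e1 : t ^ ((j : ℝ) + 1 / c + 1 - 1) = t ^ ((j : ℝ) + 1 / c - 1) * t := by
        rw [← Real.rpow_add_one ht.1.ne']
        ring_nf
      have e2 : (1 - t) ^ ((i : ℝ) + 1 / c + 1 - 1) = (1 - t) ^ ((i : ℝ) + 1 / c - 1) * (1 - t) := by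
        rw [← Real.rpow_add_one (sub_pos.2 ht.2).ne']
        ring_nf
      simp only [e1, e2, bernoulliWalk]
      ring
    have hb := (beta_pos hx hy).ne'
    have hxy : (j : ℝ) + 1 / c + (i + 1 / c) ≠ 0 := by positivity
    rw [hint, urn, h1, h2]
    have e3 : (((j + i : ℕ) : ℝ) * c + 2 - (j * c + 1)) = i * c + 1 := by push_cast; ring
    have e4 : (((j + i : ℕ) : ℝ) * c + 2) = c * ((j : ℝ) + 1 / c + (i + 1 / c)) := by
      push_cast
      field_simp
      ring
    have e5 : (j : ℝ) * c + 1 = c * (j + 1 / c) := by field_simp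
    have e6 : (i : ℝ) * c + 1 = c * (i + 1 / c) := by field_simp
    rw [e3, e4, e5, e6]
    generalize (j : ℝ) + 1 / c = x at *
    generalize (i : ℝ) + 1 / c = y at *
    field_simp

/-- By dominated convergence the limit is the Beta mass above `1 / 2`; reflecting `t` to `1 - t`
makes it an integral over `[0, 1 / 2]` and exchanges the parameters. -/
theorem tendsto_urn_excess {c : ℕ} (hc : 0 < c) (j i : ℕ) :
    Tendsto (fun n => urn c excess n j (j + i)) atTop
      (𝓝 (regIncBeta (1 / 2) (i + 1 / c) (j + 1 / c))) := by
  have hc' : (0 : ℝ) < c := by exact_mod_cast hc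
  have hx : (0 : ℝ) < j + 1 / c := by positivity
  have hy : (0 : ℝ) < i + 1 / c := by positivity
  simp only [urn_eq_integral hc]
  set x := (j : ℝ) + 1 / c
  set y := (i : ℝ) + 1 / c
  rw [regIncBeta_eq, beta_comm y x]
  refine Tendsto.div_const ?_ _
  have hlim : ∫ t in (0 : ℝ)..1, t ^ (x - 1) * (1 - t) ^ (y - 1) *
      (if 1 / 2 < t then (1 : ℝ) else 0) =
      ∫ t in (0 : ℝ)..(1 / 2), t ^ (y - 1) * (1 - t) ^ (x - 1) := by
    have e1 : Set.EqOn (fun _ : ℝ => (0 : ℝ)) (fun t : ℝ => t ^ (x - 1) * (1 - t) ^ (y - 1) *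
        (if 1 / 2 < t then (1 : ℝ) else 0)) (Set.uIoc 0 (1 / 2)) := by
      intro t ht
      rw [Set.uIoc_of_le (by norm_num)] at ht
      simp only
      rw [if_neg (not_lt.2 ht.2), mul_zero]
    have e2 : Set.EqOn (fun t : ℝ => t ^ (x - 1) * (1 - t) ^ (y - 1))
        (fun t : ℝ => t ^ (x - 1) * (1 - t) ^ (y - 1) *
        (if 1 / 2 < t then (1 : ℝ) else 0)) (Set.uIoc (1 / 2) 1) := by
      intro t ht
      rw [Set.uIoc_of_le (by norm_num)] at ht
      simp only
      rw [if_pos ht.1, mul_one]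
    rw [← integral_half_one, ← intervalIntegral.integral_add_adjacent_intervals
      ((intervalIntegrable_const (c := (0 : ℝ))).congr e1)
      ((intervalIntegrable_beta_sub hx hy (by norm_num) (by norm_num) le_rfl).congr e2),
      ← intervalIntegral.integral_congr_ae (Eventually.of_forall fun t ht => e1 ht),
      ← intervalIntegral.integral_congr_ae (Eventually.of_forall fun t ht => e2 ht)]
    simp
  rw [← hlim]
  refine intervalIntegral.tendsto_integral_filter_of_dominated_convergence
    (fun t => t ^ (x - 1) * (1 - t) ^ (y - 1)) ?_ ?_ (intervalIntegrable_beta hx hy) ?_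
  · refine Eventually.of_forall fun n => ?_
    exact ((intervalIntegrable_beta hx hy).mul_continuousOn
      (continuous_bernoulliWalk excess n _ _).continuousOn).def'.aestronglyMeasurable
  · refine Eventually.of_forall fun n => Eventually.of_forall fun t ht => ?_
    rw [Set.uIoc_of_le zero_le_one] at ht
    have h1 := bernoulliWalk_excess_mem_Icc (Set.Ioc_subset_Icc_self ht) n j (j + i)
    have h2 : 0 ≤ t ^ (x - 1) * (1 - t) ^ (y - 1) :=
      mul_nonneg (Real.rpow_nonneg ht.1.le _) (Real.rpow_nonneg (sub_nonneg.2 ht.2) _)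
    rw [Real.norm_of_nonneg (mul_nonneg h2 h1.1)]
    exact mul_le_of_le_one_right h2 h1.2
  · have : ∀ᵐ t : ℝ, t ≠ 1 / 2 := by simp [ae_iff]
    filter_upwards [this] with t ht htm
    rw [Set.uIoc_of_le zero_le_one] at htm
    exact (tendsto_bernoulliWalk_excess (Set.Ioc_subset_Icc_self htm) ht j (j + i)).const_mul _

theorem tendsto_entryProb {c : ℕ} (hc : 0 < c) (k : ℕ) :
    Tendsto (fun n => entryProb c n k) atTop (𝓝 (p₂ (c + 2) (k + 1))) := by
  have hc' : (0 : ℝ) < c := by exact_mod_cast hc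
  have h1 := tendsto_urn_excess hc k 1
  have h2 := tendsto_urn_excess hc 0 (k + 1)
  simp only [zero_add] at h2
  have h3 := (h1.const_sub 1).sub (h2.const_mul ((c : ℝ) + 1))
  have hx : (0 : ℝ) < k + 1 / c := by positivity
  have hy : (0 : ℝ) < ((1 : ℕ) : ℝ) + 1 / c := by positivity
  have h4 := regIncBeta_half_add hx hy
  have e0 : ((c + 2 : ℕ) : ℝ) - 2 = c := by push_cast; ring
  have e1 : ((c + 2 : ℕ) : ℝ) - 1 = c + 1 := by push_cast; ring
  have e2 : ((k + 1 : ℕ) : ℝ) - 1 + 1 / (c : ℝ) = k + 1 / c := by push_cast; ring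
  have e3 : ((k + 1 : ℕ) : ℝ) - 1 + ((c : ℝ) + 1) / (c : ℝ) = ((k + 1 : ℕ) : ℝ) + 1 / c := by
    push_cast; field_simp; ring
  have e4 : ((c : ℝ) + 1) / (c : ℝ) = ((1 : ℕ) : ℝ) + 1 / c := by push_cast; field_simp
  -- The branch behind the parent starts with `k` nodes against one; the reflection formula `h4`
  -- turns one minus its limit into the first term of `p₂`.
  have e5 : p₂ (c + 2) (k + 1) = 1 - regIncBeta (1 / 2) ((1 : ℕ) + 1 / c) (k + 1 / c) -
      (c + 1) * regIncBeta (1 / 2) ((k + 1 : ℕ) + 1 / c) ((0 : ℕ) + 1 / c) := by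
    rw [p₂, e0, e1, e3, e2, e4, Nat.cast_zero, zero_add]
    linarith
  rw [e5]
  exact h3

theorem p₂_le {c : ℕ} (hc : 0 < c) {k : ℕ} (hk : 0 < k) :
    p₂ (c + 2) (k + 1) ≤ (k + 2) * (1 / 2) ^ k := by
  have hc' : (1 : ℝ) ≤ c := by exact_mod_cast hc
  have hk' : (1 : ℝ) ≤ k := by exact_mod_cast hk
  have e0 : ((c + 2 : ℕ) : ℝ) - 2 = c := by push_cast; ring
  have e1 : ((c + 2 : ℕ) : ℝ) - 1 = c + 1 := by push_cast; ring
  have e2 : ((k + 1 : ℕ) : ℝ) - 1 + 1 / (c : ℝ) = k + 1 / c := by push_cast; ring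
  have e3 : ((k + 1 : ℕ) : ℝ) - 1 + ((c : ℝ) + 1) / (c : ℝ) = k + 1 + 1 / c := by
    push_cast; field_simp; ring
  have e4 : ((c : ℝ) + 1) / (c : ℝ) = 1 + 1 / c := by field_simp
  have hα0 : 0 < 1 / (c : ℝ) := by positivity
  have hα1 : 1 / (c : ℝ) ≤ 1 := by
    rw [div_le_one (by linarith)]
    exact hc'
  have h1 := regIncBeta_half_nonneg (x := k + 1 + 1 / c) (y := 1 / c) (by positivity) hα0
  have h2 := regIncBeta_half_le (a := k + 1 / c) (b := 1 + 1 / c) (by positivity)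
    (by linarith) (by linarith)
  rw [p₂, e0, e1, e3, e2, e4]
  have h3 := mul_nonneg (show (0 : ℝ) ≤ c + 1 by positivity) h1
  have h4 : ((1 : ℝ) / 2) ^ ((k : ℝ) + 1 / c) ≤ (1 / 2) ^ k := by
    rw [← Real.rpow_natCast]
    exact Real.rpow_le_rpow_of_exponent_ge (by norm_num) (by norm_num) (by linarith)
  have h5 : ((k : ℝ) + 1 / c + 1) * (1 / 2) ^ ((k : ℝ) + 1 / c) ≤ (k + 2) * (1 / 2) ^ k :=
    mul_le_mul (by linarith) h4 (by positivity) (by positivity)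
  linarith

end UrnLimit

/-! ### The law of the moment at which a node is added. -/

section EntryWeight

theorem sum_powersetCard_succ_insert {ι : Type*} [DecidableEq ι] {a : ι} {s : Finset ι} (ha : a ∉ s) (f : ι → ℝ)
    (r : ℕ) :
    ∑ J ∈ (insert a s).powersetCard (r + 1), ∏ j ∈ J, f j =
      ∑ J ∈ s.powersetCard (r + 1), ∏ j ∈ J, f j +
        f a * ∑ J ∈ s.powersetCard r, ∏ j ∈ J, f j := by
  have hmem : ∀ {n : ℕ} {J : Finset ι}, J ∈ s.powersetCard n → a ∉ J := fun hJ h =>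
    ha ((Finset.mem_powersetCard.1 hJ).1 h)
  rw [Finset.powersetCard_succ_insert ha, Finset.sum_union, Finset.sum_image, Finset.mul_sum]
  · congr 1
    exact Finset.sum_congr rfl fun J hJ => Finset.prod_insert (hmem hJ)
  · intro J hJ J' hJ' h
    rw [← Finset.erase_insert (hmem hJ), ← Finset.erase_insert (hmem hJ'), h]
  · rw [Finset.disjoint_left]
    intro J hJ hJ'
    obtain ⟨J', _, rfl⟩ := Finset.mem_image.1 hJ'
    exact hmem hJ (Finset.mem_insert_self a J')

/-- The probability that a node at distance `r + 1` from a network of `k` nodes is added when the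
network has `k + i` nodes. -/
noncomputable def entryWeight (c k r i : ℕ) : ℝ :=
  (1 / (c : ℝ)) ^ (r + 1) *
    ((∏ j ∈ Finset.range i, ((k : ℝ) + j + 1 / c)) /
      ∏ j ∈ Finset.range (i + 1), ((k : ℝ) + j + 2 / c)) *
    ∑ J ∈ (Finset.Ico k (k + i)).powersetCard r, ∏ j ∈ J, 1 / ((j : ℝ) + 1 / c)

theorem entryWeight_nonneg (c k r i : ℕ) : 0 ≤ entryWeight c k r i := by
  unfold entryWeight
  refine mul_nonneg (by positivity) (Finset.sum_nonneg fun J _ => ?_)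
  exact Finset.prod_nonneg fun j _ => by positivity

theorem entryWeight_eq_zero (c k : ℕ) {r i : ℕ} (h : i < r) : entryWeight c k r i = 0 := by
  rw [entryWeight, Finset.powersetCard_eq_empty.2 (by simpa using h), Finset.sum_empty, mul_zero]

theorem entryWeight_zero_zero {c : ℕ} (hc : 0 < c) (k : ℕ) :
    entryWeight c k 0 0 = 1 / (k * c + 2) := by
  have hc' : (0 : ℝ) < c := by exact_mod_cast hc
  simp only [entryWeight, zero_add, pow_one, Finset.range_zero, Finset.prod_empty,
    Finset.range_one, Finset.prod_singleton, Nat.cast_zero, add_zero, Finset.powersetCard_zero,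
    Finset.sum_singleton, mul_one]
  field_simp

theorem entryWeight_ratio {c : ℕ} (hc : 0 < c) (k i : ℕ) :
    (∏ j ∈ Finset.range (i + 1), ((k : ℝ) + j + 1 / c)) /
      ∏ j ∈ Finset.range (i + 1 + 1), ((k : ℝ) + j + 2 / c) =
    (k * c + 1) / (k * c + 2) * ((∏ j ∈ Finset.range i, (((k + 1 : ℕ) : ℝ) + j + 1 / c)) /
      ∏ j ∈ Finset.range (i + 1), (((k + 1 : ℕ) : ℝ) + j + 2 / c)) := by
  have hc' : (0 : ℝ) < c := by exact_mod_cast hc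
  rw [Finset.prod_range_succ', Finset.prod_range_succ' _ (i + 1), mul_comm (∏ _ ∈ _, _),
    mul_comm (∏ _ ∈ Finset.range (i + 1), _), mul_div_mul_comm]
  congr 1
  · rw [Nat.cast_zero, add_zero]
    field_simp
  · congr 1 <;> refine Finset.prod_congr rfl fun j _ => ?_ <;> push_cast <;> ring

theorem entryWeight_zero_succ {c : ℕ} (hc : 0 < c) (k i : ℕ) :
    entryWeight c k 0 (i + 1) = (k * c + 1) / (k * c + 2) * entryWeight c (k + 1) 0 i := by
  rw [entryWeight, entryWeight, entryWeight_ratio hc]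
  simp only [Finset.powersetCard_zero, Finset.sum_singleton, Finset.prod_empty]
  ring

theorem entryWeight_succ_succ {c : ℕ} (hc : 0 < c) (k r i : ℕ) :
    entryWeight c k (r + 1) (i + 1) =
      ((k * c + 1) * entryWeight c (k + 1) (r + 1) i + entryWeight c (k + 1) r i) /
        (k * c + 2) := by
  have hc' : (0 : ℝ) < c := by exact_mod_cast hc
  -- The sets `J` record the network sizes at which the `r + 1` missing ancestors are hit. They are
  -- split according to whether the current size `k` belongs to `J`.
  have hI : Finset.Ico k (k + (i + 1)) = insert k (Finset.Ico (k + 1) (k + 1 + i)) := by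
    ext j
    simp only [Finset.mem_Ico, Finset.mem_insert]
    omega
  rw [entryWeight, entryWeight, entryWeight, entryWeight_ratio hc, hI,
    sum_powersetCard_succ_insert (by simp) (fun j : ℕ => 1 / ((j : ℝ) + 1 / c))]
  generalize (∏ j ∈ Finset.range i, (((k + 1 : ℕ) : ℝ) + j + 1 / c)) /
      ∏ j ∈ Finset.range (i + 1), (((k + 1 : ℕ) : ℝ) + j + 2 / c) = R
  generalize (∑ J ∈ (Finset.Ico (k + 1) (k + 1 + i)).powersetCard (r + 1),
    ∏ j ∈ J, 1 / ((j : ℝ) + 1 / c)) = x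
  generalize (∑ J ∈ (Finset.Ico (k + 1) (k + 1 + i)).powersetCard r,
    ∏ j ∈ J, 1 / ((j : ℝ) + 1 / c)) = y
  have h1 : (k : ℝ) * c + 1 ≠ 0 := by positivity
  have e1 : (k * c + 1 : ℝ) * (1 / ((k : ℝ) + 1 / c)) = c := by field_simp
  have e2 : (1 / (c : ℝ)) ^ (r + 1 + 1) * c = (1 / (c : ℝ)) ^ (r + 1) := by
    rw [pow_succ (1 / (c : ℝ)) (r + 1)]
    field_simp
  calc _ = ((k * c + 1) * ((1 / (c : ℝ)) ^ (r + 1 + 1) * R * x) +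
        (1 / (c : ℝ)) ^ (r + 1 + 1) * ((k * c + 1 : ℝ) * (1 / ((k : ℝ) + 1 / c))) * R * y) /
        (k * c + 2) := by ring
    _ = _ := by rw [e1, e2]

/-- Decomposition by the size `k + i` at which the node is added: `i` steps precede it and the
addition uses one more, so `n - 1 - i` steps are left. -/
theorem estimateProb_eq_sum {c : ℕ} (hc : 0 < c) (n k r : ℕ) :
    estimateProb c n k r =
      ∑ i ∈ Finset.range n, entryWeight c k r i * entryProb c (n - 1 - i) (k + i) := by
  have hshift : ∀ n k r, ∑ i ∈ Finset.range n,
      entryWeight c (k + 1) r i * entryProb c (n + 1 - 1 - (i + 1)) (k + (i + 1)) =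
      ∑ i ∈ Finset.range n, entryWeight c (k + 1) r i * entryProb c (n - 1 - i) (k + 1 + i) := by
    intro n k r
    refine Finset.sum_congr rfl fun i _ => ?_
    rw [show n + 1 - 1 - (i + 1) = n - 1 - i by omega, show k + (i + 1) = k + 1 + i by omega]
  induction n generalizing k r with
  | zero => cases r <;> simp [estimateProb]
  | succ n ih =>
    rw [Finset.sum_range_succ']
    cases r with
    | zero =>
      rw [estimateProb, ih, ← hshift, entryWeight_zero_zero hc]
      simp only [entryWeight_zero_succ hc, Nat.add_sub_cancel, Nat.sub_zero, add_zero, mul_assoc,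
        ← Finset.mul_sum]
      ring
    | succ r =>
      rw [estimateProb, ih, ih, ← hshift, ← hshift,
        entryWeight_eq_zero c k (Nat.succ_pos r), zero_mul, add_zero]
      simp only [entryWeight_succ_succ hc, Finset.mul_sum, ← Finset.sum_add_distrib,
        Finset.sum_div]
      exact Finset.sum_congr rfl fun i _ => by ring

/-- A node is added at most once; formally the same recursion is applied with the entry
probabilities replaced by one. -/
theorem sum_entryWeight_le_one {c : ℕ} (hc : 0 < c) (n k r : ℕ) :
    ∑ i ∈ Finset.range n, entryWeight c k r i ≤ 1 := by
  induction n generalizing k r with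
  | zero => simp
  | succ n ih =>
    have hpos : (0 : ℝ) < k * c + 2 := by positivity
    have h1 : (0 : ℝ) ≤ k * c + 1 := by positivity
    rw [Finset.sum_range_succ']
    cases r with
    | zero =>
      simp only [entryWeight_zero_succ hc, ← Finset.mul_sum, entryWeight_zero_zero hc]
      rw [div_mul_eq_mul_div, ← add_div, div_le_one hpos]
      have := mul_le_mul_of_nonneg_left (ih (k + 1) 0) h1
      linarith
    | succ r =>
      rw [entryWeight_eq_zero c k (Nat.succ_pos r), add_zero]
      simp only [entryWeight_succ_succ hc, ← Finset.sum_div, Finset.sum_add_distrib,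
        ← Finset.mul_sum]
      rw [div_le_one hpos]
      have := mul_le_mul_of_nonneg_left (ih (k + 1) (r + 1)) h1
      have := ih (k + 1) r
      linarith

theorem summable_entryWeight {c : ℕ} (hc : 0 < c) (k r : ℕ) :
    Summable fun i => entryWeight c k r i :=
  summable_of_sum_range_le (entryWeight_nonneg c k r) fun n => sum_entryWeight_le_one hc n k r

theorem p₁_eq_entryWeight {c : ℕ} (hc : 0 < c) (r i : ℕ) :
    p₁ (c + 2) (r + 1) (i + 2) = entryWeight c 1 r i := by
  have hc' : (0 : ℝ) < c := by exact_mod_cast hc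
  have e0 : ((c + 2 : ℕ) : ℝ) - 2 = c := by push_cast; ring
  rw [p₁, e0, entryWeight, shiftedHarmonic, show r + 1 - 1 = r by omega,
    show i + 2 - 2 = i by omega, show i + 2 - 1 = i + 1 by omega,
    show Finset.Icc 1 i = Finset.Ico 1 (1 + i) by
      ext j; simp only [Finset.mem_Icc, Finset.mem_Ico]; omega]
  congr 1
  -- The first factors `1 / c` and `2 / c` of the two rising factorials have quotient `1 / 2`, which
  -- cancels the prefactor `2` of `p₁`.
  rw [risingFactorial, risingFactorial, Finset.prod_range_succ', Finset.prod_range_succ' _ (i + 1),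
    Nat.cast_zero, add_zero, add_zero]
  have e1 : ∏ j ∈ Finset.range i, (1 / (c : ℝ) + (j + 1 : ℕ)) =
      ∏ j ∈ Finset.range i, (((1 : ℕ) : ℝ) + j + 1 / c) :=
    Finset.prod_congr rfl fun j _ => by push_cast; ring
  have e2 : ∏ j ∈ Finset.range (i + 1), (2 / (c : ℝ) + (j + 1 : ℕ)) =
      ∏ j ∈ Finset.range (i + 1), (((1 : ℕ) : ℝ) + j + 2 / c) :=
    Finset.prod_congr rfl fun j _ => by push_cast; ring
  rw [e1, e2]
  have h2 : ∏ j ∈ Finset.range (i + 1), (((1 : ℕ) : ℝ) + j + 2 / c) ≠ 0 :=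
    Finset.prod_ne_zero_iff.2 fun j _ => by positivity
  rw [one_div_pow]
  generalize ∏ j ∈ Finset.range i, (((1 : ℕ) : ℝ) + j + 1 / c) = A at *
  generalize ∏ j ∈ Finset.range (i + 1), (((1 : ℕ) : ℝ) + j + 2 / c) = B at *
  field_simp

/-- The probability that the node added to a network of `i + 1` nodes is at distance `r + 1` from
the source is at most one. -/
theorem card_mul_entryWeight_le_one {c : ℕ} (hc : 0 < c) (r i : ℕ) :
    ((c : ℝ) + 2) * (c + 1) ^ r * entryWeight c 1 r i ≤ 1 := by
  have hc' : (0 : ℝ) < c := by exact_mod_cast hc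
  -- One elementary symmetric sum is at most the whole product `∏ (1 + x_j)`. By `h2` below this
  -- product is exactly the inverse of the ratio `A / B` remaining in the weight.
  have h1 : ((c + 1) * (1 / (c : ℝ))) ^ r *
      ∑ J ∈ (Finset.Ico 1 (1 + i)).powersetCard r, ∏ j ∈ J, 1 / ((j : ℝ) + 1 / c) ≤
      ∏ j ∈ Finset.Ico 1 (1 + i), (1 + (1 + 1 / (c : ℝ)) / (j + 1 / c)) := by
    rw [Finset.prod_one_add, Finset.mul_sum]
    have e : ∀ J ∈ (Finset.Ico 1 (1 + i)).powersetCard r,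
        ((c + 1) * (1 / (c : ℝ))) ^ r * ∏ j ∈ J, 1 / ((j : ℝ) + 1 / c) =
        ∏ j ∈ J, (1 + 1 / (c : ℝ)) / (j + 1 / c) := by
      intro J hJ
      rw [← (Finset.mem_powersetCard.1 hJ).2, ← Finset.prod_const, ← Finset.prod_mul_distrib]
      refine Finset.prod_congr rfl fun j _ => ?_
      field_simp
    rw [Finset.sum_congr rfl e]
    refine Finset.sum_le_sum_of_subset_of_nonneg ?_ fun J _ _ =>
      Finset.prod_nonneg fun j _ => by positivity
    exact fun J hJ => Finset.mem_powerset.2 (Finset.mem_powersetCard.1 hJ).1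
  have h2 : ∏ j ∈ Finset.Ico 1 (1 + i), (1 + (1 + 1 / (c : ℝ)) / (j + 1 / c)) =
      (∏ j ∈ Finset.range i, (((1 : ℕ) : ℝ) + (j + 1 : ℕ) + 2 / c)) /
        ∏ j ∈ Finset.range i, (((1 : ℕ) : ℝ) + j + 1 / c) := by
    rw [Finset.prod_Ico_eq_prod_range, ← Finset.prod_div_distrib,
      show 1 + i - 1 = i by omega]
    refine Finset.prod_congr rfl fun j _ => ?_
    push_cast
    field_simp
    ring
  set A := ∏ j ∈ Finset.range i, (((1 : ℕ) : ℝ) + j + 1 / c) with hA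
  set B := ∏ j ∈ Finset.range i, (((1 : ℕ) : ℝ) + (j + 1 : ℕ) + 2 / c) with hB
  have hA0 : 0 < A := Finset.prod_pos fun j _ => by positivity
  have hB0 : 0 < B := Finset.prod_pos fun j _ => by positivity
  have h3 : ∏ j ∈ Finset.range (i + 1), (((1 : ℕ) : ℝ) + j + 2 / c) =
      B * (((1 : ℕ) : ℝ) + (0 : ℕ) + 2 / c) := Finset.prod_range_succ' _ _
  rw [h2] at h1
  rw [entryWeight, h3]
  set Z := ∑ J ∈ (Finset.Ico 1 (1 + i)).powersetCard r, ∏ j ∈ J, 1 / ((j : ℝ) + 1 / c)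
  -- The factor `c + 2` and one `1 / c` cancel the first denominator factor `1 + 2 / c`.
  have h4 : ((c : ℝ) + 2) * (c + 1) ^ r * ((1 / (c : ℝ)) ^ (r + 1) *
      (A / (B * (((1 : ℕ) : ℝ) + (0 : ℕ) + 2 / c))) * Z) =
      A / B * (((c + 1) * (1 / (c : ℝ))) ^ r * Z) := by
    rw [mul_pow, pow_succ]
    push_cast
    field_simp
    ring
  rw [h4]
  calc _ ≤ A / B * (B / A) := mul_le_mul_of_nonneg_left h1 (by positivity)
    _ = 1 := by field_simp

end EntryWeight

/-! ### Passage to the limit and the tail estimate. -/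

section Limit

theorem sum_add_three_mul_half_pow_le (M n : ℕ) :
    ∑ i ∈ Finset.range n, ((i + M + 1 : ℕ) + 2 : ℝ) * (1 / 2) ^ (i + M + 1) ≤
      ((M : ℝ) + 4) * (1 / 2) ^ M := by
  -- Telescoping through `(j + 2) 2⁻ʲ = (j + 3) 2⁻⁽ʲ⁻¹⁾ - (j + 4) 2⁻ʲ`.
  have h : ∑ i ∈ Finset.range n, ((i + M + 1 : ℕ) + 2 : ℝ) * (1 / 2) ^ (i + M + 1) =
      ((M : ℝ) + 4) * (1 / 2) ^ M - (n + M + 4) * (1 / 2) ^ (n + M) := by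
    induction n with
    | zero => simp
    | succ n ih =>
      rw [Finset.sum_range_succ, ih, show n + 1 + M = n + M + 1 by ring, pow_succ]
      push_cast
      ring
  rw [h]
  exact sub_le_self _ (by positivity)

theorem half_pow_le_eps {m : ℕ} (hm : 1 ≤ m) :
    (((m - 1 : ℕ) : ℝ) + 4) * (1 / 2) ^ (m - 1) ≤ eps m := by
  obtain ⟨M, rfl⟩ := Nat.exists_eq_add_of_le' hm
  have h1 : (1 : ℝ) ≤ Real.exp 1 ^ 2 := one_le_pow₀ (Real.one_le_exp zero_le_one)
  have h2 : (2 : ℝ) ^ (-((M + 1 : ℕ) : ℤ) + 3) = 4 * (1 / 2) ^ M := by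
    rw [show -((M + 1 : ℕ) : ℤ) + 3 = 2 - (M : ℤ) by push_cast; ring, zpow_sub₀ two_ne_zero,
      zpow_natCast, one_div, inv_pow, div_eq_mul_inv]
    norm_num
  rw [eps, h2, Nat.add_sub_cancel]
  have h3 : (0 : ℝ) < (1 / 2) ^ M := by positivity
  have h4 : (M : ℝ) + 4 ≤ (8 + 5 * ((M + 1 : ℕ) : ℝ) + ((M + 1 : ℕ) : ℝ) ^ 2) * 4 := by
    push_cast
    nlinarith [(Nat.cast_nonneg M : (0 : ℝ) ≤ M)]
  calc ((M : ℝ) + 4) * (1 / 2) ^ M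
      ≤ ((8 + 5 * ((M + 1 : ℕ) : ℝ) + ((M + 1 : ℕ) : ℝ) ^ 2) * 4) * (1 / 2) ^ M :=
        mul_le_mul_of_nonneg_right h4 h3.le
    _ ≤ Real.exp 1 ^ 2 * (((8 + 5 * ((M + 1 : ℕ) : ℝ) + ((M + 1 : ℕ) : ℝ) ^ 2) * 4) *
        (1 / 2) ^ M) := le_mul_of_one_le_left (by positivity) h1
    _ = _ := by ring

/-- Dominated convergence for series: extended by zero beyond `n`, the terms are bounded by the
summable entry weights, and for fixed `i` the number of remaining steps tends to infinity. -/
theorem tendsto_estimateProb {c : ℕ} (hc : 0 < c)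
    (hentry : ∀ n k, entryProb c n (k + 1) ∈ Set.Icc (0 : ℝ) 1) (r : ℕ) :
    Tendsto (fun n => estimateProb c n 1 r) atTop
      (𝓝 (∑' i, entryWeight c 1 r i * p₂ (c + 2) (i + 2))) := by
  have h1 : ∀ n, estimateProb c n 1 r = ∑' i, if i < n then
      entryWeight c 1 r i * entryProb c (n - 1 - i) (i + 1) else 0 := by
    intro n
    rw [estimateProb_eq_sum hc, tsum_eq_sum (s := Finset.range n)]
    · refine Finset.sum_congr rfl fun i hi => ?_
      rw [if_pos (Finset.mem_range.1 hi), add_comm 1 i]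
    · intro i hi
      rw [if_neg (mt Finset.mem_range.2 hi)]
  simp only [h1]
  refine tendsto_tsum_of_dominated_convergence (summable_entryWeight hc 1 r) (fun i => ?_) ?_
  · have h2 : Tendsto (fun n => n - 1 - i) atTop atTop :=
      (tendsto_sub_atTop_nat i).comp (tendsto_sub_atTop_nat 1)
    refine Tendsto.congr' ?_ (((tendsto_entryProb hc (i + 1)).comp h2).const_mul _)
    filter_upwards [eventually_gt_atTop i] with n hn
    rw [if_pos hn]
    rfl
  · refine Eventually.of_forall fun n i => ?_
    split_ifs
    · have h3 := hentry (n - 1 - i) i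
      rw [Real.norm_of_nonneg (mul_nonneg (entryWeight_nonneg _ _ _ _) h3.1)]
      exact mul_le_of_le_one_right (entryWeight_nonneg _ _ _ _) h3.2
    · simpa using entryWeight_nonneg c 1 r i

/-- With `k = i + 2` the sum may start at `i = 0` instead of `i = r`, because a node at distance `r
+ 1` cannot be added with fewer than `r` earlier additions. -/
theorem g_eq {c : ℕ} (hc : 0 < c) (r : ℕ) {m : ℕ} (hm : r + 2 ≤ m) :
    g (c + 2) (r + 1) m = ((c : ℝ) + 2) * (c + 1) ^ r *
      ∑ i ∈ Finset.range (m - 1), entryWeight c 1 r i * p₂ (c + 2) (i + 2) := by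
  have e1 : ((c + 2 : ℕ) : ℝ) - 1 = c + 1 := by push_cast; ring
  rw [g, e1, show r + 1 - 1 = r by omega]
  congr 1
  · push_cast
    ring
  have h1 : Finset.Icc (r + 1 + 1) m = Finset.Ico (r + 2) (m - 1 + 2) := by
    ext j
    simp only [Finset.mem_Icc, Finset.mem_Ico]
    omega
  rw [h1, ← Finset.sum_Ico_add', Finset.range_eq_Ico]
  symm
  rw [← Finset.sum_subset (Finset.Ico_subset_Ico_left (Nat.zero_le r))]
  · exact Finset.sum_congr rfl fun i _ => by rw [p₁_eq_entryWeight hc]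
  · intro i hi hi'
    rw [Finset.mem_Ico] at hi hi'
    rw [entryWeight_eq_zero c 1 (by omega), zero_mul]

/-- The difference is the tail of a nonnegative series. The number of nodes times the entry weight
is at most one, so the tail of the bounds on `p₂` suffices. -/
theorem limit_sub_g_mem_Icc {c : ℕ} (hc : 0 < c)
    (hp : ∀ i, p₂ (c + 2) (i + 2) ∈ Set.Icc (0 : ℝ) 1) (r : ℕ) {m : ℕ} (hm : r + 2 ≤ m) :
    ((c : ℝ) + 2) * (c + 1) ^ r * ∑' i, entryWeight c 1 r i * p₂ (c + 2) (i + 2) -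
      g (c + 2) (r + 1) m ∈ Set.Icc 0 (eps m) := by
  have hw := entryWeight_nonneg c 1 r
  have hsum : Summable fun i => entryWeight c 1 r i * p₂ (c + 2) (i + 2) :=
    Summable.of_nonneg_of_le (fun i => mul_nonneg (hw i) (hp i).1)
      (fun i => mul_le_of_le_one_right (hw i) (hp i).2) (summable_entryWeight hc 1 r)
  rw [g_eq hc r hm, ← mul_sub, ← hsum.sum_add_tsum_nat_add (m - 1), add_sub_cancel_left,
    ← tsum_mul_left]
  have hN : (0 : ℝ) ≤ (c + 2) * (c + 1) ^ r := by positivity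
  refine ⟨tsum_nonneg fun i => mul_nonneg hN (mul_nonneg (hw _) (hp _).1),
    le_trans ?_ (half_pow_le_eps (by omega))⟩
  refine Real.tsum_le_of_sum_range_le
    (fun i => mul_nonneg hN (mul_nonneg (hw _) (hp _).1)) fun n => ?_
  refine le_trans (Finset.sum_le_sum fun i _ => ?_) (sum_add_three_mul_half_pow_le (m - 1) n)
  rw [← mul_assoc]
  refine (mul_le_of_le_one_left (hp _).1 (card_mul_entryWeight_le_one hc r _)).trans ?_
  exact p₂_le hc (Nat.succ_pos _)

end Limit

end RumorSource

theorem theorem3 {V Ω : Type*} [MeasurableSpace Ω]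
    (P : Measure Ω) [IsProbabilityMeasure P]
    (G : SimpleGraph V) [G.LocallyFinite] (hG : G.IsTree)
    (δ : ℕ) (hδ : 3 ≤ δ) (hreg : G.IsRegularOfDegree δ)
    (v₁ : V)
    -- the spreading times: independent, exponentially distributed with unit mean
    (τ : G.Dart → Ω → ℝ) (hτ_meas : ∀ e, Measurable (τ e))
    (hτ_indep : iIndepFun τ P) (hτ_law : ∀ e, P.map (τ e) = expMeasure 1)
    -- the maximum likelihood estimate from the network of `n` infected nodes
    (Vhat : ℕ → Ω → V)
    (hVhat : ∀ n, 1 ≤ n → RumorSource.IsMLEstimate P τ v₁ n (Vhat n))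
    (d : ℕ) (hd : 1 ≤ d) :
    ∃ D : ℝ,
      Tendsto (fun n => RumorSource.distProb G P v₁ (Vhat n) d) atTop (𝓝 D) ∧
      ∀ m : ℕ, d + 1 ≤ m →
        0 ≤ D - RumorSource.g δ d m ∧ D - RumorSource.g δ d m ≤ RumorSource.eps m := by
  obtain ⟨c, rfl⟩ := Nat.exists_eq_add_of_le' (show 2 ≤ δ by omega)
  obtain ⟨r, rfl⟩ := Nat.exists_eq_add_of_le' hd
  have hc : 0 < c := by omega
  have hentry := RumorSource.entryProb_mem_Icc hG hreg
  -- As limits of probabilities, the values of `p₂` lie in `[0, 1]`.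
  have hp : ∀ i, RumorSource.p₂ (c + 2) (i + 2) ∈ Set.Icc (0 : ℝ) 1 := fun i =>
    isClosed_Icc.mem_of_tendsto (RumorSource.tendsto_entryProb hc (i + 1))
      (Eventually.of_forall fun n => hentry n i)
  refine ⟨((c : ℝ) + 2) * (c + 1) ^ r *
    ∑' i, RumorSource.entryWeight c 1 r i * RumorSource.p₂ (c + 2) (i + 2), ?_,
    fun m hm => RumorSource.limit_sub_g_mem_Icc hc hp r hm⟩
  -- A network of `n + 1` nodes arises after `n` growth steps. All nodes at distance `r + 1`
  -- contribute equally, which produces the factor `(c + 2) (c + 1) ^ r`.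
  rw [← tendsto_add_atTop_iff_nat 1]
  refine ((RumorSource.tendsto_estimateProb hc hentry r).const_mul _).congr fun n => ?_
  rw [RumorSource.distProb_eq P hG (by omega) hreg τ hτ_meas hτ_indep hτ_law
    (hVhat (n + 1) (by omega)) (r + 1),
    Finset.sum_congr rfl (g := fun _ => RumorSource.estimateProb c n 1 r), Finset.sum_const,
    RumorSource.card_sphere hG hreg, nsmul_eq_mul, show c + 2 - 1 = c + 1 by omega]
  · push_cast
    ring
  · intro v hv
    rw [RumorSource.mem_sphere hG] at hv
    rw [RumorSource.grow_iterate_div_orderCount,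
      RumorSource.stepAverage_iterate_singleton hG hreg n hv]
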